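/- Let $d\in\mathbb N$, and for $L>0$ let $\Lambda_L=[-L/2,L/2)^d$ and $\Lambda_L^*=(L^{-1}\mathbb Z)^d$. For $f\in L^2(\Lambda_L)$ put $\hat f(p)=\int_{\Lambda_L}e^{-2\pi i p\cdot x}f(x)\,dx$ ($p\in\Lambda_L^*$), for $g$ with $\sum_{p}|g(p)|^2<\infty$ put $\check g=|\Lambda_L|^{-1}\sum_{p\in\Lambda_L^*}g(p)e^{2\pi i p\cdot(\cdot)}$ (convergence in $L^2(\Lambda_L)$), and let $\nu(p)=\frac12|p|^2$. The negative periodic Laplacian $-\Delta_L$ on $L^2(\Lambda_L)$ has domain $\{f:\nu\hat f\in\ell^2(\Lambda_L^*)\}$ and acts by $-\Delta_L f=2(2\pi)^2(\nu\hat f)^{\vee}$. For $z\in\mathbb C\setminus[0,\infty)$ let $$R_L(z)=\Big(-\tfrac{1}{2(2\pi)^2}\Delta_L-z\Big)^{-1}.$$ For a function $h$ on $\mathbb R^d$ let $h_\#$ be the $L$-periodic extension of $h|_{\Lambda_L}$. For $\psi\in L^2(\mathbb R^d)$, $\psi_\#$ is regarded as an element of $L^2(\Lambda_L)$. Let $B:\mathbb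 R^d\to\mathbb R$ be a Schwartz function which either has compact support or is invariant under each coordinate reflection $x_j\mapsto -x_j$, $j=1,\dots,d$. Let $\mathbf P_v$ be a probability measure on $\mathbb R$ all of whose moments $\int v^k\,d\mathbf P_v(v)$, $k\in\mathbb N$, are finite. Let $M$ be a Poisson random variable with mean $|\Lambda_L|$, let $y_1,y_2,\dots$ be i.i.d. uniformly distributed on $\Lambda_L$, let $v_1,v_2,\dots$ be i.i.d. with law $\mathbf P_v$, with $M$, $(y_\gamma)$ and $(v_\gamma)$ independent, and denote by $\mathbf E_L$ the expectation with respect to their joint law. Let $V_L$ be the operator of multiplication by $$V_L(x)=\sum_{\gamma=1}^{M}v_\gamma B_\#(x-y_\gamma)$$ on $L^2(\Lambda_L)$. For $n\in\mathbb N=\{0,1,2,\dots\}$, $z\in\mathbb C\setminus[0,\infty)$ and $\psi_1,\psi_2\in L^2(\mathbb R^d)$ set $$T_{n,L}[z;\psi_1,\psi_2]=\mathbf E_L\big\langle\psi_{1,\#},R_L(z)[V_LR_L(z)]^n\psi_{2,\#}\big\rangle_{L^2(\Lambda_L)},$$ where the inner product is conjugate linear in its first argument. **Theorem.** Let $n\in\mathbb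 N$. The random variable in the definition of $T_{n,L}[z;\psi_1,\psi_2]$ is integrable for all $L>0$, $z\in\mathbb C\setminus[0,\infty)$ and $\psi_1,\psi_2\in L^2(\mathbb R^d)$. For all $z\in\mathbb C\setminus[0,\infty)$ and $\psi_1,\psi_2\in L^2(\mathbb R^d)$ the limit $\lim_{L\to\infty}T_{n,L}[z;\psi_1,\psi_2]$ exists in $\mathbb C$. There exists a constant $K_n$ (depending only on $n$, $d$, $B$ and $\mathbf P_v$) such that $$|T_{n,L}[z;\psi_1,\psi_2]|\le\frac{K_n\,\|\psi_1\|\,\|\psi_2\|}{\operatorname{dist}(z,[0,\infty))^{n+1}}$$ for all $L\ge1$, $z\in\mathbb C\setminus[0,\infty)$ and $\psi_1,\psi_2\in L^2(\mathbb R^d)$. -/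

import Mathlib

open MeasureTheory ProbabilityTheory Filter Topology
open scoped SchwartzMap ENNReal NNReal

noncomputable section

namespace PoissonSchrodinger

/-- Euclidean space of dimension `d`. -/
abbrev E (d : ℕ) : Type := EuclideanSpace ℝ (Fin d)

/-- The half-open box `[-L/2, L/2)^d`. -/
def box (d : ℕ) (L : ℝ) : Set (E d) := {x | ∀ j, -(L / 2) ≤ x j ∧ x j < L / 2}

/-- The Hilbert space `L²` of the box, with respect to Lebesgue measure. -/
abbrev L2Box (d : ℕ) (L : ℝ) : Type := Lp ℂ 2 ((volume : Measure (E d)).restrict (box d L))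

/-- The Hilbert space `L²(ℝ^d)`. -/
abbrev L2Space (d : ℕ) : Type := Lp ℂ 2 (volume : Measure (E d))

/-- The point of the dual lattice `((1/L) ℤ)^d` with integer label `m`. -/
def dualPoint {d : ℕ} (L : ℝ) (m : Fin d → ℤ) : E d := WithLp.toLp 2 (fun j => (m j : ℝ) / L)

/-- The energy function `ν(p) = |p|² / 2`. -/
def energy {d : ℕ} (p : E d) : ℝ := ‖p‖ ^ 2 / 2

/-- The Fourier coefficient `f̂(p) = ∫_{box} e^{-2πi p·x} f(x) dx`, `p` in the dual lattice. -/
def fourierCoeffBox {d : ℕ} {L : ℝ} (f : L2Box d L) (m : Fin d → ℤ) : ℂ :=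
  ∫ x in box d L, Complex.exp (-(2 * Real.pi * Complex.I * (inner ℝ (dualPoint L m) x : ℝ))) * f x

theorem volume_box_lt_top (d : ℕ) (L : ℝ) : volume (box d L) < ⊤ := by
  have hK : IsCompact ((WithLp.toLp 2 : (Fin d → ℝ) → E d) ''
      Set.Icc (fun _ => -(L / 2)) (fun _ => L / 2)) :=
    isCompact_Icc.image (PiLp.continuous_toLp 2 _)
  refine lt_of_le_of_lt (measure_mono ?_) hK.measure_lt_top
  intro x hx
  exact ⟨x.ofLp, ⟨fun j => (hx j).1, fun j => (hx j).2.le⟩, rfl⟩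

theorem memLp_planeWave {d : ℕ} (L : ℝ) (m : Fin d → ℤ) :
    MemLp (fun x : E d => Complex.exp (2 * Real.pi * Complex.I * (inner ℝ (dualPoint L m) x : ℝ)))
      2 (volume.restrict (box d L)) := by
  have : IsFiniteMeasure ((volume : Measure (E d)).restrict (box d L)) :=
    ⟨by simpa using volume_box_lt_top d L⟩
  refine MemLp.of_bound (Continuous.aestronglyMeasurable (by fun_prop)) 1
    (Eventually.of_forall fun x => ?_)
  rw [Complex.norm_exp]
  simp

/-- The plane wave `x ↦ e^{2πi p·x}` as an element of `L²` of the box. -/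
def planeWave {d : ℕ} (L : ℝ) (m : Fin d → ℤ) : L2Box d L := (memLp_planeWave L m).toLp

/-- The inverse Fourier transform `ǧ(x) = |box|⁻¹ ∑_p g(p) e^{2πi p·x}` of a square summable
family `g` on the dual lattice; the series converges in `L²` of the box. -/
def fourierInvBox {d : ℕ} {L : ℝ} (g : (Fin d → ℤ) → ℂ) : L2Box d L :=
  ∑' m, (((volume.real (box d L))⁻¹ : ℝ) * g m : ℂ) • planeWave L m

/-- The domain `{f ∈ L² : ν f̂ ∈ ℓ²}` of the periodic Laplacian. -/
def laplacianDomain (d : ℕ) (L : ℝ) : Set (L2Box d L) :=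
  {f | Memℓp (fun m => (energy (dualPoint L m) : ℂ) * fourierCoeffBox f m) 2}

/-- The negative periodic Laplacian `-Δ_L`: in Fourier space, multiplication by
`|2πp|² = 2 (2π)² ν(p)`. It is meaningful on `laplacianDomain d L` only. -/
def negLaplacian {d : ℕ} {L : ℝ} (f : L2Box d L) : L2Box d L :=
  ((2 * (2 * Real.pi) ^ 2 : ℝ) : ℂ) •
    fourierInvBox (fun m => (energy (dualPoint L m) : ℂ) * fourierCoeffBox f m)

/-- The kinetic energy `-(ħ²/2m) Δ_L` in units with `ħ²/2m = 1 / (2 (2π)²)`. -/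
def kinetic {d : ℕ} {L : ℝ} (f : L2Box d L) : L2Box d L :=
  (((2 * (2 * Real.pi) ^ 2)⁻¹ : ℝ) : ℂ) • negLaplacian f

/-- The free resolvent `R_L(z) = (-(ħ²/2m) Δ_L - z)⁻¹`: it sends `f` to the `u` in the domain of
the Laplacian with `-(ħ²/2m) Δ_L u - z u = f` (which exists and is unique for `z ∉ [0,∞)`). -/
def freeResolvent {d : ℕ} {L : ℝ} (z : ℂ) : L2Box d L → L2Box d L :=
  Function.invFunOn (fun u => kinetic u - z • u) (laplacianDomain d L)

/-- The representative of `x` in the box modulo `L ℤ^d`. -/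
def wrap {d : ℕ} (L : ℝ) (x : E d) : E d :=
  WithLp.toLp 2 (fun j => x j - L * (⌊x j / L + 1 / 2⌋ : ℝ))

/-- The `L`-periodic extension `h_#` of the restriction of `h` to the box. -/
def periodize {d : ℕ} {α : Type*} (L : ℝ) (h : E d → α) (x : E d) : α := h (wrap L x)

/-- The restriction to the box of `ψ ∈ L²(ℝ^d)`; this is `ψ_#` as an element of `L²` of the box. -/
def restrictBox {d : ℕ} (L : ℝ) (ψ : L2Space d) : L2Box d L :=
  LpToLpRestrictCLM (E d) ℂ ℂ volume 2 (box d L) ψ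

/-- A realization of the marked point process: the number `M` of points, their positions
`y_1, …, y_M` and their weights `v_1, …, v_M`. -/
abbrev Config (d : ℕ) : Type := Σ M : ℕ, (Fin M → E d) × (Fin M → ℝ)

/-- The joint law of `M`, the positions and the weights: `M` is Poisson with mean `|box|`, and,
given `M`, the positions are i.i.d. uniform on the box, the weights are i.i.d. with law `Pv`, and
positions and weights are independent. -/
def configLaw (d : ℕ) (L : ℝ) (Pv : Measure ℝ) : Measure (Config d) :=
  Measure.sum fun M : ℕ =>
    (poissonMeasure (volume (box d L)).toNNReal {M}) •
      Measure.map (Sigma.mk M)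
        ((Measure.pi fun _ : Fin M => ProbabilityTheory.cond volume (box d L)).prod
          (Measure.pi fun _ : Fin M => Pv))

/-- The random potential `V_{L,ω}(x) = ∑_γ v_γ B_#(x - y_γ)`, i.e. the integral of `B_#(x - ·)`
against the point measure `∑_γ v_γ δ_{y_γ}`. -/
def potential {d : ℕ} (B : 𝓢(E d, ℝ)) (L : ℝ) (ω : Config d) (x : E d) : ℝ :=
  ∑ γ : Fin ω.1, ω.2.2 γ * periodize L B (x - ω.2.1 γ)

open Classical in
/-- Multiplication by the function `W` on `L²` of the box (everywhere defined when `W` is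
measurable and bounded, the only case of use). -/
def mulOp {d : ℕ} {L : ℝ} (W : E d → ℝ) (f : L2Box d L) : L2Box d L :=
  if h : MemLp (fun x => (W x : ℂ) * f x) 2 (volume.restrict (box d L)) then h.toLp else 0

/-- The random variable `⟨ψ₁_#, R_L(z) [V_L R_L(z)]^n ψ₂_#⟩`. -/
def matrixElement {d : ℕ} (B : 𝓢(E d, ℝ)) (n : ℕ) (L : ℝ) (z : ℂ) (ψ₁ ψ₂ : L2Space d)
    (ω : Config d) : ℂ :=
  inner ℂ (restrictBox L ψ₁)
    (freeResolvent z ((fun f => mulOp (potential B L ω) (freeResolvent z f))^[n]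
      (restrictBox L ψ₂)))

/-- The expansion coefficient
`T_{n,L}[z; ψ₁, ψ₂] = E_L ⟨ψ₁_#, R_L(z) [V_L R_L(z)]^n ψ₂_#⟩`. -/
def expansionCoeff {d : ℕ} (B : 𝓢(E d, ℝ)) (Pv : Measure ℝ) (n : ℕ) (L : ℝ) (z : ℂ)
    (ψ₁ ψ₂ : L2Space d) : ℂ :=
  ∫ ω, matrixElement B n L z ψ₁ ψ₂ ω ∂(configLaw d L Pv)

/-- The closed half line `[0,∞)` in the complex plane. -/
def halfLine : Set ℂ := Complex.ofReal '' Set.Ici 0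

/-- Reflection of the `j`-th coordinate. -/
def reflect {d : ℕ} (j : Fin d) (x : E d) : E d :=
  WithLp.toLp 2 (Function.update x.ofLp j (-(x j)))

end PoissonSchrodinger

end

/-! The potential is a sum `V = ∑ A p` of multiplication operators over the points `p = (y, v)` of a
Poisson process, and expectations of `R (V R)^n ψ` are computed in the Fock space of that process. A
vector-valued functional `F` of the configuration has components `h` indexed by finite lists of
points and determined by `E F(t ++ l) = ∑ h(s)`, the sum running over the sublists `s` of `l`. The
component at `[]` is the expectation. Multiplying `F` by `V` acts on the components as `fieldStep`:
a point is kept or created (`numberOp`), a point is annihilated (`∫ A p (h (p :: l))`), or the mean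
field `∫ A p` acts. `poissonMean_dyson` proves this by induction on `n`. Its inputs are the Mecke
formula `poissonMean_fieldSum` and the identity `sublistSum_numberOp`.

The volume enters the bare expectation through the number of points, but it does not enter the
component estimates. Creation is bounded in `L²` over the new point by the Hilbert-Schmidt type
estimate `∫ ‖A p f‖² dp ≤ b² ‖f‖²`. Annihilation is its adjoint and has the same constant. Keeping a
point costs a power of the mark, which the weights `weight w l ^ j` absorb, so all `j` are treated
together. The mean field is multiplication by a bounded function. Each order adds one factor `‖R‖ ≤
1 / dist(z, [0,∞))`, and `exists_chaosNorm_chaos_le` gives the uniform bound.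

For the limit every operator is extended by zero to `L²(ℝ^d)`, and the reference measure on points
is Lebesgue measure times the law of the marks, independently of the volume. If the resolvents, the
single-point operators and the mean field are strongly Cauchy, and the fields are Cauchy in the
square-mean sense, then all components are Cauchy (`chaosNorm_chaos_sub_tendsto`), because each step
is uniformly Lipschitz.

These inputs are then verified. The free resolvent is a Fourier multiplier. Its inner products and
norms on compactly supported Schwartz functions are Riemann sums over the dual lattice, so weak
convergence and convergence of norms give strong convergence. For the interaction, `y ↦ wrap L (x -
y)` preserves Lebesgue measure on the box, by invariance of Haar measure on the torus. Hence the
square integral of the periodized kernel over impurity positions equals `∫ B²` over the box. This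
gives the uniform bound, and expanding the square gives the convergence `tendsto_lintegral_sub`. -/

set_option linter.unusedSectionVars false

noncomputable section

namespace PoissonChaos

/-! ### Algebra of operators and vectors indexed by finite lists of points. -/

section Algebra

variable {P 𝓗 : Type*} [NormedAddCommGroup 𝓗] [InnerProductSpace ℂ 𝓗]

/-- The sum of the operators `A p` over a finite list of points. -/
def fieldSum (A : P → 𝓗 →L[ℂ] 𝓗) (l : List P) : 𝓗 →L[ℂ] 𝓗 := (l.map A).sum

/-- The sum of `h` over all sublists. -/
def sublistSum : List P → (List P → 𝓗) → 𝓗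
  | [], h => h []
  | p :: l, h => sublistSum l h + sublistSum l (fun t => h (p :: t))

/-- The part of the field operator that keeps or creates a point: the sum over the points `p` of
the list of `A p` applied to `h` at the list with and without `p`. -/
def numberOp (A : P → 𝓗 →L[ℂ] 𝓗) : List P → (List P → 𝓗) → 𝓗
  | [], _ => 0
  | p :: l, h => A p (h (p :: l) + h l) + numberOp A l (fun t => h (p :: t))

/-- The product of the weights of a list of points. -/
def weight (w : P → ℝ) (l : List P) : ℝ := (l.map w).prod

@[simp] theorem fieldSum_nil (A : P → 𝓗 →L[ℂ] 𝓗) : fieldSum A [] = 0 := rfl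

@[simp] theorem fieldSum_cons (A : P → 𝓗 →L[ℂ] 𝓗) (p : P) (l : List P) :
    fieldSum A (p :: l) = A p + fieldSum A l := by simp [fieldSum]

theorem fieldSum_append (A : P → 𝓗 →L[ℂ] 𝓗) (l l' : List P) :
    fieldSum A (l ++ l') = fieldSum A l + fieldSum A l' := by simp [fieldSum]

@[simp] theorem weight_nil (w : P → ℝ) : weight w [] = 1 := rfl

@[simp] theorem weight_cons (w : P → ℝ) (p : P) (l : List P) :
    weight w (p :: l) = w p * weight w l := by simp [weight]

theorem weight_append (w : P → ℝ) (l l' : List P) :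
    weight w (l ++ l') = weight w l * weight w l' := by simp [weight]

theorem weight_ofFn (w : P → ℝ) {k : ℕ} (q : Fin k → P) :
    weight w (List.ofFn q) = ∏ i, w (q i) := by
  simp [weight, List.map_ofFn, List.prod_ofFn]

theorem weight_ofFn_succAbove (w : P → ℝ) {k : ℕ} (q : Fin (k + 1) → P) (i : Fin (k + 1)) :
    weight w (List.ofFn q) = w (q i) * weight w (List.ofFn (i.removeNth q)) := by
  simp only [weight_ofFn, Fin.prod_univ_succAbove _ i, Fin.removeNth]

theorem one_le_weight {w : P → ℝ} (hw : ∀ p, 2 ≤ w p) (l : List P) : 1 ≤ weight w l := by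
  induction l with
  | nil => simp
  | cons p l ih => rw [weight_cons]; nlinarith [hw p]

theorem weight_pos {w : P → ℝ} (hw : ∀ p, 2 ≤ w p) (l : List P) : 0 < weight w l :=
  zero_lt_one.trans_le (one_le_weight hw l)

/-- For reals `a, b ≥ 2` one has `a + b ≤ a * b`. This is why weights are required to be at least
`2`: sums over points are then controlled by the multiplicative weight. -/
theorem sum_le_weight {w : P → ℝ} (hw : ∀ p, 2 ≤ w p) (l : List P) :
    (l.map w).sum ≤ weight w l := by
  induction l with
  | nil => simp
  | cons p l ih =>
    rw [weight_cons, List.map_cons, List.sum_cons]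
    rcases l with _ | ⟨p', l⟩
    · simp
    · have h1 : 2 ≤ weight w (p' :: l) := by
        rw [weight_cons]; nlinarith [hw p', one_le_weight hw l]
      nlinarith [hw p]

theorem fieldSum_ofFn (A : P → 𝓗 →L[ℂ] 𝓗) {k : ℕ} (q : Fin k → P) :
    fieldSum A (List.ofFn q) = ∑ i, A (q i) := by
  simp [fieldSum, List.map_ofFn, List.sum_ofFn]

theorem fieldSum_ofFn_succAbove (A : P → 𝓗 →L[ℂ] 𝓗) {k : ℕ} (q : Fin (k + 1) → P)
    (i : Fin (k + 1)) :
    fieldSum A (List.ofFn q) = A (q i) + fieldSum A (List.ofFn (i.removeNth q)) := by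
  simp only [fieldSum_ofFn, Fin.sum_univ_succAbove _ i, Fin.removeNth]

theorem norm_fieldSum_apply_le {A : P → 𝓗 →L[ℂ] 𝓗} {w : P → ℝ} {c : ℝ} (hc : 0 ≤ c)
    (hw : ∀ p, 2 ≤ w p) (hA : ∀ p f, ‖A p f‖ ≤ c * w p * ‖f‖) (l : List P) (f : 𝓗) :
    ‖fieldSum A l f‖ ≤ c * weight w l * ‖f‖ := by
  have h : ‖fieldSum A l f‖ ≤ c * (l.map w).sum * ‖f‖ := by
    induction l with
    | nil => simp
    | cons p l ih =>
      rw [fieldSum_cons, List.map_cons, List.sum_cons]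
      refine (norm_add_le _ _).trans ((add_le_add (hA p f) ih).trans (le_of_eq (by ring)))
  refine h.trans ?_
  gcongr
  exact sum_le_weight hw l

theorem sublistSum_add (l : List P) (h h' : List P → 𝓗) :
    sublistSum l (fun t => h t + h' t) = sublistSum l h + sublistSum l h' := by
  induction l generalizing h h' with
  | nil => rfl
  | cons p l ih => simp only [sublistSum, ih]; abel

theorem map_sublistSum (T : 𝓗 →L[ℂ] 𝓗) (l : List P) (h : List P → 𝓗) :
    T (sublistSum l h) = sublistSum l (fun t => T (h t)) := by
  induction l generalizing h with
  | nil => rfl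
  | cons p l ih => simp only [sublistSum, map_add, ih]

/-- Fix a point `p` of `l` and sum over the sublists containing it. The pairs "with `p`" and
"without `p`" then exhaust all sublists, so `A p` acts on the full sublist sum. Thus multiplication
by the field at the points of `l` becomes `numberOp` on components. -/
theorem sublistSum_numberOp (A : P → 𝓗 →L[ℂ] 𝓗) (l : List P) (h : List P → 𝓗) :
    sublistSum l (fun t => numberOp A t h) = fieldSum A l (sublistSum l h) := by
  induction l generalizing h with
  | nil => simp [sublistSum, numberOp]
  | cons p l ih =>
    simp only [sublistSum, numberOp, sublistSum_add, ih, fieldSum_cons, map_add,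
      add_apply, map_sublistSum]
    abel

theorem sublistSum_integrable {Q : Type*} [MeasurableSpace Q] {μ : Measure Q} (l : List P)
    (h : Q → List P → 𝓗) (hi : ∀ t, Integrable (fun p => h p t) μ) :
    Integrable (fun p => sublistSum l (h p)) μ := by
  induction l generalizing h with
  | nil => exact hi []
  | cons a l ih => exact (ih h hi).add (ih (fun p t => h p (a :: t)) fun t => hi _)

theorem integral_sublistSum {Q : Type*} [MeasurableSpace Q] {μ : Measure Q} (l : List P)
    (h : Q → List P → 𝓗) (hi : ∀ t, Integrable (fun p => h p t) μ) :
    ∫ p, sublistSum l (h p) ∂μ = sublistSum l (fun t => ∫ p, h p t ∂μ) := by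
  induction l generalizing h with
  | nil => rfl
  | cons a l ih =>
    simp only [sublistSum]
    rw [integral_add (sublistSum_integrable l h hi)
      (sublistSum_integrable l (fun p t => h p (a :: t)) fun t => hi _), ih h hi,
      ih (fun p t => h p (a :: t)) fun t => hi _]

/-- The list recursion suits `sublistSum`, while integration over `Fin k → P` needs a closed form in
which each coordinate can be singled out. -/
theorem numberOp_ofFn_succ (A : P → 𝓗 →L[ℂ] 𝓗) (h : List P → 𝓗) {k : ℕ}
    (q : Fin (k + 1) → P) :
    numberOp A (List.ofFn q) h = ∑ i, A (q i) (h (List.ofFn q) + h (List.ofFn (i.removeNth q))) := by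
  induction k generalizing h with
  | zero =>
    simp [List.ofFn_succ, numberOp]
  | succ k ih =>
    obtain ⟨p, q, rfl⟩ : ∃ p q', q = Fin.cons p q' := ⟨q 0, Fin.tail q, (Fin.cons_self_tail q).symm⟩
    rw [List.ofFn_cons, numberOp, ih]
    conv_rhs => rw [Fin.sum_univ_succ]
    have hrem (i : Fin (k + 1)) : (i.succ).removeNth (Fin.cons p q : Fin (k + 2) → P)
        = Fin.cons p (i.removeNth q) := by
      funext j
      refine Fin.cases ?_ (fun j => ?_) j <;> simp [Fin.removeNth]
    simp only [Fin.cons_zero, Fin.removeNth_zero, Fin.tail_cons, Fin.cons_succ, hrem,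
      List.ofFn_cons]

theorem numberOp_sub_left (A A' : P → 𝓗 →L[ℂ] 𝓗) (l : List P) (h : List P → 𝓗) :
    numberOp A l h - numberOp A' l h = numberOp (fun p => A p - A' p) l h := by
  induction l generalizing h with
  | nil => simp [numberOp]
  | cons p l ih =>
    simp only [numberOp, sub_apply, ← ih]
    abel

theorem numberOp_sub_right (A : P → 𝓗 →L[ℂ] 𝓗) (l : List P) (h h' : List P → 𝓗) :
    numberOp A l h - numberOp A l h' = numberOp A l (fun t => h t - h' t) := by
  induction l generalizing h h' with
  | nil => simp [numberOp]
  | cons p l ih =>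
    simp only [numberOp, ← ih, map_add, map_sub]
    abel

end Algebra

end PoissonChaos

/-! ### Operator fields over a space of points, and measurability of the field step. -/

namespace PoissonChaos

theorem eLpNorm_two_sq {α F : Type*} [MeasurableSpace α] [NormedAddCommGroup F] (f : α → F)
    (μ : Measure α) : eLpNorm f 2 μ ^ 2 = ∫⁻ x, ‖f x‖ₑ ^ 2 ∂μ := by
  have := eLpNorm_nnreal_pow_eq_lintegral (f := f) (μ := μ) (p := 2) (by norm_num)
  simpa only [NNReal.coe_ofNat, ENNReal.coe_ofNat, ENNReal.rpow_two] using this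

section Estimates

variable {P 𝓗 : Type*} [MeasurableSpace P] [NormedAddCommGroup 𝓗] [InnerProductSpace ℂ 𝓗]

/-- Quantitative properties of a family of operators `A p` attached to the points `p`. -/
structure FieldBounds (A : P → 𝓗 →L[ℂ] 𝓗) (w : P → ℝ) (ρ : Measure P) (S : Set P) (c : ℝ)
    (b : ℕ → ℝ) (e : ℝ) : Prop where
  meas : ∀ f, StronglyMeasurable fun p => A p f
  norm_le : ∀ p f, ‖A p f‖ ≤ c * w p * ‖f‖
  sq_le : ∀ (j : ℕ) f, ∫⁻ p, ‖(w p ^ j) • A p f‖ₑ ^ 2 ∂ρ ≤ (ENNReal.ofReal (b j) * ‖f‖ₑ) ^ 2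
  symm : ∀ p f g, inner ℂ (A p f) g = inner ℂ f (A p g)
  mean_le : ∀ f, ‖∫ p, A p f ∂ρ‖ ≤ e * ‖f‖
  supp : ∀ p, p ∉ S → A p = 0
  measurableSet : MeasurableSet S
  moment : ∀ m : ℕ, IntegrableOn (fun p => w p ^ m) S ρ

/-- Measurable families of vectors, bounded by a power of the weight. -/
structure Tame (w : P → ℝ) (h : List P → 𝓗) : Prop where
  meas : ∀ k : ℕ, StronglyMeasurable fun q : Fin k → P => h (List.ofFn q)
  bound : ∃ C : ℝ, 0 ≤ C ∧ ∃ m : ℕ, ∀ l, ‖h l‖ ≤ C * weight w l ^ m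

/-- The weighted `L²` norm of the `k`-point component of a family of vectors. -/
def chaosNorm (w : P → ℝ) (ρ : Measure P) (j k : ℕ) (h : List P → 𝓗) : ℝ≥0∞ :=
  eLpNorm (fun q : Fin k → P => (weight w (List.ofFn q) ^ j) • h (List.ofFn q)) 2
    (Measure.pi fun _ => ρ)

/-- The field operator acting on a family of vectors. -/
def fieldStep (A : P → 𝓗 →L[ℂ] 𝓗) (ρ : Measure P) (h : List P → 𝓗) (l : List P) : 𝓗 :=
  numberOp A l h + ∫ p, A p (h (p :: l)) ∂ρ + ∫ p, A p (h l) ∂ρ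

/-- The components of the expansion of the Dyson term of order `n`. -/
def chaos (A : P → 𝓗 →L[ℂ] 𝓗) (R : 𝓗 →L[ℂ] 𝓗) (ρ : Measure P) (ψ : 𝓗) : ℕ → List P → 𝓗
  | 0, [] => R ψ
  | 0, _ :: _ => 0
  | n + 1, l => R (fieldStep A ρ (chaos A R ρ ψ n) l)

variable {A : P → 𝓗 →L[ℂ] 𝓗} {w : P → ℝ} {ρ : Measure P} {S : Set P} {c e : ℝ} {b : ℕ → ℝ}
  {h h' : List P → 𝓗}

/-- The operators are measurable in `p` only for a fixed vector, not in operator norm. Continuity in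
the vector upgrades this to joint measurability (Carathéodory functions), which uses second
countability. -/
theorem stronglyMeasurable_apply [SecondCountableTopology 𝓗]
    (hA : ∀ f, StronglyMeasurable fun p => A p f) {Ω : Type*} [MeasurableSpace Ω] {g : Ω → P}
    (hg : Measurable g) {u : Ω → 𝓗} (hu : StronglyMeasurable u) :
    StronglyMeasurable fun ω => A (g ω) (u ω) := by
  borelize 𝓗
  have := stronglyMeasurable_uncurry_of_continuous_of_stronglyMeasurable
    (u := fun (f : 𝓗) (p : P) => A p f) (fun p => (A p).continuous) hA
  exact this.comp_measurable (hu.measurable.prodMk hg)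

theorem measurable_weight_ofFn (hw : Measurable w) (k : ℕ) :
    Measurable fun q : Fin k → P => weight w (List.ofFn q) := by
  simp_rw [weight_ofFn]
  exact Finset.measurable_prod _ fun i _ => hw.comp (measurable_pi_apply i)

theorem measurable_finCons (k : ℕ) :
    Measurable fun x : P × (Fin k → P) => (Fin.cons x.1 x.2 : Fin (k + 1) → P) := by
  refine measurable_pi_lambda _ fun j => ?_
  refine Fin.cases ?_ (fun j => ?_) j
  · simpa using measurable_fst
  · exact (measurable_pi_apply j).comp measurable_snd

theorem measurable_removeNth {k : ℕ} (i : Fin (k + 1)) :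
    Measurable fun q : Fin (k + 1) → P => i.removeNth q :=
  measurable_pi_lambda _ fun j => measurable_pi_apply (i.succAbove j)

namespace Tame

theorem meas_cons (hh : Tame w h) (k : ℕ) :
    StronglyMeasurable fun x : P × (Fin k → P) => h (x.1 :: List.ofFn x.2) := by
  simpa only [Function.comp_def, List.ofFn_cons] using
    (hh.meas (k + 1)).comp_measurable (measurable_finCons k)

theorem meas_cons_left (hh : Tame w h) (l : List P) :
    StronglyMeasurable fun p => h (p :: l) := by
  have := (hh.meas_cons l.length).comp_measurable
    (measurable_id.prodMk (measurable_const (a := l.get)))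
  simpa [Function.comp_def, List.ofFn_get] using this

theorem add (hw : ∀ p, 2 ≤ w p) (hh : Tame w h) (hh' : Tame w h') :
    Tame w fun l => h l + h' l := by
  obtain ⟨C, hC, m, hm⟩ := hh.bound
  obtain ⟨C', hC', m', hm'⟩ := hh'.bound
  refine ⟨fun k => (hh.meas k).add (hh'.meas k), C + C', by positivity, m + m', fun l => ?_⟩
  have h1 := one_le_weight hw l
  refine (norm_add_le _ _).trans ((add_le_add (hm l) (hm' l)).trans ?_)
  rw [add_mul]
  gcongr <;> first | exact h1 | omega

theorem clm (hh : Tame w h) (T : 𝓗 →L[ℂ] 𝓗) : Tame w fun l => T (h l) := by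
  obtain ⟨C, hC, m, hm⟩ := hh.bound
  refine ⟨fun k => T.continuous.comp_stronglyMeasurable (hh.meas k), ‖T‖ * C, by positivity, m,
    fun l => ?_⟩
  rw [mul_assoc]
  exact (T.le_opNorm _).trans (by gcongr; exact hm l)

theorem sub (hw : ∀ p, 2 ≤ w p) (hh : Tame w h) (hh' : Tame w h') :
    Tame w fun l => h l - h' l := by
  simpa [sub_eq_add_neg] using hh.add hw (hh'.clm (-ContinuousLinearMap.id ℂ 𝓗))

end Tame

namespace FieldBounds

/-- The new point contributes `w p ^ m` through `h` and one more power through `A p`. The indicator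
is available because `A p` vanishes off `S`, and the moment condition on `S` makes the bound
integrable. -/
theorem norm_integrand_le (hA : FieldBounds A w ρ S c b e) (hc : 0 ≤ c) (hw : ∀ p, 2 ≤ w p)
    {C : ℝ} {m : ℕ} (hm : ∀ l, ‖h l‖ ≤ C * weight w l ^ m) (l : List P) (p : P) :
    ‖A p (h (p :: l))‖ ≤ S.indicator (fun p => c * C * weight w l ^ m * w p ^ (m + 1)) p := by
  by_cases hp : p ∈ S
  · rw [Set.indicator_of_mem hp]
    refine (hA.norm_le _ _).trans ?_
    have hwp := hw p
    calc c * w p * ‖h (p :: l)‖ ≤ c * w p * (C * weight w (p :: l) ^ m) := by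
          gcongr; exact hm _
      _ = _ := by rw [weight_cons]; ring
  · simp [hA.supp p hp, hp]

theorem integrable_bound (hA : FieldBounds A w ρ S c b e) (a : ℝ) (m : ℕ) :
    Integrable (S.indicator fun p => a * w p ^ m) ρ :=
  (integrable_indicator_iff hA.measurableSet).2 ((hA.moment m).const_mul a)

theorem integrable_cons [SecondCountableTopology 𝓗] (hA : FieldBounds A w ρ S c b e)
    (hc : 0 ≤ c) (hw : ∀ p, 2 ≤ w p) (hh : Tame w h) (l : List P) :
    Integrable (fun p => A p (h (p :: l))) ρ := by
  obtain ⟨C, hC, m, hm⟩ := hh.bound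
  exact (hA.integrable_bound _ _).mono'
    (stronglyMeasurable_apply hA.meas measurable_id (hh.meas_cons_left l)).aestronglyMeasurable
    (Eventually.of_forall fun p => hA.norm_integrand_le hc hw hm l p)

theorem integrable_const (hA : FieldBounds A w ρ S c b e) (f : 𝓗) :
    Integrable (fun p => A p f) ρ := by
  refine (hA.integrable_bound (c * ‖f‖) 1).mono' (hA.meas f).aestronglyMeasurable
    (Eventually.of_forall fun p => ?_)
  by_cases hp : p ∈ S
  · rw [Set.indicator_of_mem hp]
    exact (hA.norm_le p f).trans (le_of_eq (by ring))
  · simp [hA.supp p hp, hp]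

/-- Duality: with `F = ∫ A p (g p)`, symmetry gives `‖F‖² = ∫ ⟨A p F, g p⟩`. Cauchy-Schwarz bounds
this by `b 0 * ‖F‖` times the `L²` norm of `g`, and one factor `‖F‖` cancels. Annihilation thus
inherits the constant of creation and no power of the volume. -/
theorem enorm_integral_sq_le [CompleteSpace 𝓗] (hA : FieldBounds A w ρ S c b e) {g : P → 𝓗}
    (hg : AEStronglyMeasurable g ρ) (hi : Integrable (fun p => A p (g p)) ρ) :
    ‖∫ p, A p (g p) ∂ρ‖ₑ ^ 2 ≤ ENNReal.ofReal (b 0) ^ 2 * ∫⁻ p, ‖g p‖ₑ ^ 2 ∂ρ := by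
  set F := ∫ p, A p (g p) ∂ρ with hF
  rcases eq_or_ne F 0 with h0 | h0
  · simp [h0]
  have h1 : ‖F‖ₑ ^ 2 ≤ ∫⁻ p, ‖A p F‖ₑ * ‖g p‖ₑ ∂ρ := by
    have : inner ℂ F F = ∫ p, inner ℂ F (A p (g p)) ∂ρ := (integral_inner hi F).symm
    have h2 : ‖F‖ₑ ^ 2 = ‖inner ℂ F F‖ₑ := by
      rw [inner_self_eq_norm_sq_to_K, enorm_pow]
      congr 1
      simp [enorm_eq_nnnorm]
    rw [h2, this]
    refine (enorm_integral_le_lintegral_enorm _).trans (lintegral_mono fun p => ?_)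
    rw [← hA.symm, ← ofReal_norm, ← ofReal_norm, ← ofReal_norm,
      ← ENNReal.ofReal_mul (norm_nonneg _)]
    exact ENNReal.ofReal_le_ofReal (norm_inner_le_norm (𝕜 := ℂ) (A p F) (g p))
  have h3 := ENNReal.lintegral_mul_le_Lp_mul_Lq ρ (Real.HolderConjugate.two_two)
    (hA.meas F).aestronglyMeasurable.enorm hg.enorm
  have h4 : ∫⁻ p, ‖A p F‖ₑ ^ (2 : ℝ) ∂ρ ≤ (ENNReal.ofReal (b 0) * ‖F‖ₑ) ^ 2 := by
    simpa using hA.sq_le 0 F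
  have h5 : ‖F‖ₑ * ‖F‖ₑ ≤ ‖F‖ₑ * (ENNReal.ofReal (b 0) * (∫⁻ p, ‖g p‖ₑ ^ 2 ∂ρ) ^ (1 / 2 : ℝ)) := by
    calc ‖F‖ₑ * ‖F‖ₑ = ‖F‖ₑ ^ 2 := (sq _).symm
      _ ≤ _ := h1.trans h3
      _ ≤ ((ENNReal.ofReal (b 0) * ‖F‖ₑ) ^ 2) ^ (1 / 2 : ℝ) *
          (∫⁻ p, ‖g p‖ₑ ^ (2 : ℝ) ∂ρ) ^ (1 / 2 : ℝ) := by gcongr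
      _ = _ := by
        rw [← ENNReal.rpow_natCast, ← ENNReal.rpow_mul]
        norm_num
        ring
  -- Cancelling in `ℝ≥0∞` needs `‖F‖ₑ` both nonzero and finite, which is why `F = 0` was split off.
  have h6 := (ENNReal.mul_le_mul_iff_right (by simpa using h0) enorm_ne_top).1 h5
  calc ‖F‖ₑ ^ 2 ≤ (ENNReal.ofReal (b 0) * (∫⁻ p, ‖g p‖ₑ ^ 2 ∂ρ) ^ (1 / 2 : ℝ)) ^ 2 := by gcongr
    _ = _ := by
      rw [mul_pow, ← ENNReal.rpow_natCast (_ ^ (1 / 2 : ℝ)), ← ENNReal.rpow_mul]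
      norm_num

end FieldBounds

theorem norm_numberOp_le (hc : 0 ≤ c) (hw : ∀ p, 2 ≤ w p) (hA : ∀ p f, ‖A p f‖ ≤ c * w p * ‖f‖)
    {C : ℝ} (hC : 0 ≤ C) {m : ℕ} (hm : ∀ l, ‖h l‖ ≤ C * weight w l ^ m) (l : List P) :
    ‖numberOp A l h‖ ≤ 2 * c * C * (l.map w).sum * weight w l ^ m := by
  induction l generalizing h C with
  | nil => simp [numberOp]
  | cons p l ih =>
    have hwp : 2 ≤ w p := hw p
    have hW := one_le_weight hw l
    -- The recursion of `numberOp` replaces `h` by `h (p :: ·)`, whose growth constant is larger by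
    -- `w p ^ m`.
    have h1 := ih (h := fun t => h (p :: t)) (C := C * w p ^ m) (by positivity)
      (fun t => (hm _).trans (le_of_eq (by rw [weight_cons]; ring)))
    have h2 : ‖A p (h (p :: l) + h l)‖ ≤ c * w p * (2 * C * (w p * weight w l) ^ m) := by
      refine (hA _ _).trans ?_
      gcongr
      refine (norm_add_le _ _).trans ?_
      have e1 := hm (p :: l)
      have e2 : ‖h l‖ ≤ C * (w p * weight w l) ^ m := (hm l).trans (by gcongr; nlinarith)
      rw [weight_cons] at e1
      linarith
    rw [numberOp, weight_cons, List.map_cons, List.sum_cons]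
    refine (norm_add_le _ _).trans ((add_le_add h2 h1).trans (le_of_eq ?_))
    rw [mul_pow]; ring

theorem Tame.numberOp [SecondCountableTopology 𝓗] (hc : 0 ≤ c) (hw : ∀ p, 2 ≤ w p)
    (hA : FieldBounds A w ρ S c b e) (hh : Tame w h) :
    Tame w fun l => PoissonChaos.numberOp A l h := by
  obtain ⟨C, hC, m, hm⟩ := hh.bound
  refine ⟨fun k => ?_, 2 * c * C, by positivity, m + 1, fun l => ?_⟩
  · rcases k with _ | k
    · simp [PoissonChaos.numberOp]
    · simp_rw [numberOp_ofFn_succ]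
      refine Finset.stronglyMeasurable_fun_sum _ fun i _ => ?_
      exact stronglyMeasurable_apply hA.meas (measurable_pi_apply i)
        ((hh.meas _).add ((hh.meas k).comp_measurable (measurable_removeNth i)))
  · refine (norm_numberOp_le hc hw hA.norm_le hC hm l).trans ?_
    have := sum_le_weight hw l
    have := weight_pos hw l
    calc _ ≤ 2 * c * C * weight w l * weight w l ^ m := by gcongr
      _ = _ := by ring

/-- The constant contains a moment over `S` and may grow with the volume. This is harmless, since
tameness only secures measurability and integrability; the uniform estimates come from `chaosNorm`.
-/
theorem Tame.annihilate [SecondCountableTopology 𝓗] [SFinite ρ] (hc : 0 ≤ c)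
    (hw : ∀ p, 2 ≤ w p) (hA : FieldBounds A w ρ S c b e) (hh : Tame w h) :
    Tame w fun l => ∫ p, A p (h (p :: l)) ∂ρ := by
  obtain ⟨C, hC, m, hm⟩ := hh.bound
  refine ⟨fun k => ?_, c * C * ∫ p in S, w p ^ (m + 1) ∂ρ, ?_, m, fun l => ?_⟩
  · exact StronglyMeasurable.integral_prod_right (f := fun (q : Fin k → P) p =>
      A p (h (p :: List.ofFn q))) (stronglyMeasurable_apply hA.meas measurable_snd
        ((hh.meas_cons k).comp_measurable measurable_swap))
  · have : 0 ≤ ∫ p in S, w p ^ (m + 1) ∂ρ :=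
      integral_nonneg fun p => pow_nonneg (by linarith [hw p]) _
    positivity
  · refine (norm_integral_le_of_norm_le (hA.integrable_bound _ _)
      (Eventually.of_forall fun p => hA.norm_integrand_le hc hw hm l p)).trans (le_of_eq ?_)
    rw [integral_indicator hA.measurableSet, integral_const_mul]
    ring

/-- The average of the operators `A p`, as a bounded operator. -/
def FieldBounds.mean (hA : FieldBounds A w ρ S c b e) : 𝓗 →L[ℂ] 𝓗 :=
  LinearMap.mkContinuous
    { toFun := fun f => ∫ p, A p f ∂ρ
      map_add' := fun f g => by
        simp_rw [map_add]
        exact integral_add (hA.integrable_const f) (hA.integrable_const g)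
      map_smul' := fun z f => by
        simp_rw [map_smul]
        exact integral_smul z _ } e hA.mean_le

theorem FieldBounds.mean_apply (hA : FieldBounds A w ρ S c b e) (f : 𝓗) :
    hA.mean f = ∫ p, A p f ∂ρ := rfl

theorem Tame.fieldStep [SecondCountableTopology 𝓗] [SFinite ρ] (hc : 0 ≤ c)
    (hw : ∀ p, 2 ≤ w p) (hA : FieldBounds A w ρ S c b e) (hh : Tame w h) :
    Tame w (PoissonChaos.fieldStep A ρ h) :=
  ((hh.numberOp hc hw hA).add hw (hh.annihilate hc hw hA)).add hw (hh.clm hA.mean)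

theorem Tame.chaos [SecondCountableTopology 𝓗] [SFinite ρ] (hc : 0 ≤ c)
    (hw : ∀ p, 2 ≤ w p) (hA : FieldBounds A w ρ S c b e) (R : 𝓗 →L[ℂ] 𝓗) (ψ : 𝓗) (n : ℕ) :
    Tame w (PoissonChaos.chaos A R ρ ψ n) := by
  induction n with
  | zero =>
    refine ⟨fun k => ?_, ‖R ψ‖, norm_nonneg _, 0, fun l => ?_⟩
    · rcases k with _ | k
      · simp [PoissonChaos.chaos]
      · simp [List.ofFn_succ, PoissonChaos.chaos, stronglyMeasurable_const]
    · rcases l with _ | ⟨p, l⟩ <;> simp [PoissonChaos.chaos]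
  | succ n ih => exact (ih.fieldStep hc hw hA).clm R

theorem fieldStep_sub [SecondCountableTopology 𝓗] (hc : 0 ≤ c) (hw : ∀ p, 2 ≤ w p)
    (hA : FieldBounds A w ρ S c b e) (hh : Tame w h) (hh' : Tame w h') (l : List P) :
    fieldStep A ρ h l - fieldStep A ρ h' l = fieldStep A ρ (fun t => h t - h' t) l := by
  simp only [fieldStep, ← numberOp_sub_right, map_sub]
  rw [integral_sub (hA.integrable_cons hc hw hh l) (hA.integrable_cons hc hw hh' l),
    integral_sub (hA.integrable_const _) (hA.integrable_const _)]
  abel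

end Estimates

end PoissonChaos

/-! ### Weighted `L²` estimates for the components, uniform in the volume. -/

namespace PoissonChaos

section NormEstimates

variable {P 𝓗 : Type*} [MeasurableSpace P] [NormedAddCommGroup 𝓗] [InnerProductSpace ℂ 𝓗]
  {A : P → 𝓗 →L[ℂ] 𝓗} {w : P → ℝ} {ρ : Measure P} {S : Set P} {c e : ℝ} {b : ℕ → ℝ}
  {h h' : List P → 𝓗}

/-- Splitting off coordinate `i` preserves the product measure, and Tonelli then puts the integral
over the distinguished point innermost. -/
theorem eLpNorm_removeNth_sq [SigmaFinite ρ] {k : ℕ} {G : P → (Fin k → P) → 𝓗}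
    (hG : StronglyMeasurable (Function.uncurry G)) (i : Fin (k + 1)) :
    eLpNorm (fun q : Fin (k + 1) → P => G (q i) (i.removeNth q)) 2 (Measure.pi fun _ => ρ) ^ 2
      = ∫⁻ q, ∫⁻ p, ‖G p q‖ₑ ^ 2 ∂ρ ∂(Measure.pi fun _ => ρ) := by
  have h1 := eLpNorm_comp_measurePreserving (p := 2) hG.aestronglyMeasurable
    (measurePreserving_piFinSuccAbove (fun _ : Fin (k + 1) => ρ) i)
  have h2 : (Function.uncurry G ∘ ⇑(MeasurableEquiv.piFinSuccAbove (fun _ => P) i))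
      = fun q : Fin (k + 1) → P => G (q i) (i.removeNth q) := rfl
  rw [← h2, h1, eLpNorm_two_sq, lintegral_prod_symm]
  · rfl
  · exact (hG.enorm.pow_const 2).aemeasurable

theorem Tame.meas_weighted (hw : Measurable w) (hh : Tame w h) (j k : ℕ) :
    StronglyMeasurable fun q : Fin k → P => (weight w (List.ofFn q) ^ j) • h (List.ofFn q) :=
  ((measurable_weight_ofFn hw k).pow_const j).stronglyMeasurable.smul (hh.meas k)

/-- The empty product measure is a point mass and the empty weight is `1`. Estimates on the
`0`-point component are therefore estimates on the expectation itself. -/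
theorem chaosNorm_zero (h : List P → 𝓗) (j : ℕ) : chaosNorm w ρ j 0 h = ‖h []‖ₑ := by
  have : (fun q : Fin 0 → P => (weight w (List.ofFn q) ^ j) • h (List.ofFn q))
      = fun _ => h [] := by
    funext q; simp
  rw [chaosNorm, this, Measure.pi_of_empty _ Fin.elim0, eLpNorm_const _ (by norm_num) (NeZero.ne _)]
  simp

theorem chaosNorm_add_le (hw : Measurable w) (hh : Tame w h) (hh' : Tame w h') (j k : ℕ) :
    chaosNorm w ρ j k (fun l => h l + h' l) ≤ chaosNorm w ρ j k h + chaosNorm w ρ j k h' := by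
  simp only [chaosNorm, smul_add]
  exact eLpNorm_add_le (hh.meas_weighted hw j k).aestronglyMeasurable
    (hh'.meas_weighted hw j k).aestronglyMeasurable (by norm_num)

theorem chaosNorm_clm_le {T : 𝓗 → 𝓗} {r : ℝ} (hT : ∀ f, ‖T f‖ ≤ r * ‖f‖) (j k : ℕ) :
    chaosNorm w ρ j k (fun l => T (h l)) ≤ ENNReal.ofReal r * chaosNorm w ρ j k h := by
  refine eLpNorm_le_mul_eLpNorm_of_ae_le_mul (Eventually.of_forall fun q => ?_) _
  rw [norm_smul, norm_smul]
  calc _ ≤ ‖weight w (List.ofFn q) ^ j‖ * (r * ‖h (List.ofFn q)‖) := by gcongr; exact hT _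
    _ = _ := by ring

/-- The weight of `q` factors into that of the created point and that of the rest, and the latter
scalar moves inside `A p` by linearity. Only measurability of `A` is assumed, so that differences of
two fields are covered. -/
theorem lintegral_removeNth_le [SigmaFinite ρ] [SecondCountableTopology 𝓗] (hwm : Measurable w)
    (hA : ∀ f, StronglyMeasurable fun p => A p f) (hh : Tame w h) {j k : ℕ} (i : Fin (k + 1)) :
    eLpNorm (fun q : Fin (k + 1) → P =>
      (weight w (List.ofFn q) ^ j) • A (q i) (h (List.ofFn (i.removeNth q)))) 2
      (Measure.pi fun _ => ρ) ^ 2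
    = ∫⁻ q : Fin k → P, ∫⁻ p, ‖(w p ^ j) • A p ((weight w (List.ofFn q) ^ j) • h (List.ofFn q))‖ₑ ^ 2
        ∂ρ ∂(Measure.pi fun _ => ρ) := by
  rw [← eLpNorm_removeNth_sq (i := i) (G := fun p (q : Fin k → P) =>
    (w p ^ j) • A p ((weight w (List.ofFn q) ^ j) • h (List.ofFn q)))]
  · simp_rw [weight_ofFn_succAbove w _ i, mul_pow, mul_smul, ContinuousLinearMap.map_smul_of_tower]
  · exact ((hwm.comp measurable_fst).pow_const j).stronglyMeasurable.smul
      (stronglyMeasurable_apply hA measurable_fst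
        ((hh.meas_weighted hwm j k).comp_measurable measurable_snd))

/-- With the other points frozen, the inner integral over the created point is exactly what `sq_le`
bounds, whatever the extent of `S`. -/
theorem chaosNorm_create_le [SigmaFinite ρ] [SecondCountableTopology 𝓗] (hwm : Measurable w)
    (hA : FieldBounds A w ρ S c b e) (hh : Tame w h) {j k : ℕ} (i : Fin (k + 1)) :
    eLpNorm (fun q : Fin (k + 1) → P =>
      (weight w (List.ofFn q) ^ j) • A (q i) (h (List.ofFn (i.removeNth q)))) 2
      (Measure.pi fun _ => ρ) ≤ ENNReal.ofReal (b j) * chaosNorm w ρ j k h := by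
  rw [← ENNReal.pow_le_pow_left_iff (two_ne_zero), lintegral_removeNth_le hwm hA.meas hh, mul_pow,
    chaosNorm, eLpNorm_two_sq, ← lintegral_const_mul' _ _ (by finiteness)]
  refine lintegral_mono fun q => (hA.sq_le j _).trans (le_of_eq (mul_pow _ _ _))

/-- Keeping a point is a pointwise multiplication of size `c * w (q i)`, which is not bounded
uniformly in the mark. Since `w (q i)` is at most the total weight, the loss is one power of the
weight; this is the reason for the parameter `j`. -/
theorem chaosNorm_keep_le (hc : 0 ≤ c) (hw : ∀ p, 2 ≤ w p)
    (hA : ∀ p f, ‖A p f‖ ≤ c * w p * ‖f‖) {j k : ℕ} (i : Fin k) :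
    eLpNorm (fun q : Fin k → P => (weight w (List.ofFn q) ^ j) • A (q i) (h (List.ofFn q))) 2
      (Measure.pi fun _ => ρ) ≤ ENNReal.ofReal c * chaosNorm w ρ (j + 1) k h := by
  refine eLpNorm_le_mul_eLpNorm_of_ae_le_mul (Eventually.of_forall fun q => ?_) _
  have h0 := weight_pos hw (List.ofFn q)
  rw [norm_smul, norm_smul, Real.norm_of_nonneg (by positivity), Real.norm_of_nonneg (by positivity)]
  have h1 : w (q i) ≤ weight w (List.ofFn q) := by
    refine le_trans (List.single_le_sum ?_ _ ?_) (sum_le_weight hw _)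
    · simp only [List.mem_map, forall_exists_index, and_imp]
      rintro _ p _ rfl; linarith [hw p]
    · exact List.mem_map.2 ⟨q i, by simp [List.mem_ofFn], rfl⟩
  calc _ ≤ weight w (List.ofFn q) ^ j * (c * w (q i) * ‖h (List.ofFn q)‖) := by gcongr; exact hA _ _
    _ ≤ weight w (List.ofFn q) ^ j * (c * weight w (List.ofFn q) * ‖h (List.ofFn q)‖) := by gcongr
    _ = _ := by ring

theorem chaosNorm_numberOp_succ_le [SigmaFinite ρ] [SecondCountableTopology 𝓗]
    (hwm : Measurable w)  (hA : ∀ f, StronglyMeasurable fun p => A p f) (hh : Tame w h)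
    (j k : ℕ) :
    chaosNorm w ρ j (k + 1) (fun l => numberOp A l h) ≤
      ∑ i : Fin (k + 1), (eLpNorm (fun q : Fin (k + 1) → P =>
        (weight w (List.ofFn q) ^ j) • A (q i) (h (List.ofFn q))) 2 (Measure.pi fun _ => ρ) +
      eLpNorm (fun q : Fin (k + 1) → P =>
        (weight w (List.ofFn q) ^ j) • A (q i) (h (List.ofFn (i.removeNth q)))) 2
          (Measure.pi fun _ => ρ)) := by
  have m0 : StronglyMeasurable fun q : Fin (k + 1) → P => weight w (List.ofFn q) ^ j :=
    ((measurable_weight_ofFn hwm _).pow_const j).stronglyMeasurable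
  have m1 (i : Fin (k + 1)) : StronglyMeasurable fun q : Fin (k + 1) → P =>
      (weight w (List.ofFn q) ^ j) • A (q i) (h (List.ofFn q)) :=
    m0.smul (stronglyMeasurable_apply hA (measurable_pi_apply i) (hh.meas _))
  have m2 (i : Fin (k + 1)) : StronglyMeasurable fun q : Fin (k + 1) → P =>
      (weight w (List.ofFn q) ^ j) • A (q i) (h (List.ofFn (i.removeNth q))) :=
    m0.smul (stronglyMeasurable_apply hA (measurable_pi_apply i)
      ((hh.meas k).comp_measurable (measurable_removeNth i)))
  have : (fun q : Fin (k + 1) → P => (weight w (List.ofFn q) ^ j) • numberOp A (List.ofFn q) h) =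
      ∑ i, fun q => ((weight w (List.ofFn q) ^ j) • A (q i) (h (List.ofFn q)) +
        (weight w (List.ofFn q) ^ j) • A (q i) (h (List.ofFn (i.removeNth q)))) := by
    funext q
    simp only [numberOp_ofFn_succ, Finset.sum_apply, Finset.smul_sum, map_add, smul_add]
  rw [chaosNorm, this]
  refine (eLpNorm_sum_le (fun i _ => ((m1 i).add (m2 i)).aestronglyMeasurable)
    (by norm_num)).trans (Finset.sum_le_sum fun i _ => ?_)
  exact eLpNorm_add_le (m1 i).aestronglyMeasurable (m2 i).aestronglyMeasurable (by norm_num)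

theorem chaosNorm_numberOp_le [SigmaFinite ρ] [SecondCountableTopology 𝓗] (hc : 0 ≤ c)
    (hwm : Measurable w) (hw : ∀ p, 2 ≤ w p) (hA : FieldBounds A w ρ S c b e) (hh : Tame w h)
    (j k : ℕ) :
    chaosNorm w ρ j k (fun l => numberOp A l h) ≤
      k * (ENNReal.ofReal c * chaosNorm w ρ (j + 1) k h +
        ENNReal.ofReal (b j) * chaosNorm w ρ j (k - 1) h) := by
  -- At `k = 0` the truncated index `k - 1` is irrelevant because the prefactor `k` vanishes.
  rcases k with _ | k
  · simp [chaosNorm_zero, numberOp]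
  refine (chaosNorm_numberOp_succ_le hwm hA.meas hh j k).trans ?_
  refine (Finset.sum_le_sum fun i _ => add_le_add (chaosNorm_keep_le hc hw hA.norm_le i)
    (chaosNorm_create_le hwm hA hh i)).trans ?_
  simp [mul_add]

theorem lintegral_cons [SigmaFinite ρ] (hwm : Measurable w) (hh : Tame w h) (j k : ℕ) :
    chaosNorm w ρ j (k + 1) h ^ 2 = ∫⁻ q : Fin k → P,
      ∫⁻ p, ‖((w p * weight w (List.ofFn q)) ^ j) • h (p :: List.ofFn q)‖ₑ ^ 2
        ∂ρ ∂(Measure.pi fun _ => ρ) := by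
  rw [← eLpNorm_removeNth_sq (i := 0) (G := fun p (q : Fin k → P) =>
    ((w p * weight w (List.ofFn q)) ^ j) • h (p :: List.ofFn q))]
  · rw [chaosNorm]
    congr 2
    funext q
    rw [← weight_cons, ← List.ofFn_cons, Fin.removeNth_zero, Fin.cons_self_tail]
  · exact (((hwm.comp measurable_fst).mul ((measurable_weight_ofFn hwm k).comp
      measurable_snd)).pow_const j).stronglyMeasurable.smul (hh.meas_cons k)

/-- This is `enorm_integral_sq_le` with the weight of `l` carried along. The form pointwise in `l`
also serves later as the dominating function in the convergence argument. -/
theorem enorm_annihilate_sq_le [SigmaFinite ρ] [CompleteSpace 𝓗] [SecondCountableTopology 𝓗]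
    (hc : 0 ≤ c) (hw : ∀ p, 2 ≤ w p) (hA : FieldBounds A w ρ S c b e) (hh : Tame w h)
    (j : ℕ) (l : List P) :
    ‖(weight w l ^ j) • ∫ p, A p (h (p :: l)) ∂ρ‖ₑ ^ 2 ≤ ENNReal.ofReal (b 0) ^ 2 *
      ∫⁻ p, ‖((w p * weight w l) ^ j) • h (p :: l)‖ₑ ^ 2 ∂ρ := by
  have h1 := hA.enorm_integral_sq_le (hh.meas_cons_left l).aestronglyMeasurable
    (hA.integrable_cons hc hw hh l)
  rw [enorm_smul, mul_pow]
  calc _ ≤ ‖weight w l ^ j‖ₑ ^ 2 *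
        (ENNReal.ofReal (b 0) ^ 2 * ∫⁻ p, ‖h (p :: l)‖ₑ ^ 2 ∂ρ) := by gcongr
    _ = ENNReal.ofReal (b 0) ^ 2 * ∫⁻ p, ‖weight w l ^ j‖ₑ ^ 2 * ‖h (p :: l)‖ₑ ^ 2 ∂ρ := by
      rw [lintegral_const_mul' _ _ (by finiteness)]; ring
    _ ≤ _ := by
      gcongr with p
      rw [enorm_smul, mul_pow]
      gcongr
      -- Adding the factor `w p` to the weight only increases it, since `w p ≥ 1`.
      refine enorm_le_iff_norm_le.2 ?_
      have h0 := weight_pos hw l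
      have hp := hw p
      rw [Real.norm_of_nonneg (by positivity), Real.norm_of_nonneg (by positivity)]
      gcongr
      nlinarith

theorem chaosNorm_annihilate_le [SigmaFinite ρ] [CompleteSpace 𝓗] [SecondCountableTopology 𝓗]
    (hc : 0 ≤ c) (hwm : Measurable w) (hw : ∀ p, 2 ≤ w p) (hA : FieldBounds A w ρ S c b e)
    (hh : Tame w h) (j k : ℕ) :
    chaosNorm w ρ j k (fun l => ∫ p, A p (h (p :: l)) ∂ρ) ≤
      ENNReal.ofReal (b 0) * chaosNorm w ρ j (k + 1) h := by
  rw [← ENNReal.pow_le_pow_left_iff (two_ne_zero), mul_pow, lintegral_cons hwm hh, chaosNorm,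
    eLpNorm_two_sq, ← lintegral_const_mul' _ _ (by finiteness)]
  exact lintegral_mono fun q => enorm_annihilate_sq_le hc hw hA hh j _

/-- The constant in the estimate of `fieldStep`. -/
def stepConst (c : ℝ) (b : ℕ → ℝ) (e : ℝ) (j k : ℕ) : ℝ≥0∞ :=
  k * (ENNReal.ofReal c + ENNReal.ofReal (b j)) + ENNReal.ofReal (b 0) + ENNReal.ofReal e

/-- The norm of the components that enter the estimate of `fieldStep`. -/
def stepNorm (w : P → ℝ) (ρ : Measure P) (j k : ℕ) (h : List P → 𝓗) : ℝ≥0∞ :=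
  chaosNorm w ρ (j + 1) k h + chaosNorm w ρ j (k - 1) h + chaosNorm w ρ j (k + 1) h +
    chaosNorm w ρ j k h

theorem chaosNorm_fieldStep_le [SigmaFinite ρ] [CompleteSpace 𝓗] [SecondCountableTopology 𝓗]
    (hc : 0 ≤ c) (hwm : Measurable w) (hw : ∀ p, 2 ≤ w p) (hA : FieldBounds A w ρ S c b e)
    (hh : Tame w h) (j k : ℕ) :
    chaosNorm w ρ j k (fieldStep A ρ h) ≤ stepConst c b e j k * stepNorm w ρ j k h := by
  have t1 := hh.numberOp hc hw hA
  have t2 := hh.annihilate hc hw hA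
  have t3 := hh.clm hA.mean
  refine (chaosNorm_add_le hwm (t1.add hw t2) t3 j k).trans
    ((add_le_add (chaosNorm_add_le hwm t1 t2 j k) le_rfl).trans ?_)
  refine (add_le_add (add_le_add (chaosNorm_numberOp_le hc hwm hw hA hh j k)
    (chaosNorm_annihilate_le hc hwm hw hA hh j k)) (chaosNorm_clm_le hA.mean_le j k)).trans ?_
  simp only [stepConst, stepNorm]
  set n1 := chaosNorm w ρ (j + 1) k h
  set n2 := chaosNorm w ρ j (k - 1) h
  set n3 := chaosNorm w ρ j (k + 1) h
  set n4 := chaosNorm w ρ j k h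
  have l1 : n1 ≤ n1 + n2 + n3 + n4 := by rw [add_assoc, add_assoc]; exact le_self_add
  have l2 : n2 ≤ n1 + n2 + n3 + n4 := by rw [add_assoc, add_comm n1, add_assoc]; exact le_self_add
  have l3 : n3 ≤ n1 + n2 + n3 + n4 := le_add_self.trans le_self_add
  have l4 : n4 ≤ n1 + n2 + n3 + n4 := le_add_self
  calc _ ≤ (k : ℝ≥0∞) * (ENNReal.ofReal c * (n1 + n2 + n3 + n4) +
        ENNReal.ofReal (b j) * (n1 + n2 + n3 + n4)) + ENNReal.ofReal (b 0) * (n1 + n2 + n3 + n4) +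
        ENNReal.ofReal e * (n1 + n2 + n3 + n4) := by gcongr
    _ = _ := by ring

theorem stepConst_ne_top (c : ℝ) (b : ℕ → ℝ) (e : ℝ) (j k : ℕ) : stepConst c b e j k ≠ ⊤ := by
  unfold stepConst; finiteness

theorem chaosNorm_chaos_zero_le {R : 𝓗 →L[ℂ] 𝓗} {r : ℝ} (hR : ∀ f, ‖R f‖ ≤ r * ‖f‖) (ψ : 𝓗)
    (j k : ℕ) : chaosNorm w ρ j k (chaos A R ρ ψ 0) ≤ ENNReal.ofReal r * ‖ψ‖ₑ := by
  rcases k with _ | k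
  · rw [chaosNorm_zero, chaos, ← ofReal_norm, ← ofReal_norm, ← ENNReal.ofReal_mul']
    · exact ENNReal.ofReal_le_ofReal (hR ψ)
    · exact norm_nonneg _
  · simp [chaosNorm, List.ofFn_succ, chaos]

/-- The components of the Dyson term are bounded by a constant independent of the resolvent and of
the volume. -/
theorem exists_chaosNorm_chaos_le [SigmaFinite ρ] [CompleteSpace 𝓗] [SecondCountableTopology 𝓗]
    (hc : 0 ≤ c) (hwm : Measurable w) (hw : ∀ p, 2 ≤ w p) (b : ℕ → ℝ) (e : ℝ) (n : ℕ) (j k : ℕ) :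
    ∃ D : ℝ≥0∞, D ≠ ⊤ ∧ ∀ (A : P → 𝓗 →L[ℂ] 𝓗) (S : Set P), FieldBounds A w ρ S c b e →
      ∀ (R : 𝓗 →L[ℂ] 𝓗) (r : ℝ), (∀ f, ‖R f‖ ≤ r * ‖f‖) → ∀ ψ : 𝓗,
        chaosNorm w ρ j k (chaos A R ρ ψ n) ≤ D * ENNReal.ofReal r ^ (n + 1) * ‖ψ‖ₑ := by
  induction n generalizing j k with
  | zero =>
    exact ⟨1, by simp, fun A S hA R r hR ψ => by simpa using chaosNorm_chaos_zero_le hR ψ j k⟩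
  | succ n ih =>
    -- A step at `(j, k)` looks at four neighbouring pairs: `(j + 1, k)` for keeping, `(j, k - 1)`
    -- for creating, `(j, k + 1)` for annihilating, and `(j, k)` for the mean field. The induction
    -- therefore runs over all pairs at once.
    obtain ⟨D1, h1, H1⟩ := ih (j + 1) k
    obtain ⟨D2, h2, H2⟩ := ih j (k - 1)
    obtain ⟨D3, h3, H3⟩ := ih j (k + 1)
    obtain ⟨D4, h4, H4⟩ := ih j k
    refine ⟨stepConst c b e j k * (D1 + D2 + D3 + D4), ?_, fun A S hA R r hR ψ => ?_⟩
    · have := stepConst_ne_top c b e j k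
      finiteness
    · have hT : Tame w (chaos A R ρ ψ n) := Tame.chaos hc hw hA R ψ n
      refine (chaosNorm_clm_le (h := fieldStep A ρ (chaos A R ρ ψ n)) hR j k).trans ?_
      calc _ ≤ ENNReal.ofReal r * (stepConst c b e j k *
            (D1 * ENNReal.ofReal r ^ (n + 1) * ‖ψ‖ₑ + D2 * ENNReal.ofReal r ^ (n + 1) * ‖ψ‖ₑ +
            D3 * ENNReal.ofReal r ^ (n + 1) * ‖ψ‖ₑ + D4 * ENNReal.ofReal r ^ (n + 1) * ‖ψ‖ₑ)) := by
            gcongr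
            refine (chaosNorm_fieldStep_le hc hwm hw hA hT j k).trans ?_
            unfold stepNorm
            gcongr
            · exact H1 A S hA R r hR ψ
            · exact H2 A S hA R r hR ψ
            · exact H3 A S hA R r hR ψ
            · exact H4 A S hA R r hR ψ
        _ = _ := by ring

end NormEstimates

end PoissonChaos

/-! ### Cauchy convergence of the components in the infinite-volume limit. -/

namespace PoissonChaos

/-- Composition of a uniformly Lipschitz family of maps, each of whose values is Cauchy, with a
Cauchy family. -/
theorem tendsto_apply_of_lipschitz {X Y : Type*} (d : X → X → ℝ≥0∞) (d' : Y → Y → ℝ≥0∞)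
    (good : X → Prop) (T : ℝ → X → Y) (u : ℝ → X) {K : ℝ≥0∞} (hK : K ≠ ⊤)
    (hu : ∀ L, 0 < L → good (u L))
    (tri : ∀ L L', 0 < L → 0 < L' → ∀ f f' g, good f → good f' → good g →
      d' (T L f) (T L' f') ≤ d' (T L f) (T L g) + d' (T L g) (T L' g) + d' (T L' g) (T L' f'))
    (lip : ∀ L, 0 < L → ∀ f g, good f → good g → d' (T L f) (T L g) ≤ K * d f g)
    (conv : ∀ g, good g →
      Tendsto (fun x : ℝ × ℝ => d' (T x.1 g) (T x.2 g)) (atTop ×ˢ atTop) (𝓝 0))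
    (cauchy : Tendsto (fun x : ℝ × ℝ => d (u x.1) (u x.2)) (atTop ×ˢ atTop) (𝓝 0)) :
    Tendsto (fun x : ℝ × ℝ => d' (T x.1 (u x.1)) (T x.2 (u x.2))) (atTop ×ˢ atTop) (𝓝 0) := by
  rw [ENNReal.tendsto_nhds_zero]
  intro ε hε
  have hε3 : ε / 3 ≠ 0 := by simpa using hε.ne'
  have hδ : 0 < ε / 3 / K := ENNReal.div_pos hε3 hK
  have h1 := (ENNReal.tendsto_nhds_zero.1 cauchy) _ hδ
  obtain ⟨⟨L₀, L₁⟩, hL⟩ := (prod_atTop_atTop_eq (α := ℝ) (β := ℝ) ▸ h1).exists_forall_of_atTop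
  -- The vector is frozen at the single scale `Λ`, past the Cauchy threshold. Both outer terms are
  -- then small by the Lipschitz bound, and the middle one concerns varying operators on a fixed
  -- vector.
  set Λ := max 1 (max L₀ L₁)
  have hΛ : 0 < Λ := lt_of_lt_of_le one_pos (le_max_left _ _)
  have hΛ0 : L₀ ≤ Λ := (le_max_left _ _).trans (le_max_right _ _)
  have hΛ1 : L₁ ≤ Λ := (le_max_right _ _).trans (le_max_right _ _)
  have h2 := (ENNReal.tendsto_nhds_zero.1 (conv _ (hu Λ hΛ))) (ε / 3)
    (pos_iff_ne_zero.2 hε3)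
  filter_upwards [h2, prod_mem_prod (Ici_mem_atTop Λ) (Ici_mem_atTop Λ)] with x hx hxΛ
  have hx1 : Λ ≤ x.1 := hxΛ.1
  have hx2 : Λ ≤ x.2 := hxΛ.2
  have g1 := hu _ (hΛ.trans_le hx1)
  have g2 := hu _ (hΛ.trans_le hx2)
  refine (tri _ _ (hΛ.trans_le hx1) (hΛ.trans_le hx2) _ _ (u Λ) g1 g2 (hu Λ hΛ)).trans ?_
  have e1 : d' (T x.1 (u x.1)) (T x.1 (u Λ)) ≤ ε / 3 :=
    (lip _ (hΛ.trans_le hx1) _ _ g1 (hu Λ hΛ)).trans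
      ((mul_le_mul_right (hL (x.1, Λ) ⟨hΛ0.trans hx1, hΛ1⟩) K).trans ENNReal.mul_div_le)
  have e2 : d' (T x.2 (u Λ)) (T x.2 (u x.2)) ≤ ε / 3 :=
    (lip _ (hΛ.trans_le hx2) _ _ (hu Λ hΛ) g2).trans
      ((mul_le_mul_right (hL (Λ, x.2) ⟨hΛ0, hΛ1.trans hx2⟩) K).trans ENNReal.mul_div_le)
  exact (add_le_add (add_le_add e1 hx) e2).trans (ENNReal.add_thirds ε).le

theorem tendsto_zero_of_sq {ι : Type*} {F : Filter ι} {u : ι → ℝ≥0∞}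
    (h : Tendsto (fun x => u x ^ 2) F (𝓝 0)) : Tendsto u F (𝓝 0) := by
  have h1 := ((ENNReal.continuous_rpow_const (y := 1 / 2)).tendsto 0).comp h
  have h2 : (fun a : ℝ≥0∞ => a ^ (1 / 2 : ℝ)) ∘ (fun x => u x ^ 2) = u := by
    funext x
    rw [Function.comp_apply, ← ENNReal.rpow_natCast, ← ENNReal.rpow_mul]
    norm_num
  rw [h2, ENNReal.zero_rpow_of_pos (by norm_num)] at h1
  exact h1

theorem enorm_sub_sq_le {V : Type*} [NormedAddCommGroup V] (x y : V) :
    ‖x - y‖ₑ ^ 2 ≤ 2 * (‖x‖ₑ ^ 2 + ‖y‖ₑ ^ 2) := by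
  have h1 : ‖x - y‖ ^ 2 ≤ 2 * (‖x‖ ^ 2 + ‖y‖ ^ 2) := by
    have := norm_sub_le x y
    nlinarith [sq_nonneg (‖x‖ - ‖y‖), norm_nonneg (x - y)]
  have := ENNReal.ofReal_le_ofReal h1
  rwa [ENNReal.ofReal_mul (by norm_num), ENNReal.ofReal_add (by positivity) (by positivity),
    ENNReal.ofReal_pow (norm_nonneg _), ENNReal.ofReal_pow (norm_nonneg _),
    ENNReal.ofReal_pow (norm_nonneg _), ofReal_norm, ofReal_norm, ofReal_norm,
    ENNReal.ofReal_ofNat] at this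

theorem tendsto_eLpNorm_zero {α V ι : Type*} [MeasurableSpace α] {μ : Measure α}
    [NormedAddCommGroup V] {F : Filter ι} [F.IsCountablyGenerated] {f : ι → α → V}
    {bound : α → ℝ≥0∞} (hm : ∀ᶠ x in F, StronglyMeasurable (f x))
    (hb : ∀ᶠ x in F, ∀ q, ‖f x q‖ₑ ^ 2 ≤ bound q) (hi : ∫⁻ q, bound q ∂μ ≠ ⊤)
    (ht : ∀ᵐ q ∂μ, Tendsto (fun x => f x q) F (𝓝 0)) :
    Tendsto (fun x => eLpNorm (f x) 2 μ) F (𝓝 0) := by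
  refine tendsto_zero_of_sq ?_
  simp_rw [eLpNorm_two_sq]
  have := tendsto_lintegral_filter_of_dominated_convergence (μ := μ) (l := F)
    (F := fun x q => ‖f x q‖ₑ ^ 2) (f := fun _ => 0) bound
    (hm.mono fun x hx => hx.enorm.pow_const 2) (hb.mono fun x hx => Eventually.of_forall hx) hi
    (ht.mono fun q hq => ?_)
  · simpa using this
  · have h2 := ((ENNReal.continuous_pow 2).tendsto _).comp hq.enorm
    simpa [Function.comp_def] using h2

section Cauchy

variable {P 𝓗 : Type*} [MeasurableSpace P] [NormedAddCommGroup 𝓗] [InnerProductSpace ℂ 𝓗]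

/-- A family of fields depending on the volume, with uniform bounds and with limits. -/
structure FieldFamily (A : ℝ → P → 𝓗 →L[ℂ] 𝓗) (w : P → ℝ) (ρ : Measure P) (S : ℝ → Set P)
    (c : ℝ) (b : ℕ → ℝ) (e : ℝ) : Prop where
  bounds : ∀ L, 0 < L → FieldBounds (A L) w ρ (S L) c b e
  conv : ∀ p f, Tendsto (fun x : ℝ × ℝ => A x.1 p f - A x.2 p f) (atTop ×ˢ atTop) (𝓝 0)
  conv_sq : ∀ (j : ℕ) f, Tendsto (fun x : ℝ × ℝ =>
    ∫⁻ p, ‖(w p ^ j) • (A x.1 p f - A x.2 p f)‖ₑ ^ 2 ∂ρ) (atTop ×ˢ atTop) (𝓝 0)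
  conv_mean : ∀ f, Tendsto (fun x : ℝ × ℝ => (∫ p, A x.1 p f ∂ρ) - ∫ p, A x.2 p f ∂ρ)
    (atTop ×ˢ atTop) (𝓝 0)

/-- Tame families with finite norms which vanish outside a set of points of finite moments. -/
structure Nice (w : P → ℝ) (ρ : Measure P) (h : List P → 𝓗) : Prop where
  tame : Tame w h
  supp : ∃ U : Set P, MeasurableSet U ∧ (∀ m : ℕ, IntegrableOn (fun p => w p ^ m) U ρ) ∧
    ∀ p, p ∉ U → ∀ l, p ∈ l → h l = 0
  norm_ne_top : ∀ j k, chaosNorm w ρ j k h ≠ ⊤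

variable {A : ℝ → P → 𝓗 →L[ℂ] 𝓗} {w : P → ℝ} {ρ : Measure P} {S : ℝ → Set P} {c e r : ℝ}
  {b : ℕ → ℝ} {h h' : List P → 𝓗} {T : ℝ → 𝓗 →L[ℂ] 𝓗}

theorem eventually_pos_prod : ∀ᶠ x : ℝ × ℝ in atTop ×ˢ atTop, 0 < x.1 ∧ 0 < x.2 :=
  prod_mem_prod (Ioi_mem_atTop 0) (Ioi_mem_atTop 0)

theorem lintegral_chaos_ne_top (hh : ∀ j k, chaosNorm w ρ j k h ≠ ⊤) (K : ℝ≥0∞) (hK : K ≠ ⊤)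
    (j k : ℕ) : ∫⁻ q : Fin k → P, K * ‖(weight w (List.ofFn q) ^ j) • h (List.ofFn q)‖ₑ ^ 2
      ∂(Measure.pi fun _ => ρ) ≠ ⊤ := by
  rw [lintegral_const_mul' _ _ hK, ← eLpNorm_two_sq]
  exact ENNReal.mul_ne_top hK (ENNReal.pow_ne_top (hh j k))

/-- Strong convergence suffices: at each list the difference tends to zero, and `2 * r` times the
norm of the weighted component dominates. -/
theorem chaosNorm_clm_sub_tendsto (hwm : Measurable w) (hT : ∀ L, 0 < L → ∀ f, ‖T L f‖ ≤ r * ‖f‖)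
    (hc : ∀ f, Tendsto (fun x : ℝ × ℝ => T x.1 f - T x.2 f) (atTop ×ˢ atTop) (𝓝 0))
    (hh : Nice w ρ h) (j k : ℕ) :
    Tendsto (fun x : ℝ × ℝ => chaosNorm w ρ j k fun l => T x.1 (h l) - T x.2 (h l))
      (atTop ×ˢ atTop) (𝓝 0) := by
  refine tendsto_eLpNorm_zero (bound := fun q => ENNReal.ofReal (2 * r) ^ 2 *
    ‖(weight w (List.ofFn q) ^ j) • h (List.ofFn q)‖ₑ ^ 2) (Eventually.of_forall fun x => ?_)
    (eventually_pos_prod.mono fun x hx q => ?_)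
    (lintegral_chaos_ne_top hh.norm_ne_top _ (by finiteness) j k) (Eventually.of_forall fun q => ?_)
  · exact ((hh.tame.clm (T x.1 - T x.2))).meas_weighted hwm j k
  · rw [← mul_pow]
    gcongr
    have h1 := hT _ hx.1 ((weight w (List.ofFn q) ^ j) • h (List.ofFn q))
    have h2 := hT _ hx.2 ((weight w (List.ofFn q) ^ j) • h (List.ofFn q))
    rw [smul_sub, ← ContinuousLinearMap.map_smul_of_tower, ← ContinuousLinearMap.map_smul_of_tower,
      ← ofReal_norm, ← ofReal_norm (_ • _), ← ENNReal.ofReal_mul' (norm_nonneg _)]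
    refine ENNReal.ofReal_le_ofReal ((norm_sub_le _ _).trans ?_)
    linarith
  · simpa using (hc (h (List.ofFn q))).const_smul (weight w (List.ofFn q) ^ j)

/-- Pointwise in `q` this is strong convergence of `A L (q i)`. The domination uses one more power
of the weight, which is why `Nice` asks for finite norms at every `j`. -/
theorem keep_sub_tendsto [SecondCountableTopology 𝓗] (hc : 0 ≤ c) (hwm : Measurable w)
    (hw : ∀ p, 2 ≤ w p) (hA : FieldFamily A w ρ S c b e) (hh : Nice w ρ h) (j : ℕ) {k : ℕ}
    (i : Fin k) :
    Tendsto (fun x : ℝ × ℝ => eLpNorm (fun q : Fin k → P =>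
      (weight w (List.ofFn q) ^ j) • (A x.1 (q i) - A x.2 (q i)) (h (List.ofFn q))) 2
      (Measure.pi fun _ => ρ)) (atTop ×ˢ atTop) (𝓝 0) := by
  refine tendsto_eLpNorm_zero (bound := fun q => ENNReal.ofReal (2 * c) ^ 2 *
    ‖(weight w (List.ofFn q) ^ (j + 1)) • h (List.ofFn q)‖ₑ ^ 2)
    (eventually_pos_prod.mono fun x hx => ?_) (eventually_pos_prod.mono fun x hx q => ?_)
    (lintegral_chaos_ne_top hh.norm_ne_top _ (by finiteness) _ k) (Eventually.of_forall fun q => ?_)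
  · exact ((measurable_weight_ofFn hwm _).pow_const j).stronglyMeasurable.smul
      ((stronglyMeasurable_apply (hA.bounds _ hx.1).meas (measurable_pi_apply i)
        (hh.tame.meas k)).sub (stronglyMeasurable_apply (hA.bounds _ hx.2).meas
          (measurable_pi_apply i) (hh.tame.meas k)))
  · rw [← mul_pow]
    gcongr
    have h1 := (hA.bounds _ hx.1).norm_le (q i) (h (List.ofFn q))
    have h2 := (hA.bounds _ hx.2).norm_le (q i) (h (List.ofFn q))
    have h0 := weight_pos hw (List.ofFn q)
    rw [← ofReal_norm, ← ofReal_norm (_ • _), ← ENNReal.ofReal_mul' (norm_nonneg _),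
      norm_smul, norm_smul, Real.norm_of_nonneg (by positivity), Real.norm_of_nonneg (by positivity)]
    refine ENNReal.ofReal_le_ofReal ?_
    have h3 : w (q i) ≤ weight w (List.ofFn q) := by
      refine le_trans (List.single_le_sum ?_ _ ?_) (sum_le_weight hw _)
      · simp only [List.mem_map, forall_exists_index, and_imp]
        rintro _ p _ rfl; linarith [hw p]
      · exact List.mem_map.2 ⟨q i, by simp [List.mem_ofFn], rfl⟩
    have h4 : ‖(A x.1 (q i) - A x.2 (q i)) (h (List.ofFn q))‖ ≤
        2 * c * weight w (List.ofFn q) * ‖h (List.ofFn q)‖ := by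
      rw [_root_.sub_apply]
      refine (norm_sub_le _ _).trans ?_
      calc _ ≤ 2 * c * w (q i) * ‖h (List.ofFn q)‖ := by linarith
        _ ≤ _ := by gcongr
    calc _ ≤ weight w (List.ofFn q) ^ j * (2 * c * weight w (List.ofFn q) * ‖h (List.ofFn q)‖) := by
          gcongr
      _ = _ := by ring
  · simpa using (hA.conv (q i) (h (List.ofFn q))).const_smul (weight w (List.ofFn q) ^ j)

/-- The created point ranges over all of `P`, and no integrable bound in that variable uniform in
the volume is assumed. The inner integral therefore converges by `conv_sq`, and dominated
convergence is used only for the remaining points. -/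
theorem create_sub_tendsto [SigmaFinite ρ] [SecondCountableTopology 𝓗] (hwm : Measurable w)
    (hA : FieldFamily A w ρ S c b e) (hh : Nice w ρ h) (j : ℕ) {k : ℕ} (i : Fin (k + 1)) :
    Tendsto (fun x : ℝ × ℝ => eLpNorm (fun q : Fin (k + 1) → P =>
      (weight w (List.ofFn q) ^ j) • (A x.1 (q i) - A x.2 (q i)) (h (List.ofFn (i.removeNth q)))) 2
      (Measure.pi fun _ => ρ)) (atTop ×ˢ atTop) (𝓝 0) := by
  refine tendsto_zero_of_sq ?_
  set g : (Fin k → P) → 𝓗 := fun q => (weight w (List.ofFn q) ^ j) • h (List.ofFn q) with hg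
  have hgm : StronglyMeasurable g := hh.tame.meas_weighted hwm j k
  have hD (x : ℝ × ℝ) (hx : 0 < x.1 ∧ 0 < x.2) :
      ∀ f, StronglyMeasurable fun p => (A x.1 p - A x.2 p) f := fun f =>
    ((hA.bounds _ hx.1).meas f).sub ((hA.bounds _ hx.2).meas f)
  have hF (x : ℝ × ℝ) (hx : 0 < x.1 ∧ 0 < x.2) := lintegral_removeNth_le (ρ := ρ) (j := j) hwm
    (hD x hx) hh.tame i
  refine Tendsto.congr' (eventually_pos_prod.mono fun x hx => (hF x hx).symm) ?_
  have hb (x : ℝ × ℝ) (hx : 0 < x.1 ∧ 0 < x.2) (f : 𝓗) :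
      ∫⁻ p, ‖(w p ^ j) • (A x.1 p - A x.2 p) f‖ₑ ^ 2 ∂ρ
        ≤ 4 * ENNReal.ofReal (b j) ^ 2 * ‖f‖ₑ ^ 2 := by
    calc _ ≤ ∫⁻ p, 2 * (‖(w p ^ j) • A x.1 p f‖ₑ ^ 2 + ‖(w p ^ j) • A x.2 p f‖ₑ ^ 2) ∂ρ := by
          refine lintegral_mono fun p => ?_
          rw [_root_.sub_apply, smul_sub]
          exact enorm_sub_sq_le _ _
      _ = 2 * (∫⁻ p, ‖(w p ^ j) • A x.1 p f‖ₑ ^ 2 ∂ρ + ∫⁻ p, ‖(w p ^ j) • A x.2 p f‖ₑ ^ 2 ∂ρ) := by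
          rw [lintegral_const_mul' _ _ (by norm_num), lintegral_add_left]
          exact ((hwm.pow_const j).stronglyMeasurable.smul
            ((hA.bounds _ hx.1).meas f)).enorm.pow_const 2
      _ ≤ 2 * ((ENNReal.ofReal (b j) * ‖f‖ₑ) ^ 2 + (ENNReal.ofReal (b j) * ‖f‖ₑ) ^ 2) := by
          gcongr
          · exact (hA.bounds _ hx.1).sq_le j f
          · exact (hA.bounds _ hx.2).sq_le j f
      _ = _ := by ring
  have := tendsto_lintegral_filter_of_dominated_convergence (l := atTop ×ˢ atTop)
    (μ := Measure.pi fun _ : Fin k => ρ)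
    (F := fun (x : ℝ × ℝ) q => ∫⁻ p, ‖(w p ^ j) • (A x.1 p - A x.2 p) (g q)‖ₑ ^ 2 ∂ρ)
    (f := fun _ => 0) (fun q => 4 * ENNReal.ofReal (b j) ^ 2 * ‖g q‖ₑ ^ 2)
    (eventually_pos_prod.mono fun x hx => ?_)
    (eventually_pos_prod.mono fun x hx => Eventually.of_forall fun q => hb x hx _)
    (lintegral_chaos_ne_top hh.norm_ne_top _ (by finiteness) j k)
    (Eventually.of_forall fun q => by simpa using hA.conv_sq j (g q))
  · simp only [lintegral_zero] at this
    simpa only [hg, ContinuousLinearMap.map_smul_of_tower] using this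
  · refine Measurable.lintegral_prod_right' (f := fun z : (Fin k → P) × P =>
      ‖(w z.2 ^ j) • (A x.1 z.2 - A x.2 z.2) (g z.1)‖ₑ ^ 2) ?_
    exact (((hwm.comp measurable_snd).pow_const j).stronglyMeasurable.smul
      (stronglyMeasurable_apply (hD x hx) measurable_snd
        (hgm.comp_measurable measurable_fst))).enorm.pow_const 2

/-- Domination comes from the fixed vector `h` and not from the field: `h` vanishes as soon as a
point leaves `U`, and `U` has finite moments, while the supports `S L` may exhaust the space. -/
theorem annihilate_apply_tendsto [SecondCountableTopology 𝓗] (hc : 0 ≤ c)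
    (hw : ∀ p, 2 ≤ w p) (hA : FieldFamily A w ρ S c b e) (hh : Nice w ρ h) (l : List P) :
    Tendsto (fun x : ℝ × ℝ => (∫ p, A x.1 p (h (p :: l)) ∂ρ) - ∫ p, A x.2 p (h (p :: l)) ∂ρ)
      (atTop ×ˢ atTop) (𝓝 0) := by
  obtain ⟨U, hU, hUm, hUs⟩ := hh.supp
  obtain ⟨C, hC, m, hm⟩ := hh.tame.bound
  have h1 : (fun x : ℝ × ℝ => ∫ p, (A x.1 p - A x.2 p) (h (p :: l)) ∂ρ) =ᶠ[atTop ×ˢ atTop]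
      fun x : ℝ × ℝ => (∫ p, A x.1 p (h (p :: l)) ∂ρ) - ∫ p, A x.2 p (h (p :: l)) ∂ρ :=
    eventually_pos_prod.mono fun x hx =>
      integral_sub ((hA.bounds _ hx.1).integrable_cons hc hw hh.tame l)
        ((hA.bounds _ hx.2).integrable_cons hc hw hh.tame l)
  refine Tendsto.congr' h1 ?_
  have := tendsto_integral_filter_of_dominated_convergence (l := atTop ×ˢ atTop) (μ := ρ)
    (F := fun (x : ℝ × ℝ) p => (A x.1 p - A x.2 p) (h (p :: l))) (f := fun _ => 0)
    (U.indicator fun p => 2 * c * C * weight w l ^ m * w p ^ (m + 1))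
    (eventually_pos_prod.mono fun x hx => ?_)
    (eventually_pos_prod.mono fun x hx => Eventually.of_forall fun p => ?_) ?_
    (Eventually.of_forall fun p => ?_)
  · simpa using this
  · exact ((stronglyMeasurable_apply (hA.bounds _ hx.1).meas measurable_id
      (hh.tame.meas_cons_left l)).sub (stronglyMeasurable_apply (hA.bounds _ hx.2).meas
        measurable_id (hh.tame.meas_cons_left l))).aestronglyMeasurable
  · by_cases hp : p ∈ U
    · rw [Set.indicator_of_mem hp]
      have h2 := (hA.bounds _ hx.1).norm_le p (h (p :: l))
      have h3 := (hA.bounds _ hx.2).norm_le p (h (p :: l))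
      have hwp := hw p
      rw [_root_.sub_apply]
      refine (norm_sub_le _ _).trans ?_
      calc _ ≤ 2 * c * w p * ‖h (p :: l)‖ := by linarith
        _ ≤ 2 * c * w p * (C * weight w (p :: l) ^ m) := by gcongr; exact hm _
        _ = _ := by rw [weight_cons]; ring
    · simp [hUs p hp (p :: l) (by simp), hp]
  · exact (integrable_indicator_iff hU).2 ((hUm (m + 1)).const_mul _)
  · simpa using hA.conv p (h (p :: l))

/-- Dominated convergence over the remaining points. The duality bound is the dominating function,
and its integral is a multiple of the squared norm of the `(k + 1)`-point component. -/
theorem chaosNorm_annihilate_sub_tendsto [SigmaFinite ρ] [CompleteSpace 𝓗]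
    [SecondCountableTopology 𝓗] (hc : 0 ≤ c) (hwm : Measurable w)
    (hw : ∀ p, 2 ≤ w p) (hA : FieldFamily A w ρ S c b e) (hh : Nice w ρ h) (j k : ℕ) :
    Tendsto (fun x : ℝ × ℝ => chaosNorm w ρ j k fun l =>
      (∫ p, A x.1 p (h (p :: l)) ∂ρ) - ∫ p, A x.2 p (h (p :: l)) ∂ρ) (atTop ×ˢ atTop) (𝓝 0) := by
  refine tendsto_eLpNorm_zero (bound := fun q : Fin k → P => 4 * ENNReal.ofReal (b 0) ^ 2 *
      ∫⁻ p, ‖((w p * weight w (List.ofFn q)) ^ j) • h (p :: List.ofFn q)‖ₑ ^ 2 ∂ρ)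
    (eventually_pos_prod.mono fun x hx => ?_) (eventually_pos_prod.mono fun x hx q => ?_) ?_
    (Eventually.of_forall fun q => ?_)
  · exact ((hh.tame.annihilate hc hw (hA.bounds _ hx.1)).sub hw
      (hh.tame.annihilate hc hw (hA.bounds _ hx.2))).meas_weighted hwm j k
  · rw [smul_sub]
    refine (enorm_sub_sq_le _ _).trans ?_
    refine (mul_le_mul_right (add_le_add
      (enorm_annihilate_sq_le hc hw (hA.bounds _ hx.1) hh.tame j _)
      (enorm_annihilate_sq_le hc hw (hA.bounds _ hx.2) hh.tame j _)) 2).trans (le_of_eq ?_)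
    ring
  · rw [lintegral_const_mul' _ _ (by finiteness), ← lintegral_cons hwm hh.tame]
    have := hh.norm_ne_top j (k + 1)
    finiteness
  · simpa using (annihilate_apply_tendsto hc hw hA hh (List.ofFn q)).const_smul
      (weight w (List.ofFn q) ^ j)

theorem chaosNorm_numberOp_sub_tendsto [SigmaFinite ρ] [SecondCountableTopology 𝓗] (hc : 0 ≤ c)
    (hwm : Measurable w) (hw : ∀ p, 2 ≤ w p) (hA : FieldFamily A w ρ S c b e) (hh : Nice w ρ h)
    (j k : ℕ) :
    Tendsto (fun x : ℝ × ℝ => chaosNorm w ρ j k fun l =>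
      numberOp (A x.1) l h - numberOp (A x.2) l h) (atTop ×ˢ atTop) (𝓝 0) := by
  simp_rw [numberOp_sub_left]
  rcases k with _ | k
  · simp [chaosNorm_zero, numberOp]
  refine tendsto_of_tendsto_of_tendsto_of_le_of_le' tendsto_const_nhds
    (g := fun _ => 0) (h := fun x : ℝ × ℝ => ∑ i : Fin (k + 1), (eLpNorm (fun q : Fin (k + 1) → P =>
        (weight w (List.ofFn q) ^ j) • (A x.1 (q i) - A x.2 (q i)) (h (List.ofFn q))) 2
          (Measure.pi fun _ => ρ) +
      eLpNorm (fun q : Fin (k + 1) → P => (weight w (List.ofFn q) ^ j) •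
        (A x.1 (q i) - A x.2 (q i)) (h (List.ofFn (i.removeNth q)))) 2
          (Measure.pi fun _ => ρ))) ?_ (Eventually.of_forall fun _ => zero_le)
    (eventually_pos_prod.mono fun x hx => chaosNorm_numberOp_succ_le hwm (fun f =>
      ((hA.bounds _ hx.1).meas f).sub ((hA.bounds _ hx.2).meas f)) hh.tame j k)
  have := tendsto_finsetSum (Finset.univ : Finset (Fin (k + 1))) fun i _ =>
    (keep_sub_tendsto hc hwm hw hA hh j i).add (create_sub_tendsto hwm hA hh j i)
  simpa using this

theorem chaosNorm_fieldStep_sub_tendsto [SigmaFinite ρ] [CompleteSpace 𝓗]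
    [SecondCountableTopology 𝓗] (hc : 0 ≤ c) (hwm : Measurable w) (hw : ∀ p, 2 ≤ w p)
    (hA : FieldFamily A w ρ S c b e) (hh : Nice w ρ h) (j k : ℕ) :
    Tendsto (fun x : ℝ × ℝ => chaosNorm w ρ j k fun l =>
      fieldStep (A x.1) ρ h l - fieldStep (A x.2) ρ h l) (atTop ×ˢ atTop) (𝓝 0) := by
  have h3 : Tendsto (fun x : ℝ × ℝ => chaosNorm w ρ j k fun l =>
      (∫ p, A x.1 p (h l) ∂ρ) - ∫ p, A x.2 p (h l) ∂ρ) (atTop ×ˢ atTop) (𝓝 0) := by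
    classical
    -- The mean field is a bounded operator only for positive `L`; the value zero elsewhere plays no
    -- role along the filter.
    have := chaosNorm_clm_sub_tendsto (r := e) (T := fun L => if hL : 0 < L then
      (hA.bounds L hL).mean else 0) hwm (fun L hL f => by
        rw [dif_pos hL]; exact (hA.bounds L hL).mean_le f) (fun f => ?_) hh j k
    · refine Tendsto.congr' (eventually_pos_prod.mono fun x hx => ?_) this
      simp [hx.1, hx.2, FieldBounds.mean_apply]
    · refine Tendsto.congr' (eventually_pos_prod.mono fun x hx => ?_) (hA.conv_mean f)
      simp [hx.1, hx.2, FieldBounds.mean_apply]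
  have hsum := ((chaosNorm_numberOp_sub_tendsto hc hwm hw hA hh j k).add
    (chaosNorm_annihilate_sub_tendsto hc hwm hw hA hh j k)).add h3
  simp only [add_zero] at hsum
  refine tendsto_of_tendsto_of_tendsto_of_le_of_le' tendsto_const_nhds hsum
    (Eventually.of_forall fun _ => zero_le) (eventually_pos_prod.mono fun x hx => ?_)
  have B1 := hA.bounds _ hx.1
  have B2 := hA.bounds _ hx.2
  have t1 := (hh.tame.numberOp hc hw B1).sub hw (hh.tame.numberOp hc hw B2)
  have t2 := (hh.tame.annihilate hc hw B1).sub hw (hh.tame.annihilate hc hw B2)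
  have t3 := (hh.tame.clm B1.mean).sub hw (hh.tame.clm B2.mean)
  refine le_trans (le_of_eq ?_) ((chaosNorm_add_le hwm (t1.add hw t2) t3 j k).trans
    (add_le_add (chaosNorm_add_le hwm t1 t2 j k) le_rfl))
  congr 1
  funext l
  simp only [fieldStep, FieldBounds.mean_apply]
  abel

/-- At the point `p` the operator itself vanishes. At any other occurrence, both lists fed to `h`
still contain `p`. This propagates the support condition of `Nice` through a field step. -/
theorem numberOp_eq_zero {A : P → 𝓗 →L[ℂ] 𝓗} {p : P} (hp : A p = 0)
    (hh : ∀ l, p ∈ l → h l = 0) (l : List P) (hl : p ∈ l) : numberOp A l h = 0 := by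
  induction l generalizing h with
  | nil => rfl
  | cons a l ih =>
    rcases List.mem_cons.1 hl with rfl | hl'
    · have h0 : (fun t => h (p :: t)) = fun _ => 0 := by
        funext t; exact hh _ (by simp)
      have h1 (l : List P) : numberOp A l (fun _ => (0 : 𝓗)) = 0 := by
        induction l with
        | nil => rfl
        | cons a l ih => simp [numberOp, ih]
      simp [numberOp, hp, h0, h1]
    · rw [numberOp, hh (a :: l) hl, hh l hl', ih (fun t ht => hh _ (by simp [ht])) hl']
      simp

namespace Nice

theorem clm (hh : Nice w ρ h) (T : 𝓗 →L[ℂ] 𝓗) : Nice w ρ fun l => T (h l) := by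
  obtain ⟨U, hU, hUm, hUs⟩ := hh.supp
  refine ⟨hh.tame.clm T, ⟨U, hU, hUm, fun p hp l hl => by simp [hUs p hp l hl]⟩, fun j k => ?_⟩
  have := hh.norm_ne_top j k
  exact ne_top_of_le_ne_top (by finiteness) (chaosNorm_clm_le T.le_opNorm j k)

theorem stepNorm_ne_top (hh : Nice w ρ h) (j k : ℕ) : stepNorm w ρ j k h ≠ ⊤ := by
  simp [stepNorm, hh.norm_ne_top]

theorem fieldStep [SigmaFinite ρ] [CompleteSpace 𝓗] [SecondCountableTopology 𝓗] (hc : 0 ≤ c)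
    (hwm : Measurable w) (hw : ∀ p, 2 ≤ w p) {A : P → 𝓗 →L[ℂ] 𝓗} {S : Set P}
    (hA : FieldBounds A w ρ S c b e) (hh : Nice w ρ h) :
    Nice w ρ (PoissonChaos.fieldStep A ρ h) := by
  obtain ⟨U, hU, hUm, hUs⟩ := hh.supp
  refine ⟨hh.tame.fieldStep hc hw hA, ⟨U ∪ S, hU.union hA.measurableSet,
    fun m => (hUm m).union (hA.moment m), fun p hp l hl => ?_⟩, fun j k => ?_⟩
  · rw [Set.mem_union, not_or] at hp
    have h1 (l) (hl : p ∈ l) : h l = 0 := hUs p hp.1 l hl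
    have h2 (p') : h (p' :: l) = 0 := h1 _ (by simp [hl])
    simp [PoissonChaos.fieldStep, numberOp_eq_zero (hA.supp p hp.2) h1 l hl, h1 l hl, h2]
  · exact ne_top_of_le_ne_top (ENNReal.mul_ne_top (stepConst_ne_top c b e j k)
      (hh.stepNorm_ne_top j k)) (chaosNorm_fieldStep_le hc hwm hw hA hh.tame j k)

theorem chaos [SigmaFinite ρ] [CompleteSpace 𝓗] [SecondCountableTopology 𝓗] (hc : 0 ≤ c)
    (hwm : Measurable w) (hw : ∀ p, 2 ≤ w p) {A : P → 𝓗 →L[ℂ] 𝓗} {S : Set P}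
    (hA : FieldBounds A w ρ S c b e) (R : 𝓗 →L[ℂ] 𝓗) (ψ : 𝓗) (n : ℕ) :
    Nice w ρ (PoissonChaos.chaos A R ρ ψ n) := by
  induction n with
  | zero =>
    refine ⟨Tame.chaos hc hw hA R ψ 0, ⟨∅, MeasurableSet.empty, by simp, fun p _ l hl => ?_⟩,
      fun j k => ?_⟩
    · rcases l with _ | ⟨a, l⟩
      · simp at hl
      · rfl
    · exact ne_top_of_le_ne_top (by finiteness) (chaosNorm_chaos_zero_le R.le_opNorm ψ j k)
  | succ n ih => exact (ih.fieldStep hc hwm hw hA).clm R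

end Nice

theorem chaosNorm_sub_triangle (hwm : Measurable w) (hw : ∀ p, 2 ≤ w p) {f f' g g' : List P → 𝓗}
    (hf : Tame w f) (hf' : Tame w f') (hg : Tame w g) (hg' : Tame w g') (j k : ℕ) :
    chaosNorm w ρ j k (fun l => f l - f' l) ≤ chaosNorm w ρ j k (fun l => f l - g l) +
      chaosNorm w ρ j k (fun l => g l - g' l) + chaosNorm w ρ j k (fun l => g' l - f' l) := by
  refine le_trans (le_of_eq ?_) ((chaosNorm_add_le hwm ((hf.sub hw hg).add hw (hg.sub hw hg'))
    (hg'.sub hw hf') j k).trans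
    (add_le_add (chaosNorm_add_le hwm (hf.sub hw hg) (hg.sub hw hg') j k) le_rfl))
  congr 1
  funext l
  abel

/-- The step is Lipschitz from the four-term `stepNorm` to `chaosNorm`, with a constant free of `L`.
Convergence on fixed vectors then passes to Cauchy families of vectors. -/
theorem fieldStep_family_tendsto [SigmaFinite ρ] [CompleteSpace 𝓗]
    [SecondCountableTopology 𝓗] (hc : 0 ≤ c) (hwm : Measurable w) (hw : ∀ p, 2 ≤ w p)
    (hA : FieldFamily A w ρ S c b e) {u : ℝ → List P → 𝓗} (hu : ∀ L, 0 < L → Nice w ρ (u L))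
    (j k : ℕ)
    (hd : Tendsto (fun x : ℝ × ℝ => stepNorm w ρ j k fun l => u x.1 l - u x.2 l)
      (atTop ×ˢ atTop) (𝓝 0)) :
    Tendsto (fun x : ℝ × ℝ => chaosNorm w ρ j k fun l =>
      fieldStep (A x.1) ρ (u x.1) l - fieldStep (A x.2) ρ (u x.2) l) (atTop ×ˢ atTop) (𝓝 0) := by
  have tri : ∀ L L', 0 < L → 0 < L' → ∀ f f' g, Nice w ρ f → Nice w ρ f' → Nice w ρ g →
      (chaosNorm w ρ j k fun l => fieldStep (A L) ρ f l - fieldStep (A L') ρ f' l) ≤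
      (chaosNorm w ρ j k fun l => fieldStep (A L) ρ f l - fieldStep (A L) ρ g l) +
      (chaosNorm w ρ j k fun l => fieldStep (A L) ρ g l - fieldStep (A L') ρ g l) +
      (chaosNorm w ρ j k fun l => fieldStep (A L') ρ g l - fieldStep (A L') ρ f' l) := by
    intro L L' hL hL' f f' g hf hf' hg
    exact chaosNorm_sub_triangle hwm hw (hf.tame.fieldStep hc hw (hA.bounds L hL))
      (hf'.tame.fieldStep hc hw (hA.bounds L' hL')) (hg.tame.fieldStep hc hw (hA.bounds L hL))
      (hg.tame.fieldStep hc hw (hA.bounds L' hL')) j k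
  have lip : ∀ L, 0 < L → ∀ f g, Nice w ρ f → Nice w ρ g →
      (chaosNorm w ρ j k fun l => fieldStep (A L) ρ f l - fieldStep (A L) ρ g l) ≤
      stepConst c b e j k * stepNorm w ρ j k fun l => f l - g l := by
    intro L hL f g hf hg
    simp only [fieldStep_sub hc hw (hA.bounds L hL) hf.tame hg.tame]
    exact chaosNorm_fieldStep_le hc hwm hw (hA.bounds L hL) (hf.tame.sub hw hg.tame) j k
  exact tendsto_apply_of_lipschitz (X := List P → 𝓗) (Y := List P → 𝓗)
    (fun f g => stepNorm w ρ j k fun l => f l - g l)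
    (fun f g => chaosNorm w ρ j k fun l => f l - g l) (Nice w ρ)
    (fun L f => fieldStep (A L) ρ f) u (stepConst_ne_top c b e j k) hu tri lip
    (fun g hg => chaosNorm_fieldStep_sub_tendsto hc hwm hw hA hg j k) hd

theorem clm_family_tendsto (hwm : Measurable w) (hw : ∀ p, 2 ≤ w p)
    (hT : ∀ L, 0 < L → ∀ f, ‖T L f‖ ≤ r * ‖f‖)
    (hTc : ∀ f, Tendsto (fun x : ℝ × ℝ => T x.1 f - T x.2 f) (atTop ×ˢ atTop) (𝓝 0))
    {u : ℝ → List P → 𝓗} (hu : ∀ L, 0 < L → Nice w ρ (u L)) (j k : ℕ)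
    (hd : Tendsto (fun x : ℝ × ℝ => chaosNorm w ρ j k fun l => u x.1 l - u x.2 l)
      (atTop ×ˢ atTop) (𝓝 0)) :
    Tendsto (fun x : ℝ × ℝ => chaosNorm w ρ j k fun l => T x.1 (u x.1 l) - T x.2 (u x.2 l))
      (atTop ×ˢ atTop) (𝓝 0) := by
  have tri : ∀ L L', 0 < L → 0 < L' → ∀ f f' g, Nice w ρ f → Nice w ρ f' → Nice w ρ g →
      (chaosNorm w ρ j k fun l => T L (f l) - T L' (f' l)) ≤
      (chaosNorm w ρ j k fun l => T L (f l) - T L (g l)) +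
      (chaosNorm w ρ j k fun l => T L (g l) - T L' (g l)) +
      (chaosNorm w ρ j k fun l => T L' (g l) - T L' (f' l)) :=
    fun L L' _ _ f f' g hf hf' hg => chaosNorm_sub_triangle hwm hw (hf.tame.clm (T L))
      (hf'.tame.clm (T L')) (hg.tame.clm (T L)) (hg.tame.clm (T L')) j k
  have lip : ∀ L, 0 < L → ∀ f g, Nice w ρ f → Nice w ρ g →
      (chaosNorm w ρ j k fun l => T L (f l) - T L (g l)) ≤
      ENNReal.ofReal r * chaosNorm w ρ j k fun l => f l - g l := by
    intro L hL f g hf hg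
    simp only [← map_sub]
    exact chaosNorm_clm_le (hT L hL) j k
  exact tendsto_apply_of_lipschitz (X := List P → 𝓗) (Y := List P → 𝓗)
    (fun f g => chaosNorm w ρ j k fun l => f l - g l)
    (fun f g => chaosNorm w ρ j k fun l => f l - g l) (Nice w ρ)
    (fun L f l => T L (f l)) u ENNReal.ofReal_ne_top hu tri lip
    (fun g hg => chaosNorm_clm_sub_tendsto hwm hT hTc hg j k) hd

/-- The components of the Dyson term are Cauchy in the limit of large volume. -/
theorem chaosNorm_chaos_sub_tendsto [SigmaFinite ρ] [CompleteSpace 𝓗]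
    [SecondCountableTopology 𝓗] (hc : 0 ≤ c) (hwm : Measurable w) (hw : ∀ p, 2 ≤ w p)
    (hA : FieldFamily A w ρ S c b e) {R : ℝ → 𝓗 →L[ℂ] 𝓗}
    (hR : ∀ L, 0 < L → ∀ f, ‖R L f‖ ≤ r * ‖f‖)
    (hRc : ∀ f, Tendsto (fun x : ℝ × ℝ => R x.1 f - R x.2 f) (atTop ×ˢ atTop) (𝓝 0)) (ψ : 𝓗)
    (n j k : ℕ) :
    Tendsto (fun x : ℝ × ℝ => chaosNorm w ρ j k fun l =>
      chaos (A x.1) (R x.1) ρ ψ n l - chaos (A x.2) (R x.2) ρ ψ n l) (atTop ×ˢ atTop) (𝓝 0) := by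
  induction n generalizing j k with
  | zero =>
    rcases k with _ | k
    · simp only [chaosNorm_zero, chaos]
      simpa using (hRc ψ).enorm
    · simp [chaosNorm, List.ofFn_succ, chaos]
  | succ n ih =>
    have hN (L : ℝ) (hL : 0 < L) := Nice.chaos hc hwm hw (hA.bounds L hL) (R L) ψ n
    have hS (L : ℝ) (hL : 0 < L) := (hN L hL).fieldStep hc hwm hw (hA.bounds L hL)
    refine clm_family_tendsto hwm hw hR hRc hS j k
      (fieldStep_family_tendsto hc hwm hw hA hN j k ?_)
    simpa [stepNorm] using (((ih (j + 1) k).add (ih j (k - 1))).add (ih j (k + 1))).add (ih j k)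

theorem exists_tendsto_of_sub_tendsto {V : Type*} [NormedAddCommGroup V] [CompleteSpace V]
    {u : ℝ → V} (hu : Tendsto (fun x : ℝ × ℝ => u x.1 - u x.2) (atTop ×ˢ atTop) (𝓝 0)) :
    ∃ v, Tendsto u atTop (𝓝 v) := by
  refine CompleteSpace.complete (f := map u atTop) ?_
  rw [cauchy_map_iff]
  refine ⟨inferInstance, ?_⟩
  rw [uniformity_eq_comap_nhds_zero_swapped, tendsto_comap_iff]
  exact hu

theorem exists_tendsto_chaos_nil [SigmaFinite ρ] [CompleteSpace 𝓗]
    [SecondCountableTopology 𝓗] (hc : 0 ≤ c) (hwm : Measurable w) (hw : ∀ p, 2 ≤ w p)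
    (hA : FieldFamily A w ρ S c b e) {R : ℝ → 𝓗 →L[ℂ] 𝓗}
    (hR : ∀ L, 0 < L → ∀ f, ‖R L f‖ ≤ r * ‖f‖)
    (hRc : ∀ f, Tendsto (fun x : ℝ × ℝ => R x.1 f - R x.2 f) (atTop ×ˢ atTop) (𝓝 0)) (ψ : 𝓗)
    (n : ℕ) : ∃ f, Tendsto (fun L => chaos (A L) (R L) ρ ψ n []) atTop (𝓝 f) := by
  refine exists_tendsto_of_sub_tendsto ?_
  have := chaosNorm_chaos_sub_tendsto hc hwm hw hA hR hRc ψ n 0 0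
  simp only [chaosNorm_zero] at this
  rw [tendsto_zero_iff_norm_tendsto_zero]
  have h2 := (ENNReal.tendsto_toReal ENNReal.zero_ne_top).comp this
  simpa [Function.comp_def, toReal_enorm] using h2

end Cauchy

end PoissonChaos

/-! ### Poisson expectations, the Mecke formula and the component expansion. -/

namespace PoissonChaos

section SigmaLaw

variable {X : ℕ → Type*} [∀ M, MeasurableSpace (X M)]

/-- This lets integrals over the disjoint union of the `M`-point spaces be computed sector by
sector, without prior measurability of the integrand on the union. -/
theorem measurableEmbedding_sigmaMk (M : ℕ) : MeasurableEmbedding (Sigma.mk M : X M → Sigma X) where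
  injective := sigma_mk_injective
  measurable := fun _ hs => MeasurableSpace.measurableSet_iInf.1 hs M
  measurableSet_image' := fun s hs => by
    refine MeasurableSpace.measurableSet_iInf.2 fun N => ?_
    change MeasurableSet (Sigma.mk N ⁻¹' (Sigma.mk M '' s))
    rcases eq_or_ne N M with rfl | h
    · rwa [Set.preimage_image_eq _ sigma_mk_injective]
    · rw [show Sigma.mk N ⁻¹' (Sigma.mk M '' s) = (∅ : Set (X N)) by
        ext x; simp [h.symm]]
      exact MeasurableSet.empty

theorem integrable_sum_sigma {V : Type*} [NormedAddCommGroup V] {μ : ∀ M, Measure (X M)}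
    {a : ℕ → ℝ≥0∞} (ha : ∀ M, a M ≠ ⊤) {F : Sigma X → V}
    (hi : ∀ M, Integrable (fun x => F ⟨M, x⟩) (μ M))
    (hs : Summable fun M => (a M).toReal * ∫ x, ‖F ⟨M, x⟩‖ ∂(μ M)) :
    Integrable F (Measure.sum fun M => a M • Measure.map (Sigma.mk M) (μ M)) := by
  refine integrable_sum_measure (fun M => ?_) ?_
  · exact (((measurableEmbedding_sigmaMk M).integrable_map_iff).2 (hi M)).smul_measure (ha M)
  · simpa only [integral_smul_measure, (measurableEmbedding_sigmaMk _).integral_map,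
      smul_eq_mul] using hs

theorem hasSum_integral_sigma {V : Type*} [NormedAddCommGroup V] [NormedSpace ℝ V]
    {μ : ∀ M, Measure (X M)}
    {a : ℕ → ℝ≥0∞} {F : Sigma X → V}
    (hF : Integrable F (Measure.sum fun M => a M • Measure.map (Sigma.mk M) (μ M))) :
    HasSum (fun M => (a M).toReal • ∫ x, F ⟨M, x⟩ ∂(μ M))
      (∫ ω, F ω ∂(Measure.sum fun M => a M • Measure.map (Sigma.mk M) (μ M))) := by
  simpa only [integral_smul_measure, (measurableEmbedding_sigmaMk _).integral_map] using
    hasSum_integral_measure hF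

end SigmaLaw

section Expectation

variable {P 𝓗 : Type*} [MeasurableSpace P] [NormedAddCommGroup 𝓗] [InnerProductSpace ℂ 𝓗]

/-- The mean of a function of a Poisson number of independent points. -/
def poissonMean (lam : ℝ≥0) (Q : Measure P) (h : List P → 𝓗) : 𝓗 :=
  ∑' M : ℕ, (poissonMeasure lam).real {M} •
    ∫ q : Fin M → P, h (List.ofFn q) ∂(Measure.pi fun _ => Q)

/-- The vectors `R (W R) ^ n ψ` where `W` is the sum of the operators `A p` over a list. -/
def dyson (A : P → 𝓗 →L[ℂ] 𝓗) (R : 𝓗 →L[ℂ] 𝓗) (ψ : 𝓗) : ℕ → List P → 𝓗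
  | 0, _ => R ψ
  | n + 1, l => R (fieldSum A l (dyson A R ψ n l))

variable {A : P → 𝓗 →L[ℂ] 𝓗} {w : P → ℝ} {ρ Q : Measure P} {S : Set P} {c e : ℝ} {b : ℕ → ℝ}
  {h h' : List P → 𝓗} {lam : ℝ≥0}

theorem Tame.const (w : P → ℝ) (f : 𝓗) : Tame w fun _ => f :=
  ⟨fun _ => stronglyMeasurable_const, ‖f‖, norm_nonneg _, 0, fun l => by simp⟩

theorem Tame.comp_append (hw : ∀ p, 2 ≤ w p) (hh : Tame w h) (l : List P) :
    Tame w fun t => h (t ++ l) := by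
  obtain ⟨C, hC, m, hm⟩ := hh.bound
  have h0 := weight_pos hw l
  refine ⟨fun k => ?_, C * weight w l ^ m, by positivity, m, fun t => ?_⟩
  · have h1 : Measurable fun q : Fin k → P => (Fin.append q l.get : Fin (k + l.length) → P) := by
      refine measurable_pi_lambda _ fun j => ?_
      refine Fin.addCases (fun j => ?_) (fun j => ?_) j
      · simpa using measurable_pi_apply j
      · simp
    have h2 := (hh.meas (k + l.length)).comp_measurable h1
    simpa only [Function.comp_def, List.ofFn_fin_append, List.ofFn_get] using h2
  · refine (hm _).trans (le_of_eq ?_)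
    rw [weight_append]; ring

theorem Tame.comp_cons (hw : ∀ p, 2 ≤ w p) (hh : Tame w h) (p : P) :
    Tame w fun t => h (p :: t) := by
  obtain ⟨C, hC, m, hm⟩ := hh.bound
  have h0 : 0 < w p := by linarith [hw p]
  refine ⟨fun k => ?_, C * w p ^ m, by positivity, m, fun t => ?_⟩
  · exact (hh.meas_cons k).comp_measurable measurable_prodMk_left
  · refine (hm _).trans (le_of_eq ?_)
    rw [weight_cons]; ring

theorem Tame.fieldSum [SecondCountableTopology 𝓗] (hc : 0 ≤ c) (hw : ∀ p, 2 ≤ w p)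
    (hA : FieldBounds A w ρ S c b e) (hh : Tame w h) :
    Tame w fun l => PoissonChaos.fieldSum A l (h l) := by
  obtain ⟨C, hC, m, hm⟩ := hh.bound
  refine ⟨fun k => ?_, c * C, by positivity, m + 1, fun l => ?_⟩
  · simp_rw [fieldSum_ofFn, _root_.sum_apply]
    exact Finset.stronglyMeasurable_fun_sum _ fun i _ =>
      stronglyMeasurable_apply hA.meas (measurable_pi_apply i) (hh.meas k)
  · have h0 := weight_pos hw l
    refine (norm_fieldSum_apply_le hc hw hA.norm_le l _).trans ?_
    calc _ ≤ c * weight w l * (C * weight w l ^ m) := by gcongr; exact hm l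
      _ = _ := by ring

theorem Tame.dyson [SecondCountableTopology 𝓗] (hc : 0 ≤ c) (hw : ∀ p, 2 ≤ w p)
    (hA : FieldBounds A w ρ S c b e) (R : 𝓗 →L[ℂ] 𝓗) (ψ : 𝓗) (n : ℕ) :
    Tame w (PoissonChaos.dyson A R ψ n) := by
  induction n with
  | zero => exact Tame.const w (R ψ)
  | succ n ih => exact (ih.fieldSum hc hw hA).clm R

/-- The Dyson vector sees the points only through the sum of their operators, so it is invariant
under reordering, as the Mecke formula requires. -/
theorem dyson_congr (R : 𝓗 →L[ℂ] 𝓗) (ψ : 𝓗) (n : ℕ) {l l' : List P}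
    (hl : fieldSum A l = fieldSum A l') : dyson A R ψ n l = dyson A R ψ n l' := by
  induction n with
  | zero => rfl
  | succ n ih => simp only [dyson, ih, hl]

theorem integrable_weight_pi [IsProbabilityMeasure Q]
    (hQ : ∀ m : ℕ, Integrable (fun p => w p ^ m) Q) (m M : ℕ) :
    Integrable (fun q : Fin M → P => weight w (List.ofFn q) ^ m) (Measure.pi fun _ => Q) := by
  simp_rw [weight_ofFn, ← Finset.prod_pow]
  exact Integrable.fintype_prod (f := fun (_ : Fin M) p => w p ^ m) fun _ => hQ m

theorem integral_weight_pi [IsProbabilityMeasure Q] (w : P → ℝ) (m M : ℕ) :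
    ∫ q : Fin M → P, weight w (List.ofFn q) ^ m ∂(Measure.pi fun _ => Q) =
      (∫ p, w p ^ m ∂Q) ^ M := by
  simp_rw [weight_ofFn, ← Finset.prod_pow]
  rw [integral_fintype_prod_eq_pow (fun p => w p ^ m), Fintype.card_fin]

/-- The `M`-point average of a tame family grows at most like `a ^ M`, with `a` a moment of the
weight; Poisson probabilities beat any such growth. -/
theorem summable_poisson_pow (lam : ℝ≥0) (a : ℝ) :
    Summable fun M : ℕ => (poissonMeasure lam).real {M} * a ^ M := by
  simp_rw [poissonMeasure_real_singleton]
  have := (Real.summable_pow_div_factorial (lam * a)).mul_left (Real.exp (-lam))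
  refine this.congr fun M => ?_
  rw [mul_pow]; ring

theorem Tame.integrable_pi [IsProbabilityMeasure Q]
    (hQ : ∀ m : ℕ, Integrable (fun p => w p ^ m) Q) (hh : Tame w h) (M : ℕ) :
    Integrable (fun q : Fin M → P => h (List.ofFn q)) (Measure.pi fun _ => Q) := by
  obtain ⟨C, hC, m, hm⟩ := hh.bound
  exact ((integrable_weight_pi hQ m M).const_mul C).mono' (hh.meas M).aestronglyMeasurable
    (Eventually.of_forall fun q => hm _)

theorem integral_norm_pi_le [IsProbabilityMeasure Q]
    (hQ : ∀ m : ℕ, Integrable (fun p => w p ^ m) Q) (hh : Tame w h) {C : ℝ} {m : ℕ}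
    (hm : ∀ l, ‖h l‖ ≤ C * weight w l ^ m) (M : ℕ) :
    ∫ q : Fin M → P, ‖h (List.ofFn q)‖ ∂(Measure.pi fun _ => Q) ≤ C * (∫ p, w p ^ m ∂Q) ^ M := by
  rw [← integral_weight_pi w m M, ← integral_const_mul]
  exact integral_mono (hh.integrable_pi hQ M).norm ((integrable_weight_pi hQ m M).const_mul C)
    fun q => hm _

theorem Tame.summable_norm [IsProbabilityMeasure Q]
    (hQ : ∀ m : ℕ, Integrable (fun p => w p ^ m) Q) (hh : Tame w h) (lam : ℝ≥0) :
    Summable fun M : ℕ => (poissonMeasure lam).real {M} *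
      ∫ q : Fin M → P, ‖h (List.ofFn q)‖ ∂(Measure.pi fun _ => Q) := by
  obtain ⟨C, hC, m, hm⟩ := hh.bound
  refine Summable.of_nonneg_of_le (fun M => by positivity) (fun M => ?_)
    ((summable_poisson_pow lam (∫ p, w p ^ m ∂Q)).mul_left C)
  calc _ ≤ (poissonMeasure lam).real {M} * (C * (∫ p, w p ^ m ∂Q) ^ M) := by
        gcongr; exact integral_norm_pi_le hQ hh hm M
    _ = _ := by ring

variable [CompleteSpace 𝓗]

theorem Tame.hasSum_poissonMean [IsProbabilityMeasure Q]
    (hQ : ∀ m : ℕ, Integrable (fun p => w p ^ m) Q) (hh : Tame w h) (lam : ℝ≥0) :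
    HasSum (fun M : ℕ => (poissonMeasure lam).real {M} •
      ∫ q : Fin M → P, h (List.ofFn q) ∂(Measure.pi fun _ => Q)) (poissonMean lam Q h) := by
  refine Summable.hasSum (Summable.of_norm_bounded (hh.summable_norm hQ lam) fun M => ?_)
  rw [norm_smul, Real.norm_of_nonneg (by positivity)]
  gcongr
  exact norm_integral_le_integral_norm _

theorem poissonMean_add [IsProbabilityMeasure Q]
    (hQ : ∀ m : ℕ, Integrable (fun p => w p ^ m) Q) (hh : Tame w h) (hh' : Tame w h') :
    poissonMean lam Q (fun l => h l + h' l) = poissonMean lam Q h + poissonMean lam Q h' := by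
  refine HasSum.tsum_eq ?_
  refine ((hh.hasSum_poissonMean hQ lam).add (hh'.hasSum_poissonMean hQ lam)).congr_fun ?_
  intro M
  rw [integral_add (hh.integrable_pi hQ M) (hh'.integrable_pi hQ M), smul_add]

theorem poissonMean_clm [IsProbabilityMeasure Q]
    (hQ : ∀ m : ℕ, Integrable (fun p => w p ^ m) Q) (hh : Tame w h) (T : 𝓗 →L[ℂ] 𝓗) :
    poissonMean lam Q (fun l => T (h l)) = T (poissonMean lam Q h) := by
  refine HasSum.tsum_eq ?_
  refine ((hh.hasSum_poissonMean hQ lam).mapL T).congr_fun ?_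
  intro M
  rw [T.integral_comp_comm (hh.integrable_pi hQ M), ContinuousLinearMap.map_smul_of_tower]

theorem poissonMean_const [IsProbabilityMeasure Q] (f : 𝓗) :
    poissonMean lam Q (fun _ => f) = f := by
  refine HasSum.tsum_eq ?_
  have := (hasSum_one_poissonMeasure lam).smul_const f
  simp_rw [← poissonMeasure_real_singleton] at this
  simpa using this

/-- The recursion behind the Mecke formula: the number of choices of a distinguished point is traded
for the intensity and one point fewer. -/
theorem poissonMeasure_succ (lam : ℝ≥0) (M : ℕ) :
    (poissonMeasure lam).real {M + 1} * (M + 1 : ℕ) = lam * (poissonMeasure lam).real {M} := by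
  simp_rw [poissonMeasure_real_singleton, Nat.factorial_succ]
  push_cast
  field_simp
  ring

/-- The formula of Mecke for the sum of the operators `A p` over the points. -/
theorem poissonMean_fieldSum [SecondCountableTopology 𝓗] [IsProbabilityMeasure Q]
    (hQ : ∀ m : ℕ, Integrable (fun p => w p ^ m) Q) (hc : 0 ≤ c) (hw : ∀ p, 2 ≤ w p)
    (hA : FieldBounds A w ρ S c b e) (hh : Tame w h)
    (hsymm : ∀ (k : ℕ) (q : Fin (k + 1) → P) (i : Fin (k + 1)),
      h (List.ofFn q) = h (q i :: List.ofFn (i.removeNth q))) :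
    poissonMean lam Q (fun l => fieldSum A l (h l)) =
      (lam : ℝ) • ∫ p, A p (poissonMean lam Q fun l => h (p :: l)) ∂Q := by
  obtain ⟨C, hC, m, hm⟩ := hh.bound
  have hw0 (p : P) : 0 < w p := by linarith [hw p]
  set Φ : ∀ M : ℕ, P × (Fin M → P) → 𝓗 := fun M x => A x.1 (h (x.1 :: List.ofFn x.2)) with hΦ
  have hΦm (M : ℕ) : StronglyMeasurable (Φ M) :=
    stronglyMeasurable_apply hA.meas measurable_fst (hh.meas_cons M)
  have hΦb (M : ℕ) (x : P × (Fin M → P)) :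
      ‖Φ M x‖ ≤ (c * C * w x.1 ^ (m + 1)) * weight w (List.ofFn x.2) ^ m := by
    refine (hA.norm_le _ _).trans ?_
    have := hw0 x.1
    calc _ ≤ c * w x.1 * (C * weight w (x.1 :: List.ofFn x.2) ^ m) := by gcongr; exact hm _
      _ = _ := by rw [weight_cons]; ring
  have hbi (M : ℕ) : Integrable (fun x : P × (Fin M → P) =>
      (c * C * w x.1 ^ (m + 1)) * weight w (List.ofFn x.2) ^ m) (Q.prod (Measure.pi fun _ => Q)) :=
    ((hQ (m + 1)).const_mul (c * C)).mul_prod (integrable_weight_pi hQ m M)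
  have hΦi (M : ℕ) : Integrable (Φ M) (Q.prod (Measure.pi fun _ => Q)) :=
    (hbi M).mono' (hΦm M).aestronglyMeasurable (Eventually.of_forall (hΦb M))
  -- By symmetry of `h` the `i`-th point may be moved to the front, so all `M + 1` summands have the
  -- same integral.
  have hterm (M : ℕ) (i : Fin (M + 1)) :
      Integrable (fun q : Fin (M + 1) → P => A (q i) (h (List.ofFn q))) (Measure.pi fun _ => Q) ∧
      ∫ q : Fin (M + 1) → P, A (q i) (h (List.ofFn q)) ∂(Measure.pi fun _ => Q)
        = ∫ p, ∫ q : Fin M → P, Φ M (p, q) ∂(Measure.pi fun _ => Q) ∂Q := by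
    have hmp := measurePreserving_piFinSuccAbove (fun _ : Fin (M + 1) => Q) i
    have heq : (fun q : Fin (M + 1) → P => A (q i) (h (List.ofFn q))) =
        Φ M ∘ (MeasurableEquiv.piFinSuccAbove (fun _ => P) i) := by
      funext q
      rw [hsymm M q i]; rfl
    rw [heq]
    exact ⟨(hmp.integrable_comp (hΦm M).aestronglyMeasurable).2 (hΦi M), by
      rw [← integral_prod _ (hΦi M), ← hmp.integral_comp']; rfl⟩
  have hsum : ∀ M : ℕ, (poissonMeasure lam).real {M + 1} •
      ∫ q : Fin (M + 1) → P, fieldSum A (List.ofFn q) (h (List.ofFn q)) ∂(Measure.pi fun _ => Q) =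
      (lam : ℝ) • ∫ p, (poissonMeasure lam).real {M} •
        ∫ q : Fin M → P, Φ M (p, q) ∂(Measure.pi fun _ => Q) ∂Q := by
    intro M
    simp_rw [fieldSum_ofFn, _root_.sum_apply]
    rw [integral_finsetSum _ fun i _ => (hterm M i).1,
      Finset.sum_congr rfl fun i _ => (hterm M i).2, Finset.sum_const, Finset.card_univ,
      Fintype.card_fin, ← Nat.cast_smul_eq_nsmul ℝ, smul_smul, poissonMeasure_succ,
      integral_smul, smul_smul]
  have hp (p : P) : HasSum (fun M : ℕ => (poissonMeasure lam).real {M} •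
      ∫ q : Fin M → P, Φ M (p, q) ∂(Measure.pi fun _ => Q))
      (A p (poissonMean lam Q fun l => h (p :: l))) := by
    rw [← poissonMean_clm hQ (hh.comp_cons hw p)]
    exact ((hh.comp_cons hw p).clm (A p)).hasSum_poissonMean hQ lam
  have hint : ∀ M : ℕ, Integrable (fun p => (poissonMeasure lam).real {M} •
      ∫ q : Fin M → P, Φ M (p, q) ∂(Measure.pi fun _ => Q)) Q :=
    fun M => (hΦi M).integral_prod_left.smul _
  have hmain := hasSum_integral_of_summable_integral_norm hint ?_
  · simp_rw [(hp _).tsum_eq] at hmain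
    refine HasSum.tsum_eq ?_
    -- The sector `M = 0` contributes nothing, since the field of no points is zero; the series is
    -- reindexed to start at `M = 1`.
    rw [← hasSum_nat_add_iff' 1]
    simp only [hsum, Finset.sum_range_one, List.ofFn_zero, fieldSum_nil, _root_.zero_apply,
      integral_zero, smul_zero, sub_zero]
    exact hmain.const_smul (lam : ℝ)
  · refine Summable.of_nonneg_of_le (fun M => by positivity) (fun M => ?_)
      ((summable_poisson_pow lam (∫ p, w p ^ m ∂Q)).mul_left (c * C * ∫ p, w p ^ (m + 1) ∂Q))
    simp_rw [norm_smul, Real.norm_of_nonneg measureReal_nonneg]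
    rw [integral_const_mul]
    have h1 : ∫ p, ‖∫ q : Fin M → P, Φ M (p, q) ∂(Measure.pi fun _ => Q)‖ ∂Q ≤
        ∫ x, ‖Φ M x‖ ∂(Q.prod (Measure.pi fun _ => Q)) := by
      rw [integral_prod _ (hΦi M).norm]
      exact integral_mono (hΦi M).integral_prod_left.norm (hΦi M).norm.integral_prod_left
        fun p => norm_integral_le_integral_norm _
    have h2 : ∫ x, ‖Φ M x‖ ∂(Q.prod (Measure.pi fun _ => Q)) ≤
        (c * C * ∫ p, w p ^ (m + 1) ∂Q) * (∫ p, w p ^ m ∂Q) ^ M := by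
      refine (integral_mono (hΦi M).norm (hbi M) (hΦb M)).trans (le_of_eq ?_)
      rw [integral_prod_mul (fun p => c * C * w p ^ (m + 1))
        (fun q : Fin M → P => weight w (List.ofFn q) ^ m), integral_weight_pi, integral_const_mul]
    calc _ ≤ (poissonMeasure lam).real {M} *
          ((c * C * ∫ p, w p ^ (m + 1) ∂Q) * (∫ p, w p ^ m ∂Q) ^ M) := by
            gcongr; exact h1.trans h2
      _ = _ := by ring

/-- Translates between the fixed reference measure `ρ` of the component calculus and the intensity
`lam • Q` of the actual point process. The two agree on `S`, outside which the field vanishes. -/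
theorem FieldBounds.integral_eq (hA : FieldBounds A w ρ S c b e)
    (hρ : ρ.restrict S = lam • Q) (u : P → 𝓗) :
    ∫ p, A p (u p) ∂ρ = (lam : ℝ) • ∫ p, A p (u p) ∂Q := by
  rw [← setIntegral_eq_integral_of_forall_compl_eq_zero (s := S), hρ, integral_smul_nnreal_measure]
  · rfl
  · intro p hp
    simp [hA.supp p hp]

theorem FieldBounds.integrable_pow (hA : FieldBounds A w ρ S c b e) (hlam : lam ≠ 0)
    (hρ : ρ.restrict S = lam • Q) (m : ℕ) : Integrable (fun p => w p ^ m) Q := by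
  have h1 := hA.moment m
  rw [IntegrableOn, hρ] at h1
  have h2 := h1.smul_measure_nnreal (c := lam⁻¹)
  rwa [smul_smul, inv_mul_cancel₀ hlam, one_smul] at h2

theorem sublistSum_chaos_zero (R : 𝓗 →L[ℂ] 𝓗) (ψ : 𝓗) (l : List P) :
    sublistSum l (chaos A R ρ ψ 0) = R ψ := by
  have h0 (l : List P) : sublistSum l (fun _ => (0 : 𝓗)) = 0 := by
    induction l with
    | nil => rfl
    | cons p l ih => simp [sublistSum, ih]
  induction l with
  | nil => rfl
  | cons p l ih => simp [sublistSum, ih, chaos, h0]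

/-- The mean of the Dyson term with additional points is the sum of the components. -/
theorem poissonMean_dyson [SecondCountableTopology 𝓗] [SFinite ρ] [IsProbabilityMeasure Q]
    (hlam : lam ≠ 0) (hρ : ρ.restrict S = lam • Q) (hc : 0 ≤ c) (hw : ∀ p, 2 ≤ w p)
    (hA : FieldBounds A w ρ S c b e) (R : 𝓗 →L[ℂ] 𝓗) (ψ : 𝓗) (n : ℕ) (l : List P) :
    poissonMean lam Q (fun t => dyson A R ψ n (t ++ l)) = sublistSum l (chaos A R ρ ψ n) := by
  have hQ := hA.integrable_pow hlam hρ
  -- The additional points `l` must be arbitrary: the Mecke formula at order `n + 1` inserts a point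
  -- and calls for order `n` at `p :: l`.
  induction n generalizing l with
  | zero => rw [sublistSum_chaos_zero]; exact poissonMean_const _
  | succ n ih =>
    have hD : Tame w fun t => dyson A R ψ n (t ++ l) := (Tame.dyson hc hw hA R ψ n).comp_append hw l
    have hC : Tame w (chaos A R ρ ψ n) := Tame.chaos hc hw hA R ψ n
    -- The outermost field splits into that of the random points `t`, which needs the Mecke formula,
    -- and that of the deterministic points `l`, which comes out of the mean.
    have h1 : poissonMean lam Q (fun t => dyson A R ψ (n + 1) (t ++ l)) =
        R (poissonMean lam Q (fun t => fieldSum A t (dyson A R ψ n (t ++ l))) +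
          fieldSum A l (poissonMean lam Q fun t => dyson A R ψ n (t ++ l))) := by
      rw [← poissonMean_clm hQ hD, ← poissonMean_add hQ (hD.fieldSum hc hw hA) (hD.clm _),
        ← poissonMean_clm hQ ((hD.fieldSum hc hw hA).add hw (hD.clm _))]
      simp only [dyson, fieldSum_append, _root_.add_apply]
    -- The inserted point joins `l`. Sublists of `p :: l` avoiding `p` give the mean field, and
    -- those containing `p` give annihilation.
    have h2 : poissonMean lam Q (fun t => fieldSum A t (dyson A R ψ n (t ++ l))) =
        sublistSum l (fun t => ∫ p, A p (chaos A R ρ ψ n t) ∂ρ) +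
        sublistSum l (fun t => ∫ p, A p (chaos A R ρ ψ n (p :: t)) ∂ρ) := by
      rw [poissonMean_fieldSum hQ hc hw hA hD, ← hA.integral_eq hρ]
      · have h3 (p : P) : (poissonMean lam Q fun t => dyson A R ψ n (p :: t ++ l)) =
            sublistSum l (chaos A R ρ ψ n) + sublistSum l (fun t => chaos A R ρ ψ n (p :: t)) := by
          rw [← sublistSum, ← ih (p :: l)]
          congr 1
          funext t
          refine dyson_congr R ψ n ?_
          simp only [fieldSum_append, fieldSum_cons, List.cons_append]
          abel
        simp_rw [h3, map_add, map_sublistSum]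
        rw [integral_add, integral_sublistSum, integral_sublistSum]
        · exact fun t => hA.integrable_cons hc hw hC t
        · exact fun t => hA.integrable_const _
        · exact sublistSum_integrable l (fun p t => A p (chaos A R ρ ψ n t))
            fun t => hA.integrable_const _
        · exact sublistSum_integrable l (fun p t => A p (chaos A R ρ ψ n (p :: t)))
            fun t => hA.integrable_cons hc hw hC t
      · intro k q i
        refine dyson_congr R ψ n ?_
        rw [fieldSum_append, fieldSum_append, fieldSum_cons, fieldSum_ofFn_succAbove A q i]
    -- The deterministic field becomes `numberOp` under the sublist sum, and the three contributions
    -- assemble to `fieldStep`.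
    rw [h1, h2, ih, ← sublistSum_numberOp, add_comm, ← sublistSum_add, ← sublistSum_add,
      map_sublistSum]
    congr 1
    funext t
    simp only [chaos, fieldStep, map_add]
    abel

end Expectation

end PoissonChaos

/-! ### The box as a torus. -/

namespace PoissonSchrodinger

section Torus

variable {d : ℕ} {L : ℝ}

/-- The projection of Euclidean space onto the unit torus, with period `L`. -/
def toTorus (L : ℝ) (x : E d) : UnitAddTorus (Fin d) := fun j => ((x j / L : ℝ) : UnitAddCircle)

/-- The representative in the box of a point of the unit torus. -/
def fromTorus (L : ℝ) (t : UnitAddTorus (Fin d)) : E d :=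
  WithLp.toLp 2 fun j => L * (AddCircle.equivIco 1 (-(1 / 2) : ℝ) (t j) : ℝ)

theorem measurableSet_box (d : ℕ) (L : ℝ) : MeasurableSet (box d L) := by
  have : box d L = ⋂ j : Fin d, {x : E d | -(L / 2) ≤ x j} ∩ {x | x j < L / 2} := by
    ext x; simp [box]
  rw [this]
  exact MeasurableSet.iInter fun j =>
    (measurableSet_le (by fun_prop) (by fun_prop)).inter
      (measurableSet_lt (by fun_prop) (by fun_prop))

theorem measurable_toTorus (L : ℝ) : Measurable (toTorus L : E d → UnitAddTorus (Fin d)) :=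
  measurable_pi_lambda _ fun j => AddCircle.measurable_mk'.comp (by fun_prop)

theorem measurable_fromTorus (L : ℝ) : Measurable (fromTorus L : UnitAddTorus (Fin d) → E d) := by
  refine (PiLp.continuous_toLp 2 _).measurable.comp (measurable_pi_lambda _ fun j => ?_)
  have h1 : Measurable fun t : UnitAddCircle => (AddCircle.equivIco 1 (-(1 / 2) : ℝ) t : ℝ) :=
    measurable_subtype_coe.comp (AddCircle.measurableEquivIco 1 (-(1 / 2))).measurable
  exact (h1.comp (measurable_pi_apply j)).const_mul L

theorem fromTorus_toTorus (hL : 0 < L) {x : E d} (hx : x ∈ box d L) :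
    fromTorus L (toTorus L x) = x := by
  ext j
  have h := hx j
  simp only [toTorus, fromTorus]
  rw [AddCircle.equivIco_coe_of_mem, mul_div_cancel₀ _ hL.ne']
  constructor
  · rw [le_div_iff₀ hL]; linarith
  · rw [div_lt_iff₀ hL]; linarith

theorem wrap_mem_box (hL : 0 < L) (x : E d) : wrap L x ∈ box d L := by
  intro j
  have h1 := Int.floor_le (x j / L + 1 / 2)
  have h2 := Int.lt_floor_add_one (x j / L + 1 / 2)
  have h3 : x j = L * (x j / L) := by field_simp
  simp only [wrap]
  constructor <;> nlinarith

theorem toTorus_wrap (hL : 0 < L) (x : E d) : toTorus L (wrap L x) = toTorus L x := by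
  funext j
  simp only [toTorus, wrap]
  rw [sub_div, mul_div_cancel_left₀ _ hL.ne', AddCircle.coe_sub,
    (AddCircle.coe_eq_zero_iff (p := (1 : ℝ)) (x := (⌊x j / L + 1 / 2⌋ : ℝ))).2
      ⟨⌊x j / L + 1 / 2⌋, by simp⟩, sub_zero]

/-- Reduction modulo the lattice is a round trip through the torus, so statements about wrapped
differences follow from invariance of Haar measure. -/
theorem wrap_eq (hL : 0 < L) (x : E d) : wrap L x = fromTorus L (toTorus L x) := by
  rw [← toTorus_wrap hL, fromTorus_toTorus hL (wrap_mem_box hL x)]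

theorem wrap_of_mem (hL : 0 < L) {x : E d} (hx : x ∈ box d L) : wrap L x = x := by
  rw [wrap_eq hL, fromTorus_toTorus hL hx]

theorem toTorus_sub (x y : E d) : toTorus L (x - y) = toTorus L x - toTorus L y := by
  funext j
  simp [toTorus, sub_div]

theorem measurable_wrap (L : ℝ) : Measurable (wrap L : E d → E d) := by
  refine (PiLp.continuous_toLp 2 _).measurable.comp (measurable_pi_lambda _ fun j => ?_)
  fun_prop

/-- Coordinatewise this is the quotient map on a fundamental interval. Half-open on the left or on
the right makes no difference up to a null set. General `L` follows by scaling. -/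
theorem measurePreserving_toTorus_one (d : ℕ) :
    MeasurePreserving (toTorus 1) ((volume : Measure (E d)).restrict (box d 1))
      (volume : Measure (UnitAddTorus (Fin d))) := by
  have h1 : MeasurePreserving (fun (x : Fin d → ℝ) j => ((x j : ℝ) : UnitAddCircle))
      ((volume : Measure (Fin d → ℝ)).restrict
        (Set.univ.pi fun _ => Set.Ico (-(1 / 2) : ℝ) (1 / 2))) volume := by
    rw [volume_pi, Measure.restrict_pi_pi]
    have h2 : ∀ _ : Fin d, MeasurePreserving (fun x : ℝ => (x : UnitAddCircle))
        ((volume : Measure ℝ).restrict (Set.Ico (-(1 / 2)) (1 / 2))) volume := fun _ => by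
      have := AddCircle.measurePreserving_mk 1 (-(1 / 2))
      rw [Measure.restrict_congr_set Ico_ae_eq_Ioc]
      norm_num at this ⊢
      exact this
    exact measurePreserving_pi _ _ h2
  have h3 := (PiLp.volume_preserving_ofLp (Fin d)).restrict_preimage
    (MeasurableSet.univ_pi fun _ : Fin d => measurableSet_Ico (a := (-(1 / 2) : ℝ)) (b := 1 / 2))
  have h4 : (WithLp.ofLp ⁻¹' (Set.univ.pi fun _ => Set.Ico (-(1 / 2) : ℝ) (1 / 2)) : Set (E d))
      = box d 1 := by
    ext x; simp [box]
  rw [h4] at h3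
  have h5 := h1.comp h3
  have h6 : (toTorus 1 : E d → _) =
      (fun (x : Fin d → ℝ) j => ((x j : ℝ) : UnitAddCircle)) ∘ WithLp.ofLp := by
    funext x j; simp [toTorus]
  rw [h6]
  exact h5

theorem measurePreserving_toTorus (hL : 0 < L) :
    MeasurePreserving (toTorus L) ((volume : Measure (E d)).restrict (box d L))
      (ENNReal.ofReal (L ^ d) • (volume : Measure (UnitAddTorus (Fin d)))) := by
  refine ⟨measurable_toTorus L, ?_⟩
  have h1 : (toTorus L : E d → _) = toTorus 1 ∘ fun x => L⁻¹ • x := by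
    funext x j; simp [toTorus, div_eq_inv_mul]
  have hm : Measurable fun x : E d => L⁻¹ • x := measurable_const_smul _
  have h2 : box d L = (fun x : E d => L⁻¹ • x) ⁻¹' box d 1 := by
    ext x
    simp only [box, Set.mem_ofPred_eq, Set.mem_preimage, PiLp.smul_apply, smul_eq_mul]
    refine forall_congr' fun j => ?_
    rw [inv_mul_eq_div, le_div_iff₀ hL, div_lt_iff₀ hL]
    constructor <;> rintro ⟨h, h'⟩ <;> constructor <;> linarith
  rw [h1, ← Measure.map_map (measurable_toTorus 1) hm, h2,
    ← Measure.restrict_map hm (measurableSet_box d 1),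
    Measure.map_addHaar_smul _ (inv_ne_zero hL.ne'), Measure.restrict_smul, Measure.map_smul,
    (measurePreserving_toTorus_one d).map_eq]
  congr 2
  rw [finrank_euclideanSpace, Fintype.card_fin, inv_pow, inv_inv, abs_of_pos (by positivity)]

theorem volume_box (hL : 0 < L) : volume (box d L) = ENNReal.ofReal (L ^ d) := by
  have h := (measurePreserving_toTorus (d := d) hL).measure_preimage
    (MeasurableSet.univ.nullMeasurableSet)
  have h1 : (volume : Measure (UnitAddTorus (Fin d))) Set.univ = 1 := by
    rw [volume_pi, Measure.pi_univ]; simp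
  simpa [h1] using h

theorem measurePreserving_fromTorus (hL : 0 < L) :
    MeasurePreserving (fromTorus L)
      (ENNReal.ofReal (L ^ d) • (volume : Measure (UnitAddTorus (Fin d))))
      ((volume : Measure (E d)).restrict (box d L)) := by
  refine ⟨measurable_fromTorus L, ?_⟩
  rw [← (measurePreserving_toTorus hL).map_eq,
    Measure.map_map (measurable_fromTorus L) (measurable_toTorus L)]
  have : (fromTorus L ∘ toTorus L : E d → E d) =ᵐ[volume.restrict (box d L)] id := by
    filter_upwards [ae_restrict_mem (measurableSet_box d L)] with x hx
    exact fromTorus_toTorus hL hx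
  rw [Measure.map_congr this, Measure.map_id]

/-- Translation invariance and reflection invariance of the periodic structure. -/
theorem measurePreserving_wrap_sub (hL : 0 < L) (x : E d) :
    MeasurePreserving (fun y => wrap L (x - y)) ((volume : Measure (E d)).restrict (box d L))
      ((volume : Measure (E d)).restrict (box d L)) := by
  have h1 : (fun y : E d => wrap L (x - y)) =
      fromTorus L ∘ (fun t => toTorus L x - t) ∘ toTorus L := by
    funext y
    rw [wrap_eq hL, toTorus_sub]; rfl
  rw [h1]
  have h2 : MeasurePreserving (fun t : UnitAddTorus (Fin d) => toTorus L x - t) volume volume :=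
    measurePreserving_pi _ _ fun j => Measure.measurePreserving_sub_left volume (toTorus L x j)
  exact (measurePreserving_fromTorus hL).comp
    ((h2.smul_measure (ENNReal.ofReal (L ^ d))).comp (measurePreserving_toTorus hL))

theorem mFourier_toTorus (m : Fin d → ℤ) (x : E d) :
    UnitAddTorus.mFourier m (toTorus L x) =
      Complex.exp (2 * Real.pi * Complex.I * (inner ℝ (dualPoint L m) x : ℝ)) := by
  simp only [UnitAddTorus.mFourier, ContinuousMap.coe_mk, toTorus, fourier_coe_apply]
  rw [← Complex.exp_sum]
  congr 1
  simp only [dualPoint, PiLp.inner_apply, RCLike.inner_apply, conj_trivial]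
  push_cast
  rw [Finset.mul_sum]
  refine Finset.sum_congr rfl fun j _ => ?_
  ring

end Torus

end PoissonSchrodinger

/-! ### Fourier series on the box. -/

namespace PoissonSchrodinger

section Fourier

variable {d : ℕ} {L : ℝ}

theorem pi_haarAddCircle (d : ℕ) :
    (Measure.pi fun _ : Fin d => (AddCircle.haarAddCircle : Measure UnitAddCircle)) =
      (volume : Measure (UnitAddTorus (Fin d))) := by
  rw [volume_pi]
  congr 1
  funext _
  rw [AddCircle.volume_eq_smul_haarAddCircle]
  simp

theorem integral_mFourier_conj_mul (m n : Fin d → ℤ) :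
    ∫ t : UnitAddTorus (Fin d), UnitAddTorus.mFourier n t *
      (starRingEnd ℂ) (UnitAddTorus.mFourier m t) = if m = n then 1 else 0 := by
  have h := orthonormal_iff_ite.1 (UnitAddTorus.orthonormal_mFourier (d := Fin d)) m n
  rw [← h, L2.inner_def, ← pi_haarAddCircle]
  refine integral_congr_ae ?_
  filter_upwards [UnitAddTorus.coeFn_mFourierLp 2 m, UnitAddTorus.coeFn_mFourierLp 2 n]
    with t h1 h2
  rw [h1, h2]
  simp

/-- Square integrable functions on the torus with vanishing Fourier coefficients vanish. -/
theorem ae_eq_zero_of_mFourierCoeff {g : UnitAddTorus (Fin d) → ℂ} (hg : MemLp g 2 volume)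
    (h : ∀ m : Fin d → ℤ, ∫ t, UnitAddTorus.mFourier (-m) t * g t = 0) : g =ᵐ[volume] 0 := by
  rw [← pi_haarAddCircle] at hg h ⊢
  have h1 : (UnitAddTorus.mFourierBasis (d := Fin d)).repr (hg.toLp g) = 0 := by
    ext m
    rw [UnitAddTorus.mFourierBasis_repr, UnitAddTorus.mFourierCoeff, lp.coeFn_zero,
      Pi.zero_apply, ← h m]
    refine integral_congr_ae ?_
    filter_upwards [hg.coeFn_toLp] with t ht
    rw [smul_eq_mul, ht]
  have h2 := (LinearIsometryEquiv.map_eq_zero_iff _).1 h1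
  have h3 := hg.coeFn_toLp
  rw [h2] at h3
  exact h3.symm.trans (Lp.coeFn_zero _ _ _)

theorem fourierCoeffBox_eq_inner (f : L2Box d L) (m : Fin d → ℤ) :
    fourierCoeffBox f m = inner ℂ (planeWave L m) f := by
  rw [L2.inner_def, fourierCoeffBox]
  refine integral_congr_ae ?_
  filter_upwards [(memLp_planeWave L m).coeFn_toLp] with x hx
  rw [planeWave, hx, RCLike.inner_apply, ← Complex.exp_conj, mul_comm]
  congr 2
  simp [Complex.conj_ofNat]

theorem measureReal_box (hL : 0 < L) : volume.real (box d L) = L ^ d := by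
  rw [measureReal_def, volume_box hL, ENNReal.toReal_ofReal (by positivity)]

theorem inner_planeWave (hL : 0 < L) (m n : Fin d → ℤ) :
    inner ℂ (planeWave L m) (planeWave L n) = if m = n then ((L ^ d : ℝ) : ℂ) else 0 := by
  have h1 : inner ℂ (planeWave L m) (planeWave L n) =
      ∫ x in box d L, UnitAddTorus.mFourier n (toTorus L x) *
        (starRingEnd ℂ) (UnitAddTorus.mFourier m (toTorus L x)) := by
    rw [L2.inner_def]
    refine integral_congr_ae ?_
    filter_upwards [(memLp_planeWave L m).coeFn_toLp, (memLp_planeWave L n).coeFn_toLp]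
      with x hx hx'
    rw [planeWave, planeWave, hx, hx', RCLike.inner_apply, mFourier_toTorus, mFourier_toTorus]
  rw [h1, ← integral_map (φ := toTorus L)
    (f := fun t => UnitAddTorus.mFourier n t * (starRingEnd ℂ) (UnitAddTorus.mFourier m t))
    (measurable_toTorus L).aemeasurable (Continuous.aestronglyMeasurable (by fun_prop)),
    (measurePreserving_toTorus hL).map_eq, integral_smul_measure, integral_mFourier_conj_mul,
    ENNReal.toReal_ofReal (by positivity)]
  split_ifs <;> simp

/-- Completeness of the characters, transported from the unit torus along `fromTorus` and back along
`toTorus`; it supplies the totality in `boxBasis`. -/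
theorem eq_zero_of_fourierCoeffBox (hL : 0 < L) (f : L2Box d L)
    (h : ∀ m, fourierCoeffBox f m = 0) : f = 0 := by
  have hc : ENNReal.ofReal (L ^ d) ≠ 0 := by simpa using pow_pos hL d
  have h1 := (Lp.memLp f).comp_measurePreserving (measurePreserving_fromTorus hL)
  have h2 : MemLp (f ∘ fromTorus L) 2 (volume : Measure (UnitAddTorus (Fin d))) := by
    refine h1.of_measure_le_smul (c := (ENNReal.ofReal (L ^ d))⁻¹) (by simpa using hc) ?_
    rw [smul_smul, ENNReal.inv_mul_cancel hc ENNReal.ofReal_ne_top, one_smul]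
  have h3 := ae_eq_zero_of_mFourierCoeff h2 fun m => by
    have h4 : ∫ t, UnitAddTorus.mFourier (-m) t * (f ∘ fromTorus L) t
        ∂(ENNReal.ofReal (L ^ d) • (volume : Measure (UnitAddTorus (Fin d)))) =
          fourierCoeffBox f m := by
      rw [← (measurePreserving_toTorus hL).map_eq, integral_map]
      · refine integral_congr_ae ?_
        filter_upwards [ae_restrict_mem (measurableSet_box d L)] with x hx
        rw [Function.comp_apply, fromTorus_toTorus hL hx, UnitAddTorus.mFourier_neg,
          mFourier_toTorus, ← Complex.exp_conj]
        congr 2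
        simp [Complex.conj_ofNat]
      · exact (measurable_toTorus L).aemeasurable
      · rw [(measurePreserving_toTorus hL).map_eq]
        exact (Continuous.aestronglyMeasurable (by fun_prop)).mul h1.1
    rw [integral_smul_measure, h m, smul_eq_zero] at h4
    refine h4.resolve_left ?_
    simpa [ENNReal.toReal_ofReal (pow_pos hL d).le] using (pow_pos hL d).ne'
  have h5 : ∀ᵐ x ∂(volume : Measure (E d)).restrict (box d L), f (fromTorus L (toTorus L x)) = 0 := by
    refine ae_of_ae_map (measurable_toTorus L).aemeasurable
      (p := fun t => f (fromTorus L t) = 0) ?_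
    rw [(measurePreserving_toTorus hL).map_eq]
    exact Measure.ae_smul_measure h3 _
  refine (Lp.eq_zero_iff_ae_eq_zero).2 ?_
  filter_upwards [h5, ae_restrict_mem (measurableSet_box d L)] with x hx hb
  rwa [fromTorus_toTorus hL hb] at hx

theorem orthonormal_planeWave (hL : 0 < L) :
    Orthonormal ℂ fun m : Fin d → ℤ => ((√(L ^ d))⁻¹ : ℂ) • planeWave (d := d) L m := by
  rw [orthonormal_iff_ite]
  intro m n
  rw [inner_smul_left, inner_smul_right, inner_planeWave hL]
  split_ifs
  · rw [← Complex.ofReal_inv, Complex.conj_ofReal, ← Complex.ofReal_mul, ← Complex.ofReal_mul,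
      ← mul_assoc, ← mul_inv, Real.mul_self_sqrt (by positivity), inv_mul_cancel₀ (by positivity),
      Complex.ofReal_one]
  · simp

/-- The normalized plane waves form a Hilbert basis. -/
def boxBasis (d : ℕ) (hL : 0 < L) : HilbertBasis (Fin d → ℤ) ℂ (L2Box d L) :=
  HilbertBasis.mkOfOrthogonalEqBot (orthonormal_planeWave hL) <| by
    rw [Submodule.eq_bot_iff]
    intro f hf
    refine eq_zero_of_fourierCoeffBox hL f fun m => ?_
    have h1 := (Submodule.mem_orthogonal _ _).1 hf _ (Submodule.subset_span ⟨m, rfl⟩)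
    rw [inner_smul_left, mul_eq_zero] at h1
    rw [fourierCoeffBox_eq_inner]
    refine h1.resolve_left ?_
    simpa using (Real.sqrt_pos.2 (pow_pos hL d)).ne'

theorem boxBasis_apply (hL : 0 < L) (m : Fin d → ℤ) :
    boxBasis d hL m = ((√(L ^ d))⁻¹ : ℂ) • planeWave L m := by
  rw [boxBasis, HilbertBasis.coe_mkOfOrthogonalEqBot]

theorem boxBasis_repr (hL : 0 < L) (f : L2Box d L) (m : Fin d → ℤ) :
    (boxBasis d hL).repr f m = ((√(L ^ d))⁻¹ : ℂ) * fourierCoeffBox f m := by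
  rw [HilbertBasis.repr_apply_apply, boxBasis_apply, inner_smul_left, fourierCoeffBox_eq_inner,
    ← Complex.ofReal_inv, Complex.conj_ofReal]

theorem fourierCoeffBox_eq_repr (hL : 0 < L) (f : L2Box d L) (m : Fin d → ℤ) :
    fourierCoeffBox f m = (√(L ^ d) : ℂ) * (boxBasis d hL).repr f m := by
  rw [boxBasis_repr, ← mul_assoc, mul_inv_cancel₀, one_mul]
  simpa using (Real.sqrt_pos.2 (pow_pos hL d)).ne'

theorem fourierCoeffBox_ext (hL : 0 < L) {f g : L2Box d L}
    (h : ∀ m, fourierCoeffBox f m = fourierCoeffBox g m) : f = g := by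
  refine (boxBasis d hL).repr.injective ?_
  ext m
  rw [boxBasis_repr, boxBasis_repr, h m]

theorem fourierCoeffBox_add (f g : L2Box d L) (m : Fin d → ℤ) :
    fourierCoeffBox (f + g) m = fourierCoeffBox f m + fourierCoeffBox g m := by
  simp only [fourierCoeffBox_eq_inner, inner_add_right]

theorem fourierCoeffBox_sub (f g : L2Box d L) (m : Fin d → ℤ) :
    fourierCoeffBox (f - g) m = fourierCoeffBox f m - fourierCoeffBox g m := by
  simp only [fourierCoeffBox_eq_inner, inner_sub_right]

theorem fourierCoeffBox_smul (c : ℂ) (f : L2Box d L) (m : Fin d → ℤ) :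
    fourierCoeffBox (c • f) m = c * fourierCoeffBox f m := by
  simp only [fourierCoeffBox_eq_inner, inner_smul_right]

theorem memℓp_fourierCoeffBox (hL : 0 < L) (f : L2Box d L) : Memℓp (fourierCoeffBox f) 2 := by
  have h : fourierCoeffBox f = (√(L ^ d) : ℂ) • ⇑((boxBasis d hL).repr f) := by
    funext m
    rw [fourierCoeffBox_eq_repr hL]; rfl
  rw [h]
  exact (lp.memℓp ((boxBasis d hL).repr f)).const_smul _

/-- The Fourier series of a square summable family has the given coefficients. -/
theorem fourierCoeffBox_fourierInvBox (hL : 0 < L) {g : (Fin d → ℤ) → ℂ} (hg : Memℓp g 2)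
    (m : Fin d → ℤ) : fourierCoeffBox (fourierInvBox g : L2Box d L) m = g m := by
  have hs : (√(L ^ d) : ℂ) ≠ 0 := by simpa using (Real.sqrt_pos.2 (pow_pos hL d)).ne'
  have hs2 : ((L ^ d : ℝ) : ℂ) = (√(L ^ d) : ℂ) * (√(L ^ d) : ℂ) := by
    rw [← Complex.ofReal_mul, Real.mul_self_sqrt (by positivity)]
  let G : lp (fun _ : Fin d → ℤ => ℂ) 2 := ⟨_, hg.const_smul ((√(L ^ d))⁻¹ : ℂ)⟩
  have h1 : fourierInvBox g = (boxBasis d hL).repr.symm G := by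
    rw [← ((boxBasis d hL).hasSum_repr_symm G).tsum_eq, fourierInvBox]
    refine tsum_congr fun n => ?_
    rw [boxBasis_apply, smul_smul, measureReal_box hL]
    congr 1
    change _ = ((√(L ^ d))⁻¹ : ℂ) * g n * _
    rw [Complex.ofReal_inv, hs2]
    field_simp
  rw [fourierCoeffBox_eq_repr hL, h1, LinearIsometryEquiv.apply_symm_apply]
  change _ * (((√(L ^ d))⁻¹ : ℂ) * g m) = _
  field_simp

theorem exists_fourierCoeffBox (hL : 0 < L) {g : (Fin d → ℤ) → ℂ} (hg : Memℓp g 2) :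
    ∃ u : L2Box d L, ∀ m, fourierCoeffBox u m = g m :=
  ⟨_, fourierCoeffBox_fourierInvBox hL hg⟩

/-- Parseval's identity. The factor `L⁻ᵈ` is the cell volume of the dual lattice, which turns such
sums into Riemann sums. -/
theorem hasSum_fourierCoeffBox (hL : 0 < L) (f g : L2Box d L) :
    HasSum (fun m => ((L ^ d : ℝ) : ℂ)⁻¹ *
      ((starRingEnd ℂ) (fourierCoeffBox f m) * fourierCoeffBox g m)) (inner ℂ f g) := by
  have hs2 : ((L ^ d : ℝ) : ℂ)⁻¹ = ((√(L ^ d))⁻¹ : ℂ) * ((√(L ^ d))⁻¹ : ℂ) := by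
    rw [← mul_inv, ← Complex.ofReal_mul, Real.mul_self_sqrt (by positivity)]
  have h := (boxBasis d hL).hasSum_inner_mul_inner f g
  rw [show (fun m => ((L ^ d : ℝ) : ℂ)⁻¹ * ((starRingEnd ℂ) (fourierCoeffBox f m) *
      fourierCoeffBox g m)) = fun m => inner ℂ f (boxBasis d hL m) * inner ℂ (boxBasis d hL m) g
    from funext fun m => ?_]
  · exact h
  rw [← inner_conj_symm f, ← HilbertBasis.repr_apply_apply, ← HilbertBasis.repr_apply_apply,
    boxBasis_repr, boxBasis_repr, map_mul, hs2, map_inv₀, Complex.conj_ofReal]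
  ring

theorem fourierCoeffBox_kinetic (hL : 0 < L) {u : L2Box d L} (hu : u ∈ laplacianDomain d L)
    (m : Fin d → ℤ) :
    fourierCoeffBox (kinetic u) m = (energy (dualPoint L m) : ℂ) * fourierCoeffBox u m := by
  rw [kinetic, negLaplacian, smul_smul, fourierCoeffBox_smul, fourierCoeffBox_fourierInvBox hL hu,
    ← Complex.ofReal_mul, inv_mul_cancel₀ (by positivity), Complex.ofReal_one, one_mul]

end Fourier

/-! ### The free resolvent as a Fourier multiplier. -/

section Resolvent

variable {d : ℕ} {L : ℝ} {z : ℂ}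

theorem infDist_halfLine_pos (hz : z ∉ halfLine) : 0 < Metric.infDist z halfLine := by
  have hc : IsClosed halfLine := by
    have : halfLine = {z : ℂ | 0 ≤ z.re ∧ z.im = 0} := by
      ext w
      constructor
      · rintro ⟨x, hx, rfl⟩; exact ⟨by simpa using hx, by simp⟩
      · rintro ⟨h1, h2⟩; exact ⟨w.re, h1, Complex.ext (by simp) (by simp [h2])⟩
    rw [this]
    exact (isClosed_le continuous_const Complex.continuous_re).inter
      (isClosed_eq Complex.continuous_im continuous_const)
  exact (hc.notMem_iff_infDist_pos ⟨0, 0, by simp, by simp⟩).1 hz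

theorem infDist_le_norm_energy_sub (z : ℂ) (p : E d) :
    Metric.infDist z halfLine ≤ ‖(energy p : ℂ) - z‖ := by
  rw [← dist_eq_norm, dist_comm]
  exact Metric.infDist_le_dist_of_mem ⟨energy p, by simp [energy]; positivity, rfl⟩

theorem energy_sub_ne_zero (hz : z ∉ halfLine) (p : E d) : (energy p : ℂ) - z ≠ 0 :=
  norm_pos_iff.1 ((infDist_halfLine_pos hz).trans_le (infDist_le_norm_energy_sub z p))

theorem norm_energy_sub_inv_le (hz : z ∉ halfLine) (p : E d) :
    ‖((energy p : ℂ) - z)⁻¹‖ ≤ (Metric.infDist z halfLine)⁻¹ := by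
  rw [norm_inv]
  exact inv_anti₀ (infDist_halfLine_pos hz) (infDist_le_norm_energy_sub z p)

/-- The resolvent is a chosen preimage, hence meaningful only once a solution exists. The one with
coefficients `(ν - z)⁻¹ f̂` works, since the symbol is bounded by the inverse distance of `z` to the
half line. -/
theorem freeResolvent_spec (hL : 0 < L) (hz : z ∉ halfLine) (f : L2Box d L) :
    freeResolvent z f ∈ laplacianDomain d L ∧
      kinetic (freeResolvent z f) - z • freeResolvent z f = f := by
  have hf := memℓp_fourierCoeffBox hL f
  have hbd : Memℓp (fun m => ((energy (dualPoint L m) : ℂ) - z)⁻¹ * fourierCoeffBox f m) 2 := by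
    have h2 : Memℓp ((((Metric.infDist z halfLine)⁻¹ : ℝ) : ℂ) • fourierCoeffBox f) 2 :=
      hf.const_smul _
    refine memℓp_gen ((((memℓp_gen_iff (by norm_num)).1 h2)).of_nonneg_of_le
      (fun m => by positivity) fun m => ?_)
    refine Real.rpow_le_rpow (norm_nonneg _) ?_ (by norm_num)
    rw [Pi.smul_apply, smul_eq_mul, norm_mul, norm_mul, Complex.norm_real, Real.norm_eq_abs,
      abs_of_pos (inv_pos.2 (infDist_halfLine_pos hz))]
    exact mul_le_mul_of_nonneg_right (norm_energy_sub_inv_le hz _) (norm_nonneg _)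
  obtain ⟨u, hu⟩ := exists_fourierCoeffBox hL hbd
  have hud : u ∈ laplacianDomain d L := by
    -- Membership in the domain: `ν û = f̂ + z û` is a sum of two square summable families.
    have h1 : (fun m => (energy (dualPoint L m) : ℂ) * fourierCoeffBox u m) =
        fourierCoeffBox f + z • fourierCoeffBox u := by
      funext m
      have := energy_sub_ne_zero hz (dualPoint L m)
      rw [Pi.add_apply, Pi.smul_apply, smul_eq_mul, hu m]
      field_simp
      ring
    rw [laplacianDomain, Set.mem_ofPred_eq, h1]
    exact hf.add ((memℓp_fourierCoeffBox hL u).const_smul z)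
  have hex : ∃ a ∈ laplacianDomain d L, kinetic a - z • a = f := by
    refine ⟨u, hud, fourierCoeffBox_ext hL fun m => ?_⟩
    rw [fourierCoeffBox_sub, fourierCoeffBox_smul, fourierCoeffBox_kinetic hL hud, ← sub_mul, hu,
      mul_inv_cancel_left₀ (energy_sub_ne_zero hz _)]
  exact ⟨Function.invFunOn_mem hex, Function.invFunOn_eq (f := fun u => kinetic u - z • u) hex⟩

/-- The free resolvent is the Fourier multiplier with symbol `(ν - z)⁻¹`. -/
theorem fourierCoeffBox_freeResolvent (hL : 0 < L) (hz : z ∉ halfLine) (f : L2Box d L)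
    (m : Fin d → ℤ) :
    fourierCoeffBox (freeResolvent z f) m =
      ((energy (dualPoint L m) : ℂ) - z)⁻¹ * fourierCoeffBox f m := by
  obtain ⟨h1, h2⟩ := freeResolvent_spec hL hz f
  have h3 := fourierCoeffBox_sub (kinetic (freeResolvent z f)) (z • freeResolvent z f) m
  rw [h2, fourierCoeffBox_smul, fourierCoeffBox_kinetic hL h1, ← sub_mul] at h3
  rw [h3, inv_mul_cancel_left₀ (energy_sub_ne_zero hz _)]

theorem norm_sq_freeResolvent (hL : 0 < L) (hz : z ∉ halfLine) (f : L2Box d L) :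
    HasSum (fun m => (L ^ d)⁻¹ * (‖((energy (dualPoint L m) : ℂ) - z)⁻¹‖ ^ 2 *
      ‖fourierCoeffBox f m‖ ^ 2)) (‖freeResolvent z f‖ ^ 2) := by
  have h := hasSum_fourierCoeffBox hL (freeResolvent z f) (freeResolvent z f)
  rw [inner_self_eq_norm_sq_to_K] at h
  have h' := Complex.hasSum_iff _ _ |>.1 h |>.1
  convert h' using 2 with m
  · rw [← Complex.normSq_eq_conj_mul_self, ← Complex.ofReal_inv, ← Complex.ofReal_mul,
      Complex.ofReal_re, fourierCoeffBox_freeResolvent hL hz, Complex.normSq_eq_norm_sq, norm_mul,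
      mul_pow]
  · norm_cast

theorem norm_freeResolvent_le (hL : 0 < L) (hz : z ∉ halfLine) (f : L2Box d L) :
    ‖freeResolvent z f‖ ≤ (Metric.infDist z halfLine)⁻¹ * ‖f‖ := by
  have hr := (inv_pos.2 (infDist_halfLine_pos hz)).le
  have h0 := hasSum_fourierCoeffBox hL f f
  rw [inner_self_eq_norm_sq_to_K] at h0
  have h1 := (Complex.hasSum_iff _ _ |>.1 h0 |>.1).mul_left ((Metric.infDist z halfLine)⁻¹ ^ 2)
  have h2 := norm_sq_freeResolvent hL hz f
  have h3 : ‖freeResolvent z f‖ ^ 2 ≤ ((Metric.infDist z halfLine)⁻¹ * ‖f‖) ^ 2 := by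
    rw [mul_pow]
    refine (hasSum_le (fun m => ?_) h2 h1).trans_eq (by norm_cast)
    rw [← Complex.normSq_eq_conj_mul_self, ← Complex.ofReal_inv, ← Complex.ofReal_mul,
      Complex.ofReal_re, Complex.normSq_eq_norm_sq, mul_left_comm]
    gcongr
    exact norm_energy_sub_inv_le hz _
  exact (pow_le_pow_iff_left₀ (norm_nonneg _) (by positivity) two_ne_zero).1 h3

/-- The free resolvent as a bounded operator on `L²` of the box. -/
def boxResolvent (hL : 0 < L) (hz : z ∉ halfLine) : L2Box d L →L[ℂ] L2Box d L :=
  LinearMap.mkContinuous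
    { toFun := freeResolvent z
      map_add' := fun f g => fourierCoeffBox_ext hL fun m => by
        rw [fourierCoeffBox_add]
        simp only [fourierCoeffBox_freeResolvent hL hz, fourierCoeffBox_add]
        ring
      map_smul' := fun c f => fourierCoeffBox_ext hL fun m => by
        rw [RingHom.id_apply, fourierCoeffBox_smul]
        simp only [fourierCoeffBox_freeResolvent hL hz, fourierCoeffBox_smul]
        ring }
    (Metric.infDist z halfLine)⁻¹ (norm_freeResolvent_le hL hz)

/-- Restriction to the box as a bounded operator. -/
def restrictCLM (d : ℕ) (L : ℝ) : L2Space d →L[ℂ] L2Box d L :=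
  LpToLpRestrictCLM (E d) ℂ ℂ volume 2 (box d L)

/-- The free resolvent on the box, extended by zero to `L²(ℝ^d)`. -/
def spaceResolvent (hL : 0 < L) (hz : z ∉ halfLine) : L2Space d →L[ℂ] L2Space d :=
  (ContinuousLinearMap.adjoint (restrictCLM d L)) ∘L boxResolvent hL hz ∘L restrictCLM d L

theorem restrictBox_eq (L : ℝ) (f : L2Space d) : restrictBox L f = restrictCLM d L f := rfl

theorem coeFn_restrictBox (L : ℝ) (f : L2Space d) :
    restrictBox L f =ᵐ[volume.restrict (box d L)] f := LpToLpRestrictCLM_coeFn ℂ _ f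

theorem norm_restrictBox_le (L : ℝ) (f : L2Space d) : ‖restrictBox L f‖ ≤ ‖f‖ := by
  rw [Lp.norm_def, Lp.norm_def]
  refine ENNReal.toReal_mono (Lp.eLpNorm_ne_top f) ?_
  rw [eLpNorm_congr_ae (coeFn_restrictBox L f)]
  exact eLpNorm_mono_measure _ Measure.restrict_le_self

theorem inner_spaceResolvent (hL : 0 < L) (hz : z ∉ halfLine) (f g : L2Space d) :
    inner ℂ g (spaceResolvent hL hz f) =
      inner ℂ (restrictBox L g) (freeResolvent z (restrictBox L f)) := by
  rw [spaceResolvent, ContinuousLinearMap.comp_apply, ContinuousLinearMap.adjoint_inner_right]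
  rfl

theorem norm_spaceResolvent_le' (hL : 0 < L) (hz : z ∉ halfLine) (f : L2Space d) :
    ‖spaceResolvent hL hz f‖ ≤ ‖freeResolvent z (restrictBox L f)‖ := by
  refine ((ContinuousLinearMap.adjoint (restrictCLM d L)).le_opNorm _).trans ?_
  rw [LinearIsometryEquiv.norm_map]
  exact mul_le_of_le_one_left (norm_nonneg _)
    ((restrictCLM d L).opNorm_le_bound zero_le_one fun f => by
      rw [one_mul]; exact norm_restrictBox_le L f)

theorem norm_spaceResolvent_le (hL : 0 < L) (hz : z ∉ halfLine) (f : L2Space d) :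
    ‖spaceResolvent hL hz f‖ ≤ (Metric.infDist z halfLine)⁻¹ * ‖f‖ := by
  refine ((norm_spaceResolvent_le' hL hz f).trans (norm_freeResolvent_le hL hz _)).trans ?_
  gcongr
  · exact inv_nonneg.2 Metric.infDist_nonneg
  · exact norm_restrictBox_le L f

end Resolvent

end PoissonSchrodinger

/-! ### Strong convergence of the free resolvents. -/

namespace PoissonSchrodinger

open scoped FourierTransform

section Mul

variable {α : Type*} [MeasurableSpace α] {μ : Measure α}

theorem memLp_mul {a : α → ℂ} (ha : Measurable a) {c : ℝ} (hc : ∀ x, ‖a x‖ ≤ c)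
    (f : Lp ℂ 2 μ) : MemLp (fun x => a x * f x) 2 μ :=
  (Lp.memLp f).of_le_mul (c := c) (ha.aestronglyMeasurable.mul (Lp.aestronglyMeasurable f))
    (Eventually.of_forall fun x => by
      rw [norm_mul]; exact mul_le_mul_of_nonneg_right (hc x) (norm_nonneg _))

/-- Multiplication by a bounded measurable function. -/
def mulCLM (μ : Measure α) (a : α → ℂ) (ha : Measurable a) (c : ℝ) (hc : ∀ x, ‖a x‖ ≤ c) :
    Lp ℂ 2 μ →L[ℂ] Lp ℂ 2 μ :=
  LinearMap.mkContinuous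
    { toFun := fun f => (memLp_mul ha hc f).toLp
      map_add' := fun f g => by
        ext1
        filter_upwards [(memLp_mul ha hc (f + g)).coeFn_toLp, (memLp_mul ha hc f).coeFn_toLp,
          (memLp_mul ha hc g).coeFn_toLp, Lp.coeFn_add f g,
          Lp.coeFn_add (memLp_mul ha hc f).toLp (memLp_mul ha hc g).toLp] with x h1 h2 h3 h4 h5
        rw [h1, h5, Pi.add_apply, h2, h3, h4, Pi.add_apply, mul_add]
      map_smul' := fun b f => by
        ext1
        filter_upwards [(memLp_mul ha hc (b • f)).coeFn_toLp, (memLp_mul ha hc f).coeFn_toLp,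
          Lp.coeFn_smul b f, Lp.coeFn_smul b (memLp_mul ha hc f).toLp] with x h1 h2 h4 h5
        rw [RingHom.id_apply, h1, h5, Pi.smul_apply, h2, h4, Pi.smul_apply, smul_eq_mul,
          smul_eq_mul, mul_left_comm] }
    c fun f => by
      refine Lp.norm_le_mul_norm_of_ae_le_mul ?_
      filter_upwards [(memLp_mul ha hc f).coeFn_toLp] with x h1
      change ‖(memLp_mul ha hc f).toLp _ x‖ ≤ _
      rw [h1, norm_mul]
      exact mul_le_mul_of_nonneg_right (hc x) (norm_nonneg _)

theorem coeFn_mulCLM {a : α → ℂ} (ha : Measurable a) {c : ℝ} (hc : ∀ x, ‖a x‖ ≤ c)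
    (f : Lp ℂ 2 μ) : mulCLM μ a ha c hc f =ᵐ[μ] fun x => a x * f x :=
  (memLp_mul ha hc f).coeFn_toLp

theorem norm_mulCLM_le {a : α → ℂ} (ha : Measurable a) {c : ℝ} (hc : ∀ x, ‖a x‖ ≤ c)
    (f : Lp ℂ 2 μ) : ‖mulCLM μ a ha c hc f‖ ≤ c * ‖f‖ := by
  refine Lp.norm_le_mul_norm_of_ae_le_mul ?_
  filter_upwards [coeFn_mulCLM ha hc f] with x h1
  rw [h1, norm_mul]
  exact mul_le_mul_of_nonneg_right (hc x) (norm_nonneg _)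

end Mul

section Riemann

variable {d : ℕ} {L : ℝ}

/-- The lattice label of the cell of side `1 / L` that contains `p`. -/
def cellLabel (L : ℝ) (p : E d) : Fin d → ℤ := fun j => ⌊L * p j⌋

theorem measurable_cellLabel (L : ℝ) : Measurable (cellLabel L : E d → Fin d → ℤ) :=
  measurable_pi_lambda _ fun j => Int.measurable_floor.comp (by fun_prop)

theorem volume_cellLabel (hL : 0 < L) (m : Fin d → ℤ) :
    volume (cellLabel L ⁻¹' {m}) = ENNReal.ofReal ((L ^ d)⁻¹) := by
  have h1 : (cellLabel L ⁻¹' {m} : Set (E d)) = WithLp.ofLp ⁻¹'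
      (Set.univ.pi fun j => Set.Ico ((m j : ℝ) / L) ((m j + 1 : ℝ) / L)) := by
    ext p
    simp only [Set.mem_preimage, Set.mem_singleton_iff, Set.mem_univ_pi, cellLabel, funext_iff,
      Int.floor_eq_iff, Set.mem_Ico]
    refine forall_congr' fun j => ?_
    rw [div_le_iff₀ hL, lt_div_iff₀ hL, mul_comm]
  rw [h1, (PiLp.volume_preserving_ofLp (Fin d)).measure_preimage
    (MeasurableSet.univ_pi fun _ => measurableSet_Ico).nullMeasurableSet, Real.volume_pi_Ico]
  have h2 : ∀ j : Fin d, ENNReal.ofReal (((m j : ℝ) + 1) / L - m j / L) = ENNReal.ofReal L⁻¹ :=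
    fun j => by congr 1; field_simp; ring
  simp only [h2]
  rw [Finset.prod_const, Finset.card_univ, Fintype.card_fin, ← ENNReal.ofReal_pow (by positivity),
    inv_pow]

theorem norm_sub_dualPoint_cellLabel_le (hL : 0 < L) (p : E d) :
    ‖dualPoint L (cellLabel L p) - p‖ ≤ d / L := by
  rw [EuclideanSpace.norm_eq]
  refine (Real.sqrt_le_iff).2 ⟨by positivity, ?_⟩
  have h1 : ∀ j : Fin d, ‖(dualPoint L (cellLabel L p) - p) j‖ ^ 2 ≤ (1 / L) ^ 2 := fun j => by
    refine pow_le_pow_left₀ (norm_nonneg _) ?_ 2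
    have h2 := Int.floor_le (L * p j)
    have h3 := Int.lt_floor_add_one (L * p j)
    have h4 : (dualPoint L (cellLabel L p) - p) j = (⌊L * p j⌋ - L * p j) / L := by
      simp only [dualPoint, cellLabel, PiLp.sub_apply]
      field_simp
    rw [h4, Real.norm_eq_abs, abs_div, abs_of_pos hL]
    gcongr
    rw [abs_le]
    constructor <;> linarith
  -- The natural bound is `√d / L`; the cruder `d / L` avoids the root, using `d ≤ d²`.
  refine (Finset.sum_le_sum fun j _ => h1 j).trans ?_
  rw [Finset.sum_const, Finset.card_univ, Fintype.card_fin, nsmul_eq_mul, div_pow, div_pow,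
    one_pow, mul_one_div]
  gcongr
  norm_cast
  exact Nat.le_self_pow two_ne_zero d

/-- A lattice sum is the integral of a step function, so convergence of Riemann sums becomes
dominated convergence. -/
theorem integral_cellLabel (hL : 0 < L) {F : (Fin d → ℤ) → ℂ}
    (hF : Integrable fun p : E d => F (cellLabel L p)) :
    ∫ p : E d, F (cellLabel L p) = ∑' m, ((L ^ d : ℝ) : ℂ)⁻¹ * F m := by
  have h1 := integral_map (μ := (volume : Measure (E d))) (measurable_cellLabel L).aemeasurable
    (f := F) (measurable_of_countable F).aestronglyMeasurable
  rw [← h1, integral_countable]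
  · refine tsum_congr fun m => ?_
    rw [measureReal_def, Measure.map_apply (measurable_cellLabel L) (measurableSet_singleton m),
      volume_cellLabel hL, ENNReal.toReal_ofReal (by positivity), Complex.real_smul,
      Complex.ofReal_inv]
  · exact (integrable_map_measure (measurable_of_countable F).aestronglyMeasurable
      (measurable_cellLabel L).aemeasurable).2 hF

/-- Riemann sums over the dual lattice of a continuous function with integrable decay. -/
theorem tendsto_riemannSum {F : E d → ℂ} (hF : Continuous F) {C : ℝ}
    (hC : ∀ p, ‖F p‖ ≤ C * (1 + ‖p‖) ^ (-(d + 1 : ℝ))) :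
    Tendsto (fun L : ℝ => ∑' m : Fin d → ℤ, ((L ^ d : ℝ) : ℂ)⁻¹ * F (dualPoint L m)) atTop
      (𝓝 (∫ p, F p)) := by
  have hC0 : 0 ≤ C := by
    have := (norm_nonneg _).trans (hC 0)
    simpa using this
  -- For `L ≥ 1` a point and the corner of its cell differ by at most `d`, so `1 + ‖p‖ ≤ (1 + d) (1
  -- + ‖q‖)`; hence the extra factor in the dominating function.
  set bd : E d → ℝ := fun p => C * ((1 + d) ^ (d + 1 : ℝ) * (1 + ‖p‖) ^ (-(d + 1 : ℝ))) with hbd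
  have hint : Integrable bd := ((integrable_one_add_norm (by simp)).const_mul _).const_mul _
  have hle : ∀ L : ℝ, 1 ≤ L → ∀ p : E d, ‖F (dualPoint L (cellLabel L p))‖ ≤ bd p := by
    intro L hL p
    refine (hC _).trans (mul_le_mul_of_nonneg_left ?_ hC0)
    have h1 := norm_sub_dualPoint_cellLabel_le (zero_lt_one.trans_le hL) p
    have h2 : (d : ℝ) / L ≤ d := div_le_self (by positivity) hL
    set q := dualPoint L (cellLabel L p)
    have h3 : ‖p‖ ≤ ‖q‖ + d := by
      have := norm_sub_le q (q - p)
      rw [sub_sub_cancel] at this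
      linarith
    have h4 : (1 + ‖p‖) ≤ (1 + d) * (1 + ‖q‖) := by
      nlinarith [norm_nonneg q, Nat.cast_nonneg (α := ℝ) d, mul_nonneg (Nat.cast_nonneg (α := ℝ) d) (norm_nonneg q)]
    rw [Real.rpow_neg (by positivity), Real.rpow_neg (by positivity), ← div_eq_mul_inv,
      le_div_iff₀ (by positivity), inv_mul_le_iff₀ (by positivity), mul_comm _ ((1 + (d : ℝ)) ^ _),
      ← Real.mul_rpow (by positivity) (by positivity)]
    exact Real.rpow_le_rpow (by positivity) h4 (by positivity)
  have hmeas : ∀ L : ℝ, AEStronglyMeasurable (fun p : E d => F (dualPoint L (cellLabel L p))) :=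
    fun L => ((measurable_of_countable fun m => F (dualPoint L m)).comp
      (measurable_cellLabel L)).aestronglyMeasurable
  have hlim : Tendsto (fun L : ℝ => ∫ p : E d, F (dualPoint L (cellLabel L p))) atTop
      (𝓝 (∫ p, F p)) := by
    refine tendsto_integral_filter_of_dominated_convergence bd (Eventually.of_forall hmeas) ?_
      hint ?_
    · filter_upwards [eventually_ge_atTop 1] with L hL
      exact Eventually.of_forall (hle L hL)
    · refine Eventually.of_forall fun p => (hF.tendsto p).comp ?_
      rw [tendsto_iff_norm_sub_tendsto_zero]
      refine squeeze_zero' (Eventually.of_forall fun _ => norm_nonneg _) ?_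
        ((tendsto_const_nhds (x := (d : ℝ))).div_atTop tendsto_id)
      filter_upwards [eventually_gt_atTop 0] with L hL
      exact norm_sub_dualPoint_cellLabel_le hL p
  refine hlim.congr' ?_
  filter_upwards [eventually_ge_atTop 1] with L hL
  exact integral_cellLabel (F := fun m => F (dualPoint L m)) (zero_lt_one.trans_le hL)
    (hint.mono' (hmeas L) (Eventually.of_forall (hle L hL)))

end Riemann

section Limit

variable {d : ℕ} {L : ℝ} {z : ℂ}

theorem exists_dist_toLp_le (f : L2Space d) {ε : ℝ} (hε : 0 < ε) :
    ∃ φ : 𝓢(E d, ℂ), HasCompactSupport φ ∧ ‖f - φ.toLp 2 volume‖ ≤ ε := by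
  obtain ⟨g, hg₁, hg₂, hg₃⟩ := MemLp.exist_eLpNorm_sub_le (by norm_num) (by norm_num)
    (Lp.memLp f) hε
  refine ⟨hg₁.toSchwartzMap hg₂, hg₁, ?_⟩
  rw [Lp.norm_def]
  refine ENNReal.toReal_le_of_le_ofReal hε.le (le_trans (le_of_eq (eLpNorm_congr_ae ?_)) hg₃)
  filter_upwards [Lp.coeFn_sub f ((hg₁.toSchwartzMap hg₂).toLp 2 volume),
    (hg₁.toSchwartzMap hg₂).coeFn_toLp 2 volume] with x h1 h2
  rw [h1, Pi.sub_apply, h2]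
  rfl

theorem exists_support_subset_box {φ : E d → ℂ} (hφ : HasCompactSupport φ) :
    ∃ L₀ : ℝ, 0 < L₀ ∧ ∀ L, L₀ ≤ L → ∀ x ∉ box d L, φ x = 0 := by
  obtain ⟨r, hr, hsub⟩ := hφ.isCompact.isBounded.subset_ball_lt 0 0
  refine ⟨2 * r, by positivity, fun L hL x hx => ?_⟩
  by_contra hne
  refine hx fun j => ?_
  have h1 := hsub (subset_tsupport _ (Function.mem_support.2 hne))
  rw [mem_ball_zero_iff] at h1
  have h2 := abs_le.1 ((PiLp.norm_apply_le x j).trans h1.le)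
  have h3 := (abs_lt.1 ((PiLp.norm_apply_le x j).trans_lt h1)).2
  constructor <;> linarith [h2.1]

/-- Once the box contains the support, the coefficients are samples of one fixed Fourier transform,
independent of `L`. -/
theorem fourierCoeffBox_restrictBox_toLp (φ : 𝓢(E d, ℂ)) (h : ∀ x ∉ box d L, φ x = 0)
    (m : Fin d → ℤ) :
    fourierCoeffBox (restrictBox L (φ.toLp 2 volume)) m = 𝓕 φ (dualPoint L m) := by
  rw [SchwartzMap.fourier_coe, Real.fourier_eq', fourierCoeffBox]
  refine Eq.trans ?_ (setIntegral_eq_integral_of_forall_compl_eq_zero (s := box d L)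
    (fun x hx => by rw [h x hx, smul_zero]))
  refine integral_congr_ae ?_
  filter_upwards [coeFn_restrictBox L (φ.toLp 2 volume),
    ae_restrict_of_ae (φ.coeFn_toLp 2 volume)] with x h1 h2
  rw [h1, h2, smul_eq_mul, real_inner_comm]
  congr 2
  push_cast
  ring

theorem measurable_resolventSymbol (z : ℂ) :
    Measurable fun p : E d => ((energy p : ℂ) - z)⁻¹ := by
  unfold energy
  fun_prop

/-- The free resolvent on the whole space. -/
def limitResolvent (hz : z ∉ halfLine) (f : L2Space d) : L2Space d :=
  (Lp.fourierTransformₗᵢ (E d) ℂ).symm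
    (mulCLM volume _ (measurable_resolventSymbol z) _ (norm_energy_sub_inv_le hz)
      (Lp.fourierTransformₗᵢ (E d) ℂ f))

theorem inner_limitResolvent (hz : z ∉ halfLine) (φ χ : 𝓢(E d, ℂ)) :
    inner ℂ (φ.toLp 2 volume) (limitResolvent hz (χ.toLp 2 volume)) =
      ∫ p, (starRingEnd ℂ) (𝓕 φ p) * (((energy p : ℂ) - z)⁻¹ * 𝓕 χ p) := by
  have h1 : ∀ f : 𝓢(E d, ℂ), Lp.fourierTransformₗᵢ (E d) ℂ (f.toLp 2 volume) =
      (𝓕 f).toLp 2 volume := SchwartzMap.toLp_fourier_eq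
  rw [limitResolvent, ← (Lp.fourierTransformₗᵢ (E d) ℂ).inner_map_map,
    LinearIsometryEquiv.apply_symm_apply, h1, h1, L2.inner_def]
  refine integral_congr_ae ?_
  filter_upwards [coeFn_mulCLM (measurable_resolventSymbol z) (norm_energy_sub_inv_le hz)
    ((𝓕 χ).toLp 2 volume), (𝓕 φ).coeFn_toLp 2 volume, (𝓕 χ).coeFn_toLp 2 volume] with p h2 h3 h4
  rw [h2, h3, h4, RCLike.inner_apply, mul_comm]

theorem norm_sq_eq_integral {α : Type*} [MeasurableSpace α] {μ : Measure α} (f : Lp ℂ 2 μ) :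
    ((‖f‖ ^ 2 : ℝ) : ℂ) = ∫ x, ((‖f x‖ ^ 2 : ℝ) : ℂ) ∂μ := by
  have h := inner_self_eq_norm_sq_to_K (𝕜 := ℂ) f
  rw [L2.inner_def] at h
  rw [Complex.ofReal_pow]
  refine h.symm.trans (integral_congr_ae (Eventually.of_forall fun x => ?_))
  dsimp only
  rw [inner_self_eq_norm_sq_to_K, Complex.ofReal_pow]
  rfl

theorem norm_sq_limitResolvent (hz : z ∉ halfLine) (χ : 𝓢(E d, ℂ)) :
    ((‖limitResolvent hz (χ.toLp 2 volume)‖ ^ 2 : ℝ) : ℂ) =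
      ∫ p, ((‖((energy p : ℂ) - z)⁻¹‖ ^ 2 * ‖𝓕 χ p‖ ^ 2 : ℝ) : ℂ) := by
  have h1 : ∀ f : 𝓢(E d, ℂ), Lp.fourierTransformₗᵢ (E d) ℂ (f.toLp 2 volume) =
      (𝓕 f).toLp 2 volume := SchwartzMap.toLp_fourier_eq
  rw [limitResolvent, LinearIsometryEquiv.norm_map, h1, norm_sq_eq_integral]
  refine integral_congr_ae ?_
  filter_upwards [coeFn_mulCLM (measurable_resolventSymbol z) (norm_energy_sub_inv_le hz)
    ((𝓕 χ).toLp 2 volume), (𝓕 χ).coeFn_toLp 2 volume] with p h2 h3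
  rw [h2, h3, norm_mul, mul_pow]

theorem continuous_resolventSymbol (hz : z ∉ halfLine) :
    Continuous fun p : E d => ((energy p : ℂ) - z)⁻¹ := by
  refine Continuous.inv₀ ?_ fun p => energy_sub_ne_zero hz p
  unfold energy
  fun_prop

theorem exists_norm_le_decay (φ : 𝓢(E d, ℂ)) :
    ∃ C : ℝ, 0 ≤ C ∧ ∀ p, ‖φ p‖ ≤ C * (1 + ‖p‖) ^ (-(d + 1 : ℝ)) := by
  refine ⟨2 ^ (d + 1) * (Finset.Iic ((d + 1, 0) : ℕ × ℕ)).sup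
    (fun m => SchwartzMap.seminorm ℂ m.1 m.2) φ, by positivity, fun p => ?_⟩
  have h := SchwartzMap.one_add_le_sup_seminorm_apply (𝕜 := ℂ) (m := (d + 1, 0)) (k := d + 1)
    (n := 0) le_rfl le_rfl φ p
  rw [norm_iteratedFDeriv_zero] at h
  rw [Real.rpow_neg (by positivity), ← div_eq_mul_inv, le_div_iff₀ (by positivity), mul_comm]
  exact_mod_cast h

/-- Parseval turns the left side into a Riemann sum of the integrand in `inner_limitResolvent`. The
decay of one of the two Schwartz factors already suffices; the other is only bounded. -/
theorem tendsto_inner_spaceResolvent (hz : z ∉ halfLine) {φ χ : 𝓢(E d, ℂ)}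
    (hφ : HasCompactSupport φ) (hχ : HasCompactSupport χ) :
    Tendsto (fun L : ℝ => inner ℂ (restrictBox L (φ.toLp 2 volume))
      (freeResolvent z (restrictBox L (χ.toLp 2 volume)))) atTop
      (𝓝 (inner ℂ (φ.toLp 2 volume) (limitResolvent hz (χ.toLp 2 volume)))) := by
  obtain ⟨C, hC0, hC⟩ := exists_norm_le_decay (𝓕 φ)
  obtain ⟨C', hC0', hC'⟩ := exists_norm_le_decay (𝓕 χ)
  have hr := (infDist_halfLine_pos hz)
  rw [inner_limitResolvent]
  refine (tendsto_riemannSum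
    (F := fun p => (starRingEnd ℂ) (𝓕 φ p) * (((energy p : ℂ) - z)⁻¹ * 𝓕 χ p)) ?_
    (C := C * ((Metric.infDist z halfLine)⁻¹ * C')) fun p => ?_).congr' ?_
  · exact (Complex.continuous_conj.comp (𝓕 φ).continuous).mul
      ((continuous_resolventSymbol hz).mul (𝓕 χ).continuous)
  · rw [norm_mul, norm_mul, RCLike.norm_conj, mul_assoc, mul_assoc]
    have h1 : ‖𝓕 φ p‖ ≤ C := (hC p).trans (mul_le_of_le_one_right hC0
      (Real.rpow_le_one_of_one_le_of_nonpos (by linarith [norm_nonneg p]) (by linarith)))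
    gcongr
    · exact norm_energy_sub_inv_le hz p
    · exact hC' p
  · obtain ⟨L₁, h1, h1'⟩ := exists_support_subset_box hφ
    obtain ⟨L₂, h2, h2'⟩ := exists_support_subset_box hχ
    filter_upwards [eventually_ge_atTop L₁, eventually_ge_atTop L₂] with L hL1 hL2
    have hL : 0 < L := h1.trans_le hL1
    rw [← (hasSum_fourierCoeffBox hL _ _).tsum_eq]
    refine tsum_congr fun m => ?_
    rw [fourierCoeffBox_freeResolvent hL hz, fourierCoeffBox_restrictBox_toLp φ (h1' L hL1),
      fourierCoeffBox_restrictBox_toLp χ (h2' L hL2)]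

theorem tendsto_norm_sq_freeResolvent (hz : z ∉ halfLine) {χ : 𝓢(E d, ℂ)}
    (hχ : HasCompactSupport χ) :
    Tendsto (fun L : ℝ => ‖freeResolvent z (restrictBox L (χ.toLp 2 volume))‖ ^ 2) atTop
      (𝓝 (‖limitResolvent hz (χ.toLp 2 volume)‖ ^ 2)) := by
  obtain ⟨C, hC0, hC⟩ := exists_norm_le_decay (𝓕 χ)
  have hr := (infDist_halfLine_pos hz)
  suffices h : Tendsto (fun L : ℝ =>
      ((‖freeResolvent z (restrictBox L (χ.toLp 2 volume))‖ ^ 2 : ℝ) : ℂ)) atTop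
      (𝓝 ((‖limitResolvent hz (χ.toLp 2 volume)‖ ^ 2 : ℝ) : ℂ)) by
    exact (Complex.continuous_re.tendsto _).comp h
  rw [norm_sq_limitResolvent]
  refine (tendsto_riemannSum
    (F := fun p => ((‖((energy p : ℂ) - z)⁻¹‖ ^ 2 * ‖𝓕 χ p‖ ^ 2 : ℝ) : ℂ)) ?_
    (C := (Metric.infDist z halfLine)⁻¹ ^ 2 * (C * C)) fun p => ?_).congr' ?_
  · exact Complex.continuous_ofReal.comp (((continuous_resolventSymbol hz).norm.pow 2).mul
      ((𝓕 χ).continuous.norm.pow 2))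
  · rw [Complex.norm_real, Real.norm_eq_abs, abs_of_nonneg (by positivity), mul_assoc, mul_assoc,
      sq ‖𝓕 χ p‖]
    have h1 : ‖𝓕 χ p‖ ≤ C := (hC p).trans (mul_le_of_le_one_right hC0
      (Real.rpow_le_one_of_one_le_of_nonpos (by linarith [norm_nonneg p]) (by linarith)))
    gcongr
    · exact norm_energy_sub_inv_le hz p
    · exact hC p
  · obtain ⟨L₂, h2, h2'⟩ := exists_support_subset_box hχ
    filter_upwards [eventually_ge_atTop L₂] with L hL2
    have hL : 0 < L := h2.trans_le hL2
    rw [← (norm_sq_freeResolvent hL hz _).tsum_eq, Complex.ofReal_tsum]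
    refine tsum_congr fun m => ?_
    rw [fourierCoeffBox_restrictBox_toLp χ (h2' L hL2)]
    push_cast
    rfl

open Classical in
/-- The free resolvent on the box, extended by zero to `L²(ℝ^d)` and, as a function of the side
length, to nonpositive values. -/
def resolventFamily (hz : z ∉ halfLine) (L : ℝ) : L2Space d →L[ℂ] L2Space d :=
  if hL : 0 < L then spaceResolvent hL hz else 0

theorem resolventFamily_of_pos (hz : z ∉ halfLine) (hL : 0 < L) :
    (resolventFamily hz L : L2Space d →L[ℂ] L2Space d) = spaceResolvent hL hz := dif_pos hL

theorem norm_resolventFamily_le (hz : z ∉ halfLine) (hL : 0 < L) (f : L2Space d) :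
    ‖resolventFamily hz L f‖ ≤ (Metric.infDist z halfLine)⁻¹ * ‖f‖ := by
  rw [resolventFamily_of_pos hz hL]
  exact norm_spaceResolvent_le hL hz f

theorem tendsto_inner_resolventFamily (hz : z ∉ halfLine) {χ : 𝓢(E d, ℂ)}
    (hχ : HasCompactSupport χ) (g : L2Space d) :
    Tendsto (fun L : ℝ => inner ℂ g (resolventFamily hz L (χ.toLp 2 volume))) atTop
      (𝓝 (inner ℂ g (limitResolvent hz (χ.toLp 2 volume)))) := by
  set f : L2Space d := χ.toLp 2 volume
  set r := (Metric.infDist z halfLine)⁻¹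
  have hr : 0 < r := inv_pos.2 (infDist_halfLine_pos hz)
  rw [Metric.tendsto_nhds]
  intro ε hε
  set K := r * ‖f‖ + ‖limitResolvent hz f‖ + 1 with hK
  have hK0 : 0 < K := by positivity
  obtain ⟨φ, hφ, hle⟩ := exists_dist_toLp_le g (ε := ε / (2 * K)) (by positivity)
  have h1 := Metric.tendsto_nhds.1 (tendsto_inner_spaceResolvent hz hφ hχ) (ε / 2) (by positivity)
  filter_upwards [h1, eventually_gt_atTop 0] with L hL1 hL
  rw [← inner_spaceResolvent hL hz, dist_eq_norm, ← inner_sub_right] at hL1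
  rw [resolventFamily_of_pos hz hL, dist_eq_norm, ← inner_sub_right]
  have h2 : g = (g - φ.toLp 2 volume) + φ.toLp 2 volume := by abel
  rw [h2, inner_add_left]
  have h3 : ‖spaceResolvent hL hz f - limitResolvent hz f‖ ≤ K :=
    (norm_sub_le _ _).trans (by linarith [norm_spaceResolvent_le hL hz f])
  have h4 : ‖inner ℂ (g - φ.toLp 2 volume) (spaceResolvent hL hz f - limitResolvent hz f)‖ ≤
      ε / 2 := by
    refine (norm_inner_le_norm _ _).trans ((mul_le_mul hle h3 (norm_nonneg _)
      (by positivity)).trans_eq ?_)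
    field_simp
  exact (norm_add_le _ _).trans_lt (by linarith)

/-- Weak convergence together with convergence of norms gives strong convergence, by expanding `‖u -
g‖²`. An upper bound on the norm of the extended vector by the norm on the box is enough. -/
theorem tendsto_resolventFamily_toLp (hz : z ∉ halfLine) {χ : 𝓢(E d, ℂ)}
    (hχ : HasCompactSupport χ) :
    Tendsto (fun L : ℝ => resolventFamily hz L (χ.toLp 2 volume)) atTop
      (𝓝 (limitResolvent hz (χ.toLp 2 volume))) := by
  set f : L2Space d := χ.toLp 2 volume
  set g := limitResolvent hz f
  rw [tendsto_iff_norm_sub_tendsto_zero]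
  have h1 : Tendsto (fun L : ℝ => ‖freeResolvent z (restrictBox L f)‖ ^ 2 -
      2 * RCLike.re (inner ℂ g (resolventFamily hz L f)) + ‖g‖ ^ 2) atTop (𝓝 0) := by
    have h2 := ((tendsto_norm_sq_freeResolvent hz hχ).sub (((RCLike.continuous_re.tendsto _).comp
      (tendsto_inner_resolventFamily hz hχ g)).const_mul 2)).add_const (‖g‖ ^ 2)
    rw [inner_self_eq_norm_sq_to_K] at h2
    have h5 : ‖g‖ ^ 2 - 2 * RCLike.re ((‖g‖ : ℂ) ^ 2) + ‖g‖ ^ 2 = 0 := by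
      rw [← Complex.ofReal_pow, RCLike.re_eq_complex_re, Complex.ofReal_re]; ring
    rw [← h5]
    exact h2
  have h3 : Tendsto (fun L : ℝ => ‖resolventFamily hz L f - g‖ ^ 2) atTop (𝓝 0) := by
    refine squeeze_zero' (Eventually.of_forall fun _ => by positivity) ?_ h1
    filter_upwards [eventually_gt_atTop 0] with L hL
    rw [norm_sub_sq (𝕜 := ℂ), ← inner_conj_symm, RCLike.conj_re]
    gcongr
    rw [resolventFamily_of_pos hz hL]
    exact norm_spaceResolvent_le' hL hz f
  have h4 := (Real.continuous_sqrt.tendsto 0).comp h3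
  simpa [Function.comp_def, Real.sqrt_sq (norm_nonneg _)] using h4

/-- Strong convergence of the resolvents in the infinite volume limit, in Cauchy form. -/
theorem tendsto_resolventFamily_sub (hz : z ∉ halfLine) (f : L2Space d) :
    Tendsto (fun x : ℝ × ℝ => resolventFamily hz x.1 f - resolventFamily hz x.2 f)
      (atTop ×ˢ atTop) (𝓝 0) := by
  set r := (Metric.infDist z halfLine)⁻¹
  have hr : 0 < r := inv_pos.2 (infDist_halfLine_pos hz)
  rw [Metric.tendsto_nhds]
  intro ε hε
  obtain ⟨φ, hφ, hle⟩ := exists_dist_toLp_le f (ε := ε / (4 * r)) (by positivity)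
  have h0 := tendsto_resolventFamily_toLp hz hφ
  have h1 := (h0.comp (tendsto_fst (g := (atTop : Filter ℝ)))).sub
    (h0.comp (tendsto_snd (f := (atTop : Filter ℝ))))
  rw [sub_self] at h1
  filter_upwards [Metric.tendsto_nhds.1 h1 (ε / 2) (by positivity),
    (tendsto_fst (f := (atTop : Filter ℝ)) (g := (atTop : Filter ℝ))).eventually
      (eventually_gt_atTop 0),
    (tendsto_snd (f := (atTop : Filter ℝ)) (g := (atTop : Filter ℝ))).eventually
      (eventually_gt_atTop 0)] with x hx hx1 hx2
  rw [dist_zero_right] at hx ⊢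
  have h2 := norm_resolventFamily_le hz hx1 (f - φ.toLp 2 volume)
  have h3 := norm_resolventFamily_le hz hx2 (f - φ.toLp 2 volume)
  have h4 : r * ‖f - φ.toLp 2 volume‖ ≤ ε / 4 :=
    (mul_le_mul_of_nonneg_left hle hr.le).trans_eq (by field_simp)
  have h5 : resolventFamily hz x.1 f - resolventFamily hz x.2 f =
      resolventFamily hz x.1 (f - φ.toLp 2 volume) - resolventFamily hz x.2 (f - φ.toLp 2 volume) +
      (resolventFamily hz x.1 (φ.toLp 2 volume) - resolventFamily hz x.2 (φ.toLp 2 volume)) := by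
    rw [map_sub, map_sub]; abel
  rw [h5]
  have h6 := norm_sub_le (resolventFamily hz x.1 (f - φ.toLp 2 volume))
    (resolventFamily hz x.2 (f - φ.toLp 2 volume))
  exact (norm_add_le _ _).trans_lt (by simp only [Function.comp_apply] at hx; linarith)

end Limit

end PoissonSchrodinger

/-! ### Multiplication operators defined by kernels. -/

namespace PoissonSchrodinger

open PoissonChaos

section Measurability

theorem measurable_of_edist {α β : Type*} [MeasurableSpace α] [PseudoEMetricSpace β]
    [SecondCountableTopology β] [MeasurableSpace β] [BorelSpace β] {u : α → β}
    (h : ∀ g, Measurable fun x => edist (u x) g) : Measurable u := by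
  have hb : TopologicalSpace.IsTopologicalBasis
      {s : Set β | ∃ g, ∃ ε : ℝ≥0∞, s = Metric.eball g ε} := by
    refine TopologicalSpace.isTopologicalBasis_of_isOpen_of_nhds ?_ fun x U hx hU => ?_
    · rintro _ ⟨g, ε, rfl⟩
      exact Metric.isOpen_eball
    · obtain ⟨ε, hε, hsub⟩ := EMetric.isOpen_iff.1 hU x hx
      exact ⟨_, ⟨x, ε, rfl⟩, Metric.mem_eball_self hε, hsub⟩
  rw [BorelSpace.measurable_eq (α := β), hb.borel_eq_generateFrom]
  refine measurable_generateFrom ?_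
  rintro _ ⟨g, ε, rfl⟩
  exact measurableSet_lt (h g) measurable_const

theorem enorm_sq_eq_lintegral {α : Type*} [MeasurableSpace α] {μ : Measure α} (f : Lp ℂ 2 μ) :
    ‖f‖ₑ ^ 2 = ∫⁻ x, ‖f x‖ₑ ^ 2 ∂μ := by
  rw [Lp.enorm_def, eLpNorm_two_sq]

end Measurability

variable {d : ℕ}

instance : SecondCountableTopology (L2Space d) :=
  have : Fact ((2 : ℝ≥0∞) ≠ ⊤) := ⟨by norm_num⟩
  inferInstance

/-- A bounded measurable real kernel. -/
structure Kernel (d : ℕ) where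
  /-- The kernel at the position of the impurity and the position of the particle. -/
  toFun : E d → E d → ℝ
  measurable : Measurable (Function.uncurry toFun)
  /-- A bound for the kernel. -/
  bound : ℝ
  le : ∀ y x, ‖toFun y x‖ ≤ bound

namespace Kernel

variable (K K' : Kernel d)

theorem measurable_apply (y : E d) : Measurable fun x => (K.toFun y x : ℂ) :=
  Complex.measurable_ofReal.comp (K.measurable.comp measurable_prodMk_left)

theorem norm_ofReal_le (y x : E d) : ‖(K.toFun y x : ℂ)‖ ≤ K.bound := by
  rw [Complex.norm_real]; exact K.le y x

theorem bound_nonneg : 0 ≤ K.bound := (norm_nonneg _).trans (K.le 0 0)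

/-- The multiplication operator attached to an impurity with given position and weight. -/
def op (p : E d × ℝ) : L2Space d →L[ℂ] L2Space d :=
  (p.2 : ℂ) • mulCLM volume _ (K.measurable_apply p.1) _ (K.norm_ofReal_le p.1)

theorem coeFn_op (p : E d × ℝ) (f : L2Space d) :
    K.op p f =ᵐ[volume] fun x => (p.2 : ℂ) * (K.toFun p.1 x * f x) := by
  filter_upwards [coeFn_mulCLM (K.measurable_apply p.1) (K.norm_ofReal_le p.1) f,
    Lp.coeFn_smul (p.2 : ℂ) (mulCLM volume _ (K.measurable_apply p.1) _ (K.norm_ofReal_le p.1) f)]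
    with x h1 h2
  change ((p.2 : ℂ) • mulCLM volume _ (K.measurable_apply p.1) _ (K.norm_ofReal_le p.1) f :
    L2Space d) x = _
  rw [h2, Pi.smul_apply, h1, smul_eq_mul]

theorem norm_op_le (p : E d × ℝ) (f : L2Space d) : ‖K.op p f‖ ≤ K.bound * |p.2| * ‖f‖ := by
  change ‖(p.2 : ℂ) • mulCLM volume _ (K.measurable_apply p.1) _ (K.norm_ofReal_le p.1) f‖ ≤ _
  rw [norm_smul, Complex.norm_real, Real.norm_eq_abs, mul_comm K.bound, mul_assoc]
  exact mul_le_mul_of_nonneg_left (norm_mulCLM_le _ _ f) (abs_nonneg _)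

theorem inner_op (p : E d × ℝ) (f g : L2Space d) :
    inner ℂ (K.op p f) g = inner ℂ f (K.op p g) := by
  rw [L2.inner_def, L2.inner_def]
  refine integral_congr_ae ?_
  filter_upwards [K.coeFn_op p f, K.coeFn_op p g] with x h1 h2
  rw [h1, h2, RCLike.inner_apply, RCLike.inner_apply, map_mul, map_mul, Complex.conj_ofReal,
    Complex.conj_ofReal]
  ring

theorem measurable_op_integrand (f : L2Space d) : Measurable fun q : (E d × ℝ) × E d =>
    (q.1.2 : ℂ) * (K.toFun q.1.1 q.2 * f q.2) := by
  have h1 : Measurable fun q : (E d × ℝ) × E d => K.toFun q.1.1 q.2 :=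
    K.measurable.comp ((measurable_fst.comp measurable_fst).prodMk measurable_snd)
  have h2 := (Lp.stronglyMeasurable f).measurable
  exact (Complex.measurable_ofReal.comp (measurable_snd.comp measurable_fst)).mul
    ((Complex.measurable_ofReal.comp h1).mul (h2.comp measurable_snd))

/-- The values are almost-everywhere classes, so measurability in `p` is tested through distances to
fixed vectors. These are parameter integrals of jointly measurable functions, and balls generate the
Borel sets. -/
theorem stronglyMeasurable_op (f : L2Space d) : StronglyMeasurable fun p => K.op p f := by
  borelize (L2Space d)
  refine (measurable_of_edist fun g => ?_).stronglyMeasurable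
  have h1 : (fun p => edist (K.op p f) g) = fun p : E d × ℝ =>
      (∫⁻ x, ‖(p.2 : ℂ) * (K.toFun p.1 x * f x) - g x‖ₑ ^ 2) ^ (1 / 2 : ℝ) := by
    funext p
    have h2 : edist (K.op p f) g = (‖K.op p f - g‖ₑ ^ 2) ^ (1 / 2 : ℝ) := by
      rw [edist_eq_enorm_sub, ← ENNReal.rpow_natCast, ← ENNReal.rpow_mul]
      norm_num
    rw [h2, enorm_sq_eq_lintegral]
    congr 1
    refine lintegral_congr_ae ?_
    filter_upwards [K.coeFn_op p f, Lp.coeFn_sub (K.op p f) g] with x h3 h4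
    rw [h4, Pi.sub_apply, h3]
  rw [h1]
  refine Measurable.pow_const (Measurable.lintegral_prod_right' (f := fun q : (E d × ℝ) × E d =>
    ‖(q.1.2 : ℂ) * (K.toFun q.1.1 q.2 * f q.2) - g q.2‖ₑ ^ 2) ?_) _
  exact (((K.measurable_op_integrand f).sub
    ((Lp.stronglyMeasurable g).measurable.comp measurable_snd)).enorm).pow_const 2

/-- The difference of two kernels. -/
def sub : Kernel d where
  toFun y x := K.toFun y x - K'.toFun y x
  measurable := K.measurable.sub K'.measurable
  bound := K.bound + K'.bound
  le y x := (norm_sub_le _ _).trans (add_le_add (K.le y x) (K'.le y x))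

theorem sub_op (p : E d × ℝ) (f : L2Space d) : (K.sub K').op p f = K.op p f - K'.op p f := by
  ext1
  filter_upwards [(K.sub K').coeFn_op p f, K.coeFn_op p f, K'.coeFn_op p f,
    Lp.coeFn_sub (K.op p f) (K'.op p f)] with x h1 h2 h3 h4
  rw [h1, h4, Pi.sub_apply, h2, h3, sub, Complex.ofReal_sub]
  ring

theorem enorm_op_sq (p : E d × ℝ) (f : L2Space d) :
    ‖K.op p f‖ₑ ^ 2 = ‖p.2‖ₑ ^ 2 * ∫⁻ x, ‖K.toFun p.1 x‖ₑ ^ 2 * ‖f x‖ₑ ^ 2 := by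
  rw [enorm_sq_eq_lintegral, ← lintegral_const_mul']
  · refine lintegral_congr_ae ?_
    filter_upwards [K.coeFn_op p f] with x hx
    rw [hx, enorm_mul, enorm_mul, mul_pow, mul_pow]
    simp only [enorm_eq_nnnorm, Complex.nnnorm_real]
  · finiteness

theorem measurable_enorm_sq : Measurable fun q : E d × E d => ‖K.toFun q.1 q.2‖ₑ ^ 2 :=
  K.measurable.enorm.pow_const 2

/-- The weighted Hilbert-Schmidt type norm of the field, via Tonelli. -/
theorem lintegral_enorm_op_sq (Pv : Measure ℝ) [SFinite Pv] {w : ℝ → ℝ} (hw : Measurable w)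
    (f : L2Space d) :
    ∫⁻ p : E d × ℝ, ‖(w p.2) • K.op p f‖ₑ ^ 2 ∂(volume.prod Pv) =
      (∫⁻ v, ‖w v * v‖ₑ ^ 2 ∂Pv) * ∫⁻ x, (∫⁻ y, ‖K.toFun y x‖ₑ ^ 2) * ‖f x‖ₑ ^ 2 := by
  have hf : Measurable fun x => ‖f x‖ₑ ^ 2 :=
    (Lp.stronglyMeasurable f).measurable.enorm.pow_const 2
  have hm : Measurable fun q : E d × E d => ‖K.toFun q.1 q.2‖ₑ ^ 2 * ‖f q.2‖ₑ ^ 2 :=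
    K.measurable_enorm_sq.mul (hf.comp measurable_snd)
  have h1 : ∀ p : E d × ℝ, ‖(w p.2) • K.op p f‖ₑ ^ 2 =
      (∫⁻ x, ‖K.toFun p.1 x‖ₑ ^ 2 * ‖f x‖ₑ ^ 2) * ‖w p.2 * p.2‖ₑ ^ 2 := fun p => by
    rw [enorm_smul, mul_pow, enorm_op_sq, ← mul_assoc, ← mul_pow, ← enorm_mul, mul_comm]
  simp_rw [h1]
  rw [lintegral_prod_mul (f := fun y => ∫⁻ x, ‖K.toFun y x‖ₑ ^ 2 * ‖f x‖ₑ ^ 2)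
    (g := fun v : ℝ => ‖w v * v‖ₑ ^ 2) hm.lintegral_prod_right'.aemeasurable
    ((hw.mul measurable_id).enorm.pow_const 2).aemeasurable, mul_comm]
  congr 1
  rw [lintegral_lintegral_swap hm.aemeasurable]
  refine lintegral_congr fun x => ?_
  rw [lintegral_mul_const']
  finiteness

end Kernel

end PoissonSchrodinger

/-! ### The mean field and convergence of the periodized interaction. -/

namespace PoissonSchrodinger

open PoissonChaos

variable {d : ℕ}

/-- The average of a family of operators, applied to a vector. -/
def fieldMean {P 𝓗 : Type*} [MeasurableSpace P] [NormedAddCommGroup 𝓗] [InnerProductSpace ℂ 𝓗]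
    (A : P → 𝓗 →L[ℂ] 𝓗) (ρ : Measure P) (f : 𝓗) : 𝓗 := ∫ p, A p f ∂ρ

theorem inner_fieldMean {P 𝓗 : Type*} [MeasurableSpace P] [NormedAddCommGroup 𝓗]
    [InnerProductSpace ℂ 𝓗] [CompleteSpace 𝓗] {A : P → 𝓗 →L[ℂ] 𝓗} {ρ : Measure P} {f : 𝓗}
    (h : Integrable (fun p => A p f) ρ) (g : 𝓗) :
    inner ℂ g (fieldMean A ρ f) = ∫ p, inner ℂ g (A p f) ∂ρ :=
  (integral_inner h g).symm

theorem tendsto_sub_of_tendsto {V : Type*} [NormedAddCommGroup V] {u : ℝ → V} {v : V}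
    (h : Tendsto u atTop (𝓝 v)) :
    Tendsto (fun x : ℝ × ℝ => u x.1 - u x.2) (atTop ×ˢ atTop) (𝓝 0) := by
  have h1 := (h.comp (tendsto_fst (g := (atTop : Filter ℝ)))).sub
    (h.comp (tendsto_snd (f := (atTop : Filter ℝ))))
  rwa [sub_self] at h1

theorem eventually_mem_box (x : E d) : ∀ᶠ L : ℝ in atTop, x ∈ box d L := by
  filter_upwards [eventually_gt_atTop (2 * ‖x‖)] with L hL j
  have h := abs_le.1 (PiLp.norm_apply_le x j)
  constructor <;> linarith [h.1, h.2]

/-- Dominated convergence for multiplication operators. -/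
theorem tendsto_of_coeFn_mul {α : Type*} [MeasurableSpace α] {μ : Measure α} {f : Lp ℂ 2 μ}
    {u : ℝ → Lp ℂ 2 μ} {v : Lp ℂ 2 μ} {a : ℝ → α → ℂ} {a' : α → ℂ} {C : ℝ}
    (hu : ∀ᶠ L in atTop, u L =ᵐ[μ] fun x => a L x * f x) (hv : v =ᵐ[μ] fun x => a' x * f x)
    (hm : ∀ᶠ L in atTop, Measurable (a L)) (hm' : Measurable a')
    (hC : ∀ᶠ L in atTop, ∀ x, ‖a L x - a' x‖ ≤ C)
    (hlim : ∀ x, Tendsto (fun L => a L x) atTop (𝓝 (a' x))) : Tendsto u atTop (𝓝 v) := by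
  rw [tendsto_iff_edist_tendsto_0]
  refine tendsto_zero_of_sq ?_
  have hf := (Lp.stronglyMeasurable f).measurable
  have h1 : Tendsto (fun L => ∫⁻ x, ‖(a L x - a' x) * f x‖ₑ ^ 2 ∂μ) atTop
      (𝓝 (∫⁻ _, 0 ∂μ)) := by
    refine tendsto_lintegral_filter_of_dominated_convergence
      (fun x => ENNReal.ofReal C ^ 2 * ‖f x‖ₑ ^ 2) ?_ ?_ ?_ ?_
    · filter_upwards [hm] with L hL
      exact ((hL.sub hm').mul hf).enorm.pow_const 2
    · filter_upwards [hC] with L hL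
      refine Eventually.of_forall fun x => ?_
      rw [enorm_mul, mul_pow]
      gcongr
      rw [← ofReal_norm]
      exact ENNReal.ofReal_le_ofReal (hL x)
    · rw [lintegral_const_mul' _ _ (by finiteness), ← enorm_sq_eq_lintegral]
      finiteness
    · refine Eventually.of_forall fun x => ?_
      have h2 := (((hlim x).sub_const (a' x)).mul_const (f x)).enorm
      rw [sub_self, zero_mul, enorm_zero] at h2
      simpa [Function.comp_def] using ((ENNReal.continuous_pow 2).tendsto 0).comp h2
  rw [lintegral_zero] at h1
  refine h1.congr' ?_
  filter_upwards [hu] with L hL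
  rw [edist_eq_enorm_sub, enorm_sq_eq_lintegral]
  refine lintegral_congr_ae ?_
  filter_upwards [hL, hv, Lp.coeFn_sub (u L) v] with x h2 h3 h4
  rw [h4, Pi.sub_apply, h2, h3, sub_mul]

namespace Kernel

variable (K : Kernel d) {S : Set (E d)} {Pv : Measure ℝ} [SFinite Pv]

theorem integrable_op (hS : MeasurableSet S) (hS' : volume S < ⊤)
    (hK : ∀ y ∉ S, ∀ x, K.toFun y x = 0) (hv : Integrable (fun v : ℝ => v) Pv) (f : L2Space d) :
    Integrable (fun p => K.op p f) (volume.prod Pv) := by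
  have h1 : Integrable (S.indicator fun _ => K.bound * ‖f‖) (volume : Measure (E d)) :=
    (integrable_indicator_iff hS).2 (integrableOn_const hS'.ne)
  refine (h1.mul_prod hv.norm).mono' (K.stronglyMeasurable_op f).aestronglyMeasurable
    (Eventually.of_forall fun p => ?_)
  by_cases hp : p.1 ∈ S
  · rw [Set.indicator_of_mem hp]
    exact (K.norm_op_le p f).trans_eq (by rw [Real.norm_eq_abs]; ring)
  · rw [Set.indicator_of_notMem hp, zero_mul]
    have h2 : K.op p f = 0 := by
      rw [Lp.eq_zero_iff_ae_eq_zero]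
      filter_upwards [K.coeFn_op p f] with x hx
      rw [hx, hK _ hp]; simp
    rw [h2, norm_zero]

theorem measurable_integral : Measurable fun x => ∫ y, K.toFun y x :=
  (StronglyMeasurable.integral_prod_left' (f := fun q : E d × E d => K.toFun q.1 q.2)
    K.measurable.stronglyMeasurable).measurable

theorem norm_integral_le (hS' : volume S < ⊤)
    (hK : ∀ y ∉ S, ∀ x, K.toFun y x = 0) (x : E d) :
    ‖∫ y, K.toFun y x‖ ≤ K.bound * volume.real S := by
  rw [← setIntegral_eq_integral_of_forall_compl_eq_zero (s := S) fun y hy => hK y hy x]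
  exact norm_setIntegral_le_of_norm_le_const hS' fun y _ => K.le y x

/-- The averaged field is the multiplication by the averaged kernel. -/
theorem coeFn_integral_op (hS : MeasurableSet S) (hS' : volume S < ⊤)
    (hK : ∀ y ∉ S, ∀ x, K.toFun y x = 0) (hv : Integrable (fun v : ℝ => v) Pv) (f : L2Space d) :
    (fieldMean K.op (volume.prod Pv) f : L2Space d) =ᵐ[volume]
      fun x => (((∫ v, v ∂Pv) * ∫ y, K.toFun y x : ℝ) : ℂ) * f x := by
  set m : ℝ := ∫ v, v ∂Pv
  have ha : Measurable fun x : E d => ((m * ∫ y, K.toFun y x : ℝ) : ℂ) :=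
    Complex.measurable_ofReal.comp (K.measurable_integral.const_mul m)
  have hb : ∀ x : E d, ‖((m * ∫ y, K.toFun y x : ℝ) : ℂ)‖ ≤ |m| * (K.bound * volume.real S) := by
    intro x
    rw [Complex.norm_real, norm_mul, Real.norm_eq_abs]
    exact mul_le_mul_of_nonneg_left (K.norm_integral_le hS' hK x) (abs_nonneg m)
  suffices h : fieldMean K.op (volume.prod Pv) f = mulCLM volume _ ha _ hb f by
    rw [h]; exact coeFn_mulCLM ha hb f
  -- A Bochner integral of classes cannot be evaluated at a point, so it is tested against `g`,
  -- where Fubini exchanges the impurity and particle variables.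
  refine ext_inner_left ℂ fun g => ?_
  rw [inner_fieldMean (K.integrable_op hS hS' hK hv f)]
  set h : E d → ℂ := fun x => f x * (starRingEnd ℂ) (g x) with hh
  have hi : Integrable h := by
    have := L2.integrable_inner (𝕜 := ℂ) g f
    simpa only [RCLike.inner_apply] using this
  have h1 : ∀ p : E d × ℝ, inner ℂ g (K.op p f) =
      (∫ x, (K.toFun p.1 x : ℂ) * h x) * (p.2 : ℂ) := fun p => by
    rw [L2.inner_def, ← integral_mul_const]
    refine integral_congr_ae ?_
    filter_upwards [K.coeFn_op p f] with x hx
    rw [hx, RCLike.inner_apply, hh]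
    ring
  simp_rw [h1]
  rw [integral_prod_mul (fun y => ∫ x, (K.toFun y x : ℂ) * h x) (fun v : ℝ => (v : ℂ)),
    integral_integral_swap]
  · rw [L2.inner_def, integral_complex_ofReal, mul_comm, ← integral_const_mul]
    refine integral_congr_ae ?_
    filter_upwards [coeFn_mulCLM ha hb f] with x hx
    rw [hx, RCLike.inner_apply, integral_mul_const, integral_complex_ofReal, hh]
    push_cast
    ring
  · have h2 : Integrable (S.indicator fun _ => K.bound) (volume : Measure (E d)) :=
      (integrable_indicator_iff hS).2 (integrableOn_const hS'.ne)
    refine (h2.mul_prod hi.norm).mono' ?_ (Eventually.of_forall fun q => ?_)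
    · exact (Complex.measurable_ofReal.comp K.measurable).aestronglyMeasurable.mul
        hi.aestronglyMeasurable.comp_snd
    · rw [Function.uncurry_def, norm_mul]
      by_cases hq : q.1 ∈ S
      · rw [Set.indicator_of_mem hq]
        exact mul_le_mul_of_nonneg_right (K.norm_ofReal_le _ _) (norm_nonneg _)
      · rw [Set.indicator_of_notMem hq, hK _ hq]; simp

end Kernel

section Field

variable (B : 𝓢(E d, ℝ)) {L : ℝ}

/-- The interaction on the box. -/
def boxKernel (L : ℝ) : Kernel d where
  toFun y x := (box d L ×ˢ box d L).indicator (fun q => B (wrap L (q.2 - q.1))) (y, x)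
  measurable := (B.continuous.measurable.comp ((measurable_wrap L).comp
    (measurable_snd.sub measurable_fst))).indicator
      ((measurableSet_box d L).prod (measurableSet_box d L))
  bound := SchwartzMap.seminorm ℝ 0 0 B
  le _ _ := (norm_indicator_le_norm_self _ _).trans (B.norm_le_seminorm ℝ _)

/-- The interaction on the whole space. -/
def spaceKernel : Kernel d where
  toFun y x := B (x - y)
  measurable := B.continuous.measurable.comp (measurable_snd.sub measurable_fst)
  bound := SchwartzMap.seminorm ℝ 0 0 B
  le _ _ := B.norm_le_seminorm ℝ _

theorem boxKernel_of_mem {x y : E d} (hx : x ∈ box d L) (hy : y ∈ box d L) :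
    (boxKernel B L).toFun y x = B (wrap L (x - y)) :=
  Set.indicator_of_mem (Set.mk_mem_prod hy hx) fun q : E d × E d => B (wrap L (q.2 - q.1))

theorem boxKernel_of_notMem_right {x : E d} (hx : x ∉ box d L) (y : E d) :
    (boxKernel B L).toFun y x = 0 :=
  Set.indicator_of_notMem (s := box d L ×ˢ box d L) (fun h => hx h.2)
    fun q : E d × E d => B (wrap L (q.2 - q.1))

theorem boxKernel_of_notMem_left {y : E d} (hy : y ∉ box d L) (x : E d) :
    (boxKernel B L).toFun y x = 0 :=
  Set.indicator_of_notMem (s := box d L ×ˢ box d L) (fun h => hy h.1)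
    fun q : E d × E d => B (wrap L (q.2 - q.1))

/-- For fixed positions the periodization is eventually invisible: `x`, `y` and `x - y` all lie in
the box. -/
theorem eventually_boxKernel_eq (x y : E d) :
    ∀ᶠ L : ℝ in atTop, (boxKernel B L).toFun y x = B (x - y) := by
  filter_upwards [eventually_gt_atTop 0, eventually_mem_box x, eventually_mem_box y,
    eventually_mem_box (x - y)] with L hL hx hy hxy
  rw [boxKernel_of_mem B hx hy, wrap_of_mem hL hxy]

theorem measurePreserving_sub_left (x : E d) :
    MeasurePreserving (fun y : E d => x - y) volume volume :=
  Measure.measurePreserving_sub_left volume x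

/-- On the torus `y ↦ x - y` preserves the measure, so wrapping costs nothing. The bound is uniform
in both `L` and `x` and is the source of volume independence. -/
theorem lintegral_boxKernel_le (hL : 0 < L) (x : E d) :
    ∫⁻ y, ‖(boxKernel B L).toFun y x‖ₑ ^ 2 ≤ ∫⁻ y, ‖B y‖ₑ ^ 2 := by
  calc ∫⁻ y, ‖(boxKernel B L).toFun y x‖ₑ ^ 2
      ≤ ∫⁻ y in box d L, ‖B (wrap L (x - y))‖ₑ ^ 2 := by
        rw [← lintegral_indicator (measurableSet_box d L)]
        refine lintegral_mono fun y => ?_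
        by_cases hy : y ∈ box d L
        · rw [Set.indicator_of_mem hy]
          by_cases hx : x ∈ box d L
          · rw [boxKernel_of_mem B hx hy]
          · rw [boxKernel_of_notMem_right B hx]; simp
        · rw [boxKernel_of_notMem_left B hy]; simp
    _ = ∫⁻ y in box d L, ‖B y‖ₑ ^ 2 :=
        (measurePreserving_wrap_sub hL x).lintegral_comp
          (f := fun y => ‖B y‖ₑ ^ 2) (B.continuous.measurable.enorm.pow_const 2)
    _ ≤ _ := setLIntegral_le_lintegral _ _

theorem lintegral_spaceKernel (x : E d) :
    ∫⁻ y, ‖(spaceKernel B).toFun y x‖ₑ ^ 2 = ∫⁻ y, ‖B y‖ₑ ^ 2 :=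
  (measurePreserving_sub_left x).lintegral_comp (f := fun y => ‖B y‖ₑ ^ 2)
    (B.continuous.measurable.enorm.pow_const 2)

theorem lintegral_enorm_sq_ne_top : ∫⁻ y, ‖B y‖ₑ ^ 2 ≠ ⊤ := by
  rw [← eLpNorm_two_sq]
  have := (B.memLp 2 volume).eLpNorm_ne_top
  finiteness

/-- The same invariance as an exact identity. It is used with the identity for the mean field and
with the square for the `L²` norm of the kernel. -/
theorem integral_comp_boxKernel (hL : 0 < L) {x : E d} (hx : x ∈ box d L) {F : ℝ → ℝ}
    (hF : Continuous F) (hF0 : F 0 = 0) :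
    ∫ y, F ((boxKernel B L).toFun y x) = ∫ y in box d L, F (B y) := by
  rw [← setIntegral_eq_integral_of_forall_compl_eq_zero (s := box d L)
    (fun y hy => by rw [boxKernel_of_notMem_left B hy, hF0])]
  have h := integral_map (μ := (volume : Measure (E d)).restrict (box d L))
    (measurePreserving_wrap_sub hL x).measurable.aemeasurable
    (f := fun y => F (B y)) (hF.comp B.continuous).aestronglyMeasurable
  rw [(measurePreserving_wrap_sub hL x).map_eq] at h
  rw [h]
  refine setIntegral_congr_fun (measurableSet_box d L) fun y hy => ?_
  simp only [boxKernel_of_mem B hx hy]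

theorem tendsto_setIntegral_box {F : E d → ℝ} (hF : Integrable F) :
    Tendsto (fun L : ℝ => ∫ y in box d L, F y) atTop (𝓝 (∫ y, F y)) := by
  have h : Tendsto (fun L : ℝ => ∫ y, (box d L).indicator F y) atTop (𝓝 (∫ y, F y)) := by
    refine tendsto_integral_filter_of_dominated_convergence (fun y => ‖F y‖)
      (Eventually.of_forall fun L => hF.aestronglyMeasurable.indicator (measurableSet_box d L))
      (Eventually.of_forall fun L => Eventually.of_forall fun y => norm_indicator_le_norm_self _ _)
      hF.norm (Eventually.of_forall fun y => tendsto_const_nhds.congr' ?_)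
    filter_upwards [eventually_mem_box y] with L hL
    rw [Set.indicator_of_mem hL]
  refine h.congr fun L => ?_
  rw [integral_indicator (measurableSet_box d L)]

theorem integral_boxKernel (hL : 0 < L) (x : E d) :
    ∫ y, (boxKernel B L).toFun y x = (box d L).indicator (fun _ => ∫ y in box d L, B y) x := by
  by_cases hx : x ∈ box d L
  · rw [Set.indicator_of_mem hx]
    exact integral_comp_boxKernel B hL hx continuous_id rfl
  · rw [Set.indicator_of_notMem hx]
    simp [boxKernel_of_notMem_right B hx]

/-- The kernels converge in the square mean with respect to the position of the impurity. -/
theorem tendsto_lintegral_sub (x : E d) :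
    Tendsto (fun L : ℝ => ∫⁻ y, ‖((boxKernel B L).sub (spaceKernel B)).toFun y x‖ₑ ^ 2) atTop
      (𝓝 0) := by
  have hB2 : Integrable fun y => B y ^ 2 := (B.memLp 2 volume).integrable_sq
  have hs2 : Integrable fun y => B (x - y) ^ 2 :=
    (measurePreserving_sub_left x).integrable_comp_of_integrable hB2
  have hs1 : Integrable fun y => B (x - y) :=
    (measurePreserving_sub_left x).integrable_comp_of_integrable B.integrable
  have hsi : ∫ y, B (x - y) ^ 2 = ∫ y, B y ^ 2 := integral_sub_left_eq_self (fun y => B y ^ 2) _ x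
  set k : ℝ → E d → ℝ := fun L y => (boxKernel B L).toFun y x with hk
  have hkm : ∀ L, Measurable (k L) := fun L => (boxKernel B L).measurable.comp measurable_prodMk_right
  have hk2 : ∀ L, Integrable fun y => k L y ^ 2 := fun L => by
    have h1 : Integrable ((box d L).indicator fun _ => SchwartzMap.seminorm ℝ 0 0 B ^ 2)
        (volume : Measure (E d)) :=
      (integrable_indicator_iff (measurableSet_box d L)).2
        (integrableOn_const (volume_box_lt_top d L).ne)
    refine h1.mono' ((hkm L).pow_const 2).aestronglyMeasurable (Eventually.of_forall fun y => ?_)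
    by_cases hy : y ∈ box d L
    · rw [Set.indicator_of_mem hy, norm_pow]
      exact pow_le_pow_left₀ (norm_nonneg _) ((boxKernel B L).le y x) 2
    · rw [Set.indicator_of_notMem hy, hk]
      simp [boxKernel_of_notMem_left B hy]
  have hbd : ∀ L y, ‖k L y * B (x - y)‖ ≤ SchwartzMap.seminorm ℝ 0 0 B * ‖B (x - y)‖ :=
    fun L y => by
      rw [norm_mul]
      exact mul_le_mul_of_nonneg_right ((boxKernel B L).le y x) (norm_nonneg _)
  have hmix : ∀ L, Integrable fun y => k L y * B (x - y) := fun L =>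
    (hs1.norm.const_mul _).mono' ((hkm L).aestronglyMeasurable.mul hs1.aestronglyMeasurable)
      (Eventually.of_forall (hbd L))
  -- The wrapped kernel alone is given no integrable bound uniform in `L`, but in the cross term the
  -- fixed function `B (x - ·)` dominates.
  have hlim : Tendsto (fun L => ∫ y, k L y * B (x - y)) atTop (𝓝 (∫ y, B y ^ 2)) := by
    rw [← hsi]
    refine tendsto_integral_filter_of_dominated_convergence _
      (Eventually.of_forall fun L => (hmix L).aestronglyMeasurable)
      (Eventually.of_forall fun L => Eventually.of_forall (hbd L)) (hs1.norm.const_mul _)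
      (Eventually.of_forall fun y => tendsto_const_nhds.congr' ?_)
    filter_upwards [eventually_boxKernel_eq B x y] with L hL
    simp only [hk, hL, sq]
  -- Expanding the square: the norm of the wrapped kernel is known exactly, so convergence of the
  -- cross term forces convergence in square mean.
  have h1 : Tendsto (fun L => ENNReal.ofReal
      ((∫ y in box d L, B y ^ 2) + (∫ y, B y ^ 2) - 2 * ∫ y, k L y * B (x - y))) atTop (𝓝 0) := by
    have h2 := ((tendsto_setIntegral_box hB2).add_const (∫ y, B y ^ 2)).sub (hlim.const_mul 2)
    rw [show (∫ y, B y ^ 2) + (∫ y, B y ^ 2) - 2 * ∫ y, B y ^ 2 = 0 by ring] at h2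
    simpa using ENNReal.tendsto_ofReal h2
  refine h1.congr' ?_
  filter_upwards [eventually_gt_atTop 0, eventually_mem_box x] with L hL hx
  have h3 : ∫ y, k L y ^ 2 = ∫ y in box d L, B y ^ 2 :=
    integral_comp_boxKernel B hL hx (F := fun t => t ^ 2) (by fun_prop) (by simp)
  have h4 : ∫ y, (k L y - B (x - y)) ^ 2 =
      (∫ y in box d L, B y ^ 2) + (∫ y, B y ^ 2) - 2 * ∫ y, k L y * B (x - y) := by
    rw [← h3, ← hsi, ← integral_const_mul, ← integral_add (hk2 L) hs2]
    refine Eq.trans ?_ (integral_sub ((hk2 L).add hs2) ((hmix L).const_mul 2))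
    exact integral_congr_ae (Eventually.of_forall fun y => by ring)
  rw [← h4, ofReal_integral_eq_lintegral_ofReal]
  · refine lintegral_congr fun y => ?_
    change _ = ‖k L y - B (x - y)‖ₑ ^ 2
    rw [← ofReal_norm, ← ENNReal.ofReal_pow (norm_nonneg _), Real.norm_eq_abs, sq_abs]
  · have h5 := ((hk2 L).add hs2).sub ((hmix L).const_mul 2)
    refine h5.congr (Eventually.of_forall fun y => ?_)
    simp only [Pi.add_apply, Pi.sub_apply]; ring
  · exact Eventually.of_forall fun y => by positivity

end Field

end PoissonSchrodinger

/-! ### Verification of the field hypotheses for the marked Poisson process. -/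

namespace PoissonSchrodinger

open PoissonChaos

theorem tendsto_lintegral_sub_of_tendsto {P 𝓗 : Type*} [MeasurableSpace P]
    [NormedAddCommGroup 𝓗] [InnerProductSpace ℂ 𝓗] {w : P → ℝ} {ρ : Measure P}
    {u : ℝ → P → 𝓗} {v : P → 𝓗} (hw : Measurable w) (hu : ∀ L, StronglyMeasurable (u L))
    (hv : StronglyMeasurable v) (j : ℕ)
    (h : Tendsto (fun L => ∫⁻ p, ‖(w p ^ j) • (u L p - v p)‖ₑ ^ 2 ∂ρ) atTop (𝓝 0)) :
    Tendsto (fun x : ℝ × ℝ => ∫⁻ p, ‖(w p ^ j) • (u x.1 p - u x.2 p)‖ₑ ^ 2 ∂ρ)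
      (atTop ×ˢ atTop) (𝓝 0) := by
  have h1 := ENNReal.Tendsto.const_mul (a := 2)
    ((h.comp (tendsto_fst (g := (atTop : Filter ℝ)))).add
      (h.comp (tendsto_snd (f := (atTop : Filter ℝ))))) (Or.inr (by norm_num))
  rw [add_zero, mul_zero] at h1
  refine tendsto_of_tendsto_of_tendsto_of_le_of_le tendsto_const_nhds h1
    (fun _ => zero_le) fun x => ?_
  simp only [Function.comp_apply]
  have hm : Measurable fun p => ‖(w p ^ j) • (u x.1 p - v p)‖ₑ ^ 2 :=
    ((hw.pow_const j).stronglyMeasurable.smul ((hu x.1).sub hv)).enorm.pow_const 2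
  rw [← lintegral_add_left hm, ← lintegral_const_mul' _ _ ENNReal.ofNat_ne_top]
  refine lintegral_mono fun p => ?_
  refine le_trans (le_of_eq ?_) (enorm_sub_sq_le _ _)
  rw [← smul_sub, sub_sub_sub_cancel_right]

variable {d : ℕ} {L : ℝ} {Pv : Measure ℝ} [IsProbabilityMeasure Pv]

/-- The weight of a marked point. -/
def markWeight (p : E d × ℝ) : ℝ := 2 + |p.2|

theorem measurable_markWeight : Measurable (markWeight : E d × ℝ → ℝ) := by
  unfold markWeight
  fun_prop

theorem two_le_markWeight (p : E d × ℝ) : 2 ≤ markWeight p := le_add_of_nonneg_right (abs_nonneg _)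

theorem integrable_two_add_abs_pow (hmom : ∀ k : ℕ, Integrable (fun v : ℝ => v ^ k) Pv) (m : ℕ) :
    Integrable (fun v : ℝ => (2 + |v|) ^ m) Pv := by
  have h1 : Integrable (fun v : ℝ => 2 ^ (m - 1) * (2 ^ m + |v| ^ m)) Pv := by
    refine (Integrable.add (integrable_const _) ?_).const_mul _
    refine (hmom m).norm.congr (Eventually.of_forall fun v => ?_)
    simp only [norm_pow, Real.norm_eq_abs]
  refine h1.mono' (Measurable.aestronglyMeasurable (by fun_prop)) (Eventually.of_forall fun v => ?_)
  rw [Real.norm_eq_abs, abs_of_nonneg (by positivity)]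
  exact add_pow_le zero_le_two (abs_nonneg v) m

/-- Since `|v| ≤ 2 + |v|`, the integrand is at most the power `2 * j + 2` of the weight. -/
theorem lintegral_moment_ne_top (hmom : ∀ k : ℕ, Integrable (fun v : ℝ => v ^ k) Pv) (j : ℕ) :
    ∫⁻ v, ‖(2 + |v|) ^ j * v‖ₑ ^ 2 ∂Pv ≠ ⊤ := by
  have h1 : ∫⁻ v, ‖(2 + |v|) ^ (2 * j + 2)‖ₑ ∂Pv < ⊤ :=
    (integrable_two_add_abs_pow hmom (2 * j + 2)).2
  refine ne_top_of_le_ne_top h1.ne (lintegral_mono fun v => ?_)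
  rw [← enorm_pow, enorm_le_iff_norm_le]
  have h2 : (2 + |v|) ^ (2 * j + 2) = ((2 + |v|) ^ j * (2 + |v|)) ^ 2 := by ring
  rw [h2, norm_pow, norm_pow, norm_mul, norm_mul]
  gcongr
  rw [Real.norm_eq_abs, Real.norm_eq_abs, abs_of_nonneg (by positivity : 0 ≤ 2 + |v|)]
  linarith

/-- Restriction of the reference measure on marked points to a box. -/
theorem restrict_prod_univ (L : ℝ) :
    ((volume : Measure (E d)).prod Pv).restrict (box d L ×ˢ Set.univ) =
      (volume.restrict (box d L)).prod Pv := by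
  rw [← Measure.prod_restrict, Measure.restrict_univ]

theorem integrableOn_markWeight_pow (hmom : ∀ k : ℕ, Integrable (fun v : ℝ => v ^ k) Pv) (L : ℝ)
    (m : ℕ) : IntegrableOn (fun p : E d × ℝ => markWeight p ^ m) (box d L ×ˢ Set.univ)
      (volume.prod Pv) := by
  have : IsFiniteMeasure ((volume : Measure (E d)).restrict (box d L)) :=
    ⟨by simpa using volume_box_lt_top d L⟩
  rw [IntegrableOn, restrict_prod_univ]
  have h := (integrable_const (1 : ℝ) (μ := (volume : Measure (E d)).restrict (box d L))).mul_prod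
    (integrable_two_add_abs_pow hmom m)
  simp only [one_mul] at h
  exact h

theorem Kernel.lintegral_sub_le (K K' : Kernel d) {β : ℝ≥0∞} {x : E d}
    (hK : ∫⁻ y, ‖K.toFun y x‖ₑ ^ 2 ≤ β) (hK' : ∫⁻ y, ‖K'.toFun y x‖ₑ ^ 2 ≤ β) :
    ∫⁻ y, ‖(K.sub K').toFun y x‖ₑ ^ 2 ≤ 2 * (β + β) := by
  have h1 : ∫⁻ y, ‖(K.sub K').toFun y x‖ₑ ^ 2 ≤
      ∫⁻ y, 2 * (‖K.toFun y x‖ₑ ^ 2 + ‖K'.toFun y x‖ₑ ^ 2) :=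
    lintegral_mono fun y => enorm_sub_sq_le (K.toFun y x) (K'.toFun y x)
  refine h1.trans ?_
  have hm : Measurable fun y => ‖K.toFun y x‖ₑ ^ 2 :=
    K.measurable_enorm_sq.comp measurable_prodMk_right
  rw [lintegral_const_mul' _ _ ENNReal.ofNat_ne_top, lintegral_add_left hm]
  exact mul_le_mul' le_rfl (add_le_add hK hK')

section Bounds

variable (B : 𝓢(E d, ℝ))

/-- The constants in the square mean bounds of the field. -/
def fieldConst (Pv : Measure ℝ) (j : ℕ) : ℝ :=
  √((∫⁻ v, ‖(2 + |v|) ^ j * v‖ₑ ^ 2 ∂Pv) * ∫⁻ y, ‖B y‖ₑ ^ 2).toReal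

theorem ofReal_fieldConst_sq (hmom : ∀ k : ℕ, Integrable (fun v : ℝ => v ^ k) Pv) (j : ℕ) :
    ENNReal.ofReal (fieldConst B Pv j) ^ 2 =
      (∫⁻ v, ‖(2 + |v|) ^ j * v‖ₑ ^ 2 ∂Pv) * ∫⁻ y, ‖B y‖ₑ ^ 2 := by
  rw [fieldConst, ← ENNReal.ofReal_pow (Real.sqrt_nonneg _), Real.sq_sqrt ENNReal.toReal_nonneg,
    ENNReal.ofReal_toReal]
  exact ENNReal.mul_ne_top (lintegral_moment_ne_top hmom j) (lintegral_enorm_sq_ne_top B)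

theorem coeFn_integral_boxKernel (hL : 0 < L) (hv : Integrable (fun v : ℝ => v) Pv)
    (f : L2Space d) :
    (fieldMean (boxKernel B L).op (volume.prod Pv) f : L2Space d) =ᵐ[volume] fun x =>
      (((∫ v, v ∂Pv) * (box d L).indicator (fun _ => ∫ y in box d L, B y) x : ℝ) : ℂ) * f x := by
  filter_upwards [(boxKernel B L).coeFn_integral_op (measurableSet_box d L)
    (volume_box_lt_top d L) (fun y hy => boxKernel_of_notMem_left B hy) hv f] with x hx
  rw [hx, integral_boxKernel B hL]

theorem norm_indicator_integral_le (L : ℝ) (x : E d) :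
    ‖(box d L).indicator (fun _ => ∫ y in box d L, B y) x‖ ≤ ∫ y, ‖B y‖ :=
  (norm_indicator_le_norm_self _ _).trans ((norm_integral_le_integral_norm _).trans
    (setIntegral_le_integral B.integrable.norm (Eventually.of_forall fun _ => norm_nonneg _)))

/-- The three constants come from the sup norm of `B` (a kept point), its `L²` norm with a moment of
the mark (creation and annihilation) and its `L¹` norm with the mean mark (mean field). Only the
support depends on `L`. -/
theorem fieldBounds_boxKernel (hmom : ∀ k : ℕ, Integrable (fun v : ℝ => v ^ k) Pv) (hL : 0 < L) :
    FieldBounds (boxKernel B L).op markWeight (volume.prod Pv) (box d L ×ˢ Set.univ)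
      (SchwartzMap.seminorm ℝ 0 0 B) (fieldConst B Pv) (|∫ v, v ∂Pv| * ∫ y, ‖B y‖) where
  meas := (boxKernel B L).stronglyMeasurable_op
  norm_le p f := by
    refine ((boxKernel B L).norm_op_le p f).trans ?_
    have h1 : |p.2| ≤ markWeight p := by simp [markWeight]
    have h2 : 0 ≤ (boxKernel B L).bound := (boxKernel B L).bound_nonneg
    change (boxKernel B L).bound * _ * _ ≤ (boxKernel B L).bound * _ * _
    gcongr
  sq_le j f := by
    have h1 := (boxKernel B L).lintegral_enorm_op_sq Pv (w := fun v => (2 + |v|) ^ j)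
      (by fun_prop) f
    refine h1.trans_le ?_
    rw [mul_pow, ofReal_fieldConst_sq B hmom, mul_assoc]
    gcongr
    rw [enorm_sq_eq_lintegral, ← lintegral_const_mul' _ _ (lintegral_enorm_sq_ne_top B)]
    exact lintegral_mono fun x => mul_le_mul' (lintegral_boxKernel_le B hL x) le_rfl
  symm := (boxKernel B L).inner_op
  mean_le f := by
    refine Lp.norm_le_mul_norm_of_ae_le_mul ?_
    filter_upwards [coeFn_integral_boxKernel B hL (by simpa using hmom 1) f] with x hx
    change ‖(fieldMean (boxKernel B L).op (volume.prod Pv) f : L2Space d) x‖ ≤ _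
    rw [hx, norm_mul, Complex.norm_real, norm_mul, Real.norm_eq_abs]
    gcongr
    exact norm_indicator_integral_le B L x
  supp p hp := by
    have hp' : p.1 ∉ box d L := fun h => hp ⟨h, trivial⟩
    ext1 f
    rw [_root_.zero_apply, Lp.eq_zero_iff_ae_eq_zero]
    filter_upwards [(boxKernel B L).coeFn_op p f] with x hx
    rw [hx, boxKernel_of_notMem_left B hp']; simp
  measurableSet := (measurableSet_box d L).prod MeasurableSet.univ
  moment := integrableOn_markWeight_pow hmom L

theorem tendsto_boxKernel_op (p : E d × ℝ) (f : L2Space d) :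
    Tendsto (fun L => (boxKernel B L).op p f) atTop (𝓝 ((spaceKernel B).op p f)) := by
  have hcoe : ∀ K : Kernel d, K.op p f =ᵐ[volume]
      fun x => ((p.2 * K.toFun p.1 x : ℝ) : ℂ) * f x := fun K => by
    filter_upwards [K.coeFn_op p f] with x hx
    rw [hx, Complex.ofReal_mul, mul_assoc]
  have hmeas : ∀ K : Kernel d, Measurable fun x => ((p.2 * K.toFun p.1 x : ℝ) : ℂ) := fun K =>
    Complex.measurable_ofReal.comp ((K.measurable.comp measurable_prodMk_left).const_mul _)
  refine tendsto_of_coeFn_mul (C := |p.2| * (2 * SchwartzMap.seminorm ℝ 0 0 B))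
    (Eventually.of_forall fun L => hcoe (boxKernel B L)) (hcoe (spaceKernel B))
    (Eventually.of_forall fun L => hmeas (boxKernel B L)) (hmeas (spaceKernel B))
    (Eventually.of_forall fun L x => ?_) fun x => tendsto_const_nhds.congr' ?_
  · rw [← Complex.ofReal_sub, ← mul_sub, Complex.norm_real, norm_mul, Real.norm_eq_abs, two_mul]
    exact mul_le_mul_of_nonneg_left (((boxKernel B L).sub (spaceKernel B)).le p.1 x)
      (abs_nonneg _)
  · filter_upwards [eventually_boxKernel_eq B x p.1] with L hL
    rw [hL]; rfl

/-- Tonelli isolates the integral over impurity positions, which tends to zero for each `x` by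
`tendsto_lintegral_sub`. Its uniform bound times `|f|²` dominates in `x`. -/
theorem tendsto_lintegral_boxKernel_sub (hmom : ∀ k : ℕ, Integrable (fun v : ℝ => v ^ k) Pv)
    (j : ℕ) (f : L2Space d) :
    Tendsto (fun L => ∫⁻ p : E d × ℝ, ‖(markWeight p ^ j) •
      ((boxKernel B L).op p f - (spaceKernel B).op p f)‖ₑ ^ 2 ∂(volume.prod Pv)) atTop (𝓝 0) := by
  have h1 : ∀ L, ∫⁻ p : E d × ℝ, ‖(markWeight p ^ j) •
      ((boxKernel B L).op p f - (spaceKernel B).op p f)‖ₑ ^ 2 ∂(volume.prod Pv) =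
      (∫⁻ v, ‖(2 + |v|) ^ j * v‖ₑ ^ 2 ∂Pv) *
        ∫⁻ x, (∫⁻ y, ‖((boxKernel B L).sub (spaceKernel B)).toFun y x‖ₑ ^ 2) * ‖f x‖ₑ ^ 2 :=
    fun L => by
      simp_rw [← Kernel.sub_op]
      exact ((boxKernel B L).sub (spaceKernel B)).lintegral_enorm_op_sq Pv
        (w := fun v => (2 + |v|) ^ j) (by fun_prop) f
  simp_rw [h1]
  have hf : Measurable fun x => ‖f x‖ₑ ^ 2 :=
    (Lp.stronglyMeasurable f).measurable.enorm.pow_const 2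
  obtain ⟨C, hC, hCβ⟩ : ∃ C : ℝ≥0∞, C ≠ ⊤ ∧
      2 * ((∫⁻ y, ‖B y‖ₑ ^ 2) + ∫⁻ y, ‖B y‖ₑ ^ 2) = C :=
    ⟨_, ENNReal.mul_ne_top ENNReal.ofNat_ne_top (ENNReal.add_ne_top.2
      ⟨lintegral_enorm_sq_ne_top B, lintegral_enorm_sq_ne_top B⟩), rfl⟩
  have h2 : Tendsto (fun L : ℝ => ∫⁻ x,
      (∫⁻ y, ‖((boxKernel B L).sub (spaceKernel B)).toFun y x‖ₑ ^ 2) * ‖f x‖ₑ ^ 2) atTop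
      (𝓝 (∫⁻ _ : E d, 0)) := by
    refine tendsto_lintegral_filter_of_dominated_convergence
      (fun x => C * ‖f x‖ₑ ^ 2) ?_ ?_ ?_ ?_
    · exact Eventually.of_forall fun L => (Measurable.lintegral_prod_left'
        ((boxKernel B L).sub (spaceKernel B)).measurable_enorm_sq).mul hf
    · filter_upwards [eventually_gt_atTop 0] with L hL
      refine Eventually.of_forall fun x => ?_
      exact mul_le_mul' ((Kernel.lintegral_sub_le _ _ (lintegral_boxKernel_le B hL x)
        (lintegral_spaceKernel B x).le).trans_eq hCβ) le_rfl
    · rw [lintegral_const_mul' _ _ hC, ← enorm_sq_eq_lintegral]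
      finiteness
    · refine Eventually.of_forall fun x => ?_
      have h3 := ENNReal.Tendsto.mul_const (b := ‖f x‖ₑ ^ 2) (tendsto_lintegral_sub B x)
        (Or.inr (by finiteness))
      rwa [zero_mul] at h3
  rw [lintegral_zero] at h2
  have h4 := ENNReal.Tendsto.const_mul h2 (Or.inr (lintegral_moment_ne_top hmom j))
  rwa [mul_zero] at h4

/-- By translation invariance the mean field is a constant on the box and zero outside, so its
strong limit is a scalar. -/
theorem tendsto_integral_boxKernel_op (hv : Integrable (fun v : ℝ => v) Pv) (f : L2Space d) :
    Tendsto (fun L => fieldMean (boxKernel B L).op (volume.prod Pv) f) atTop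
      (𝓝 ((((∫ v, v ∂Pv) * ∫ y, B y : ℝ) : ℂ) • f)) := by
  set m : ℝ := ∫ v, v ∂Pv
  have hB : ‖∫ y, B y‖ ≤ ∫ y, ‖B y‖ := norm_integral_le_integral_norm _
  refine tendsto_of_coeFn_mul (f := f) (C := |m| * (2 * ∫ y, ‖B y‖))
    (a := fun L x => ((m * (box d L).indicator (fun _ => ∫ y in box d L, B y) x : ℝ) : ℂ))
    (a' := fun _ => ((m * ∫ y, B y : ℝ) : ℂ)) ?_ ?_ ?_ measurable_const
    (Eventually.of_forall fun L x => ?_) fun x => ?_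
  · exact (eventually_gt_atTop 0).mono fun L hL => coeFn_integral_boxKernel B hL hv f
  · filter_upwards [Lp.coeFn_smul ((m * ∫ y, B y : ℝ) : ℂ) f] with x hx
    rw [hx, Pi.smul_apply, smul_eq_mul]
  · exact Eventually.of_forall fun L => Complex.measurable_ofReal.comp
      ((measurable_const.indicator (measurableSet_box d L)).const_mul _)
  · rw [← Complex.ofReal_sub, ← mul_sub, Complex.norm_real, norm_mul, Real.norm_eq_abs, two_mul]
    exact mul_le_mul_of_nonneg_left ((norm_sub_le _ _).trans
      (add_le_add (norm_indicator_integral_le B L x) hB)) (abs_nonneg _)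
  · refine (Complex.continuous_ofReal.tendsto _).comp (((tendsto_setIntegral_box
      B.integrable).congr' ?_).const_mul m)
    filter_upwards [eventually_mem_box x] with L hL
    rw [Set.indicator_of_mem hL]

theorem tendsto_lintegral_boxKernel_op_sub (hmom : ∀ k : ℕ, Integrable (fun v : ℝ => v ^ k) Pv)
    (j : ℕ) (f : L2Space d) : Tendsto (fun x : ℝ × ℝ => ∫⁻ p, ‖(markWeight p ^ j) •
      ((boxKernel B x.1).op p f - (boxKernel B x.2).op p f)‖ₑ ^ 2 ∂(volume.prod Pv))
      (atTop ×ˢ atTop) (𝓝 0) :=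
  tendsto_lintegral_sub_of_tendsto measurable_markWeight
    (fun L => (boxKernel B L).stronglyMeasurable_op f) ((spaceKernel B).stronglyMeasurable_op f) j
    (tendsto_lintegral_boxKernel_sub B hmom j f)

theorem fieldFamily_boxKernel (hmom : ∀ k : ℕ, Integrable (fun v : ℝ => v ^ k) Pv) :
    FieldFamily (fun L => (boxKernel B L).op) markWeight (volume.prod Pv)
      (fun L => box d L ×ˢ Set.univ) (SchwartzMap.seminorm ℝ 0 0 B) (fieldConst B Pv)
      (|∫ v, v ∂Pv| * ∫ y, ‖B y‖) := by
  have h1 : ∀ (p : E d × ℝ) (f : L2Space d), Tendsto (fun x : ℝ × ℝ =>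
      (boxKernel B x.1).op p f - (boxKernel B x.2).op p f) (atTop ×ˢ atTop) (𝓝 0) :=
    fun p f => tendsto_sub_of_tendsto (u := fun L => (boxKernel B L).op p f)
      (tendsto_boxKernel_op B p f)
  have h2 : ∀ f : L2Space d, Tendsto (fun x : ℝ × ℝ =>
      fieldMean (boxKernel B x.1).op (volume.prod Pv) f -
        fieldMean (boxKernel B x.2).op (volume.prod Pv) f) (atTop ×ˢ atTop) (𝓝 0) :=
    fun f => tendsto_sub_of_tendsto
      (u := fun L => fieldMean (boxKernel B L).op (volume.prod Pv) f)
      (tendsto_integral_boxKernel_op B (by simpa using hmom 1) f)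
  exact ⟨fun _ hL => fieldBounds_boxKernel B hmom hL, h1,
    tendsto_lintegral_boxKernel_op_sub B hmom, h2⟩

end Bounds

end PoissonSchrodinger

/-! ### Passage from the random matrix element to the component at the empty list. -/

namespace PoissonChaos

section Inner

variable {P 𝓗 : Type*} [MeasurableSpace P] [NormedAddCommGroup 𝓗] [InnerProductSpace ℂ 𝓗]
  {w : P → ℝ} {Q : Measure P} {h : List P → 𝓗} {lam : ℝ≥0}

theorem Tame.inner_left (hh : Tame w h) (g : 𝓗) : Tame w fun l => (inner ℂ g (h l) : ℂ) := by
  obtain ⟨C, hC, m, hm⟩ := hh.bound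
  refine ⟨fun k => stronglyMeasurable_const.inner (hh.meas k), ‖g‖ * C, by positivity, m,
    fun l => ?_⟩
  rw [mul_assoc]
  exact (norm_inner_le_norm _ _).trans (mul_le_mul_of_nonneg_left (hm l) (norm_nonneg g))

theorem inner_poissonMean [CompleteSpace 𝓗] [IsProbabilityMeasure Q]
    (hQ : ∀ m : ℕ, Integrable (fun p => w p ^ m) Q) (hh : Tame w h) (g : 𝓗) :
    poissonMean lam Q (fun l => (inner ℂ g (h l) : ℂ)) = inner ℂ g (poissonMean lam Q h) := by
  refine HasSum.tsum_eq ?_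
  refine ((hh.hasSum_poissonMean hQ lam).mapL (innerSL ℂ g)).congr_fun fun M => ?_
  rw [integral_inner (hh.integrable_pi hQ M), ContinuousLinearMap.map_smul_of_tower]
  rfl

end Inner

end PoissonChaos

namespace PoissonSchrodinger

open PoissonChaos

variable {d : ℕ} {L : ℝ} {z : ℂ} {Pv : Measure ℝ} [IsProbabilityMeasure Pv]

theorem memLp_indicator_box (g : L2Box d L) :
    MemLp ((box d L).indicator g) 2 (volume : Measure (E d)) :=
  (memLp_indicator_iff_restrict (measurableSet_box d L)).2 (Lp.memLp g)

theorem adjoint_restrictCLM (g : L2Box d L) :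
    ContinuousLinearMap.adjoint (restrictCLM d L) g = (memLp_indicator_box g).toLp := by
  refine ext_inner_right ℂ fun f => ?_
  rw [ContinuousLinearMap.adjoint_inner_left, L2.inner_def, L2.inner_def,
    ← integral_indicator (measurableSet_box d L)]
  have h1 := coeFn_restrictBox L f
  rw [Filter.EventuallyEq, ae_restrict_iff' (measurableSet_box d L)] at h1
  refine integral_congr_ae ?_
  filter_upwards [h1, (memLp_indicator_box g).coeFn_toLp] with x h2 h3
  rw [h3]
  by_cases hx : x ∈ box d L
  · rw [Set.indicator_of_mem hx, Set.indicator_of_mem hx]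
    exact congrArg _ (h2 hx)
  · rw [Set.indicator_of_notMem hx, Set.indicator_of_notMem hx, inner_zero_left]

/-- The adjoint of restriction is extension by zero. Hence inner restriction-extension pairs cancel
in products of extended operators, and the iteration on the box lifts to the whole space. -/
theorem restrictCLM_adjoint (g : L2Box d L) :
    restrictCLM d L (ContinuousLinearMap.adjoint (restrictCLM d L) g) = g := by
  rw [adjoint_restrictCLM]
  ext1
  filter_upwards [coeFn_restrictBox L (memLp_indicator_box g).toLp,
    ae_restrict_of_ae (memLp_indicator_box g).coeFn_toLp,
    ae_restrict_mem (measurableSet_box d L)] with x h1 h2 hx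
  rw [restrictBox_eq] at h1
  rw [h1, h2, Set.indicator_of_mem hx]

section Dyson

variable (B : 𝓢(E d, ℝ))

theorem coeFn_fieldSum_boxKernel (l : List (E d × ℝ)) (f : L2Space d) :
    fieldSum (boxKernel B L).op l f =ᵐ[volume] fun x =>
      (((l.map fun p => p.2 * (boxKernel B L).toFun p.1 x).sum : ℝ) : ℂ) * f x := by
  induction l with
  | nil =>
    filter_upwards [] with x
    simp [fieldSum]
  | cons p l ih =>
    have h1 : fieldSum (boxKernel B L).op (p :: l) f =
        (boxKernel B L).op p f + fieldSum (boxKernel B L).op l f := rfl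
    filter_upwards [ih, (boxKernel B L).coeFn_op p f, Lp.coeFn_add ((boxKernel B L).op p f)
      (fieldSum (boxKernel B L).op l f)] with x h2 h3 h4
    rw [h1, h4, Pi.add_apply, h2, h3, List.map_cons, List.sum_cons]
    push_cast
    ring

theorem potential_eq {ω : Config d} (hω : ∀ i, ω.2.1 i ∈ box d L) {x : E d} (hx : x ∈ box d L) :
    potential B L ω x = ((List.ofFn fun i => (ω.2.1 i, ω.2.2 i)).map fun p =>
      p.2 * (boxKernel B L).toFun p.1 x).sum := by
  rw [List.map_ofFn, List.sum_ofFn, potential]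
  refine Finset.sum_congr rfl fun i _ => ?_
  rw [Function.comp_apply, boxKernel_of_mem B hx (hω i)]
  rfl

/-- The product with the potential agrees almost everywhere with a vector already in `L²`, so the
zero default in `mulOp` never occurs here. -/
theorem mulOp_potential {ω : Config d} (hω : ∀ i, ω.2.1 i ∈ box d L) (g : L2Box d L) :
    mulOp (potential B L ω) g = restrictCLM d L (fieldSum (boxKernel B L).op
      (List.ofFn fun i => (ω.2.1 i, ω.2.2 i))
      (ContinuousLinearMap.adjoint (restrictCLM d L) g)) := by
  set l := List.ofFn fun i => (ω.2.1 i, ω.2.2 i)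
  set f := ContinuousLinearMap.adjoint (restrictCLM d L) g with hf
  have hfg : restrictBox L f = g := restrictCLM_adjoint g
  have h : restrictBox L (fieldSum (boxKernel B L).op l f) =ᵐ[volume.restrict (box d L)]
      fun x => (potential B L ω x : ℂ) * g x := by
    have h0 := coeFn_restrictBox L f
    rw [hfg] at h0
    filter_upwards [coeFn_restrictBox L (fieldSum (boxKernel B L).op l f), h0,
      ae_restrict_of_ae (coeFn_fieldSum_boxKernel B l f),
      ae_restrict_mem (measurableSet_box d L)] with x h1 h2 h3 hx
    rw [h1, h2, h3, potential_eq B hω hx]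
  have hm : MemLp (fun x => (potential B L ω x : ℂ) * g x) 2 (volume.restrict (box d L)) :=
    (memLp_congr_ae h).1 (Lp.memLp _)
  rw [mulOp, dif_pos hm, ← restrictBox_eq]
  ext1
  exact hm.coeFn_toLp.trans h.symm

/-- The random variable in terms of the operators on the whole space. -/
theorem matrixElement_eq (hL : 0 < L) (hz : z ∉ halfLine) (n : ℕ) (ψ₁ ψ₂ : L2Space d)
    {ω : Config d} (hω : ∀ i, ω.2.1 i ∈ box d L) :
    matrixElement B n L z ψ₁ ψ₂ ω = inner ℂ ψ₁ (dyson (boxKernel B L).op (resolventFamily hz L) ψ₂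
      n (List.ofFn fun i => (ω.2.1 i, ω.2.2 i))) := by
  set l := List.ofFn fun i => (ω.2.1 i, ω.2.2 i) with hl
  have h1 : dyson (boxKernel B L).op (resolventFamily hz L) ψ₂ n l =
      ContinuousLinearMap.adjoint (restrictCLM d L) (freeResolvent z
        ((fun f => mulOp (potential B L ω) (freeResolvent z f))^[n] (restrictBox L ψ₂))) := by
    induction n with
    | zero => rw [dyson, resolventFamily_of_pos hz hL]; rfl
    | succ n ih =>
      rw [dyson, ih, resolventFamily_of_pos hz hL, Function.iterate_succ_apply',
        mulOp_potential B hω]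
      rfl
  rw [h1, ContinuousLinearMap.adjoint_inner_right]
  rfl

end Dyson

section Law

theorem isProbabilityMeasure_cond_box (hL : 0 < L) :
    IsProbabilityMeasure (cond (volume : Measure (E d)) (box d L)) :=
  cond_isProbabilityMeasure_of_finite
    (by rw [volume_box hL]; simpa using pow_pos hL d) (volume_box_lt_top d L).ne

theorem toNNReal_volume_box_ne_zero (hL : 0 < L) :
    (volume (box d L)).toNNReal ≠ 0 := by
  rw [ENNReal.toNNReal_ne_zero]
  exact ⟨by rw [volume_box hL]; simpa using pow_pos hL d, (volume_box_lt_top d L).ne⟩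

/-- The Poisson intensity is the volume times the uniform law, that is, the reference measure on the
box. This is the hypothesis linking `ρ`, `lam` and `Q` in the abstract expansion. -/
theorem restrict_eq_smul_cond (hL : 0 < L) :
    ((volume : Measure (E d)).prod Pv).restrict (box d L ×ˢ Set.univ) =
      (volume (box d L)).toNNReal • ((cond volume (box d L)).prod Pv) := by
  have h0 : volume (box d L) ≠ 0 := by rw [volume_box hL]; simpa using pow_pos hL d
  rw [restrict_prod_univ, ProbabilityTheory.cond, Measure.prod_smul_left]
  change _ = ((volume (box d L)).toNNReal : ℝ≥0∞) •
    ((volume (box d L))⁻¹ • (volume.restrict (box d L)).prod Pv)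
  rw [ENNReal.coe_toNNReal (volume_box_lt_top d L).ne, smul_smul,
    ENNReal.mul_inv_cancel h0 (volume_box_lt_top d L).ne, one_smul]

/-- The kernel is cut off at the box in the impurity variable while the potential is not; the two
are compared only for points in the box, which is almost sure. -/
theorem ae_mem_box (hL : 0 < L) (M : ℕ) :
    ∀ᵐ x ∂((Measure.pi fun _ : Fin M => cond (volume : Measure (E d)) (box d L)).prod
      (Measure.pi fun _ : Fin M => Pv)), ∀ i, x.1 i ∈ box d L := by
  have := isProbabilityMeasure_cond_box (d := d) hL
  have h : ∀ᵐ y ∂(Measure.pi fun _ : Fin M => cond (volume : Measure (E d)) (box d L)),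
      ∀ i, y i ∈ box d L := eventually_all.2 fun i => ?_
  · exact Measure.quasiMeasurePreserving_fst.ae h
  exact (Measure.quasiMeasurePreserving_eval
    (fun _ : Fin M => cond (volume : Measure (E d)) (box d L)) i).ae (ae_cond_mem (measurableSet_box d L))

variable (B : 𝓢(E d, ℝ))

/-- The random variable is integrable, and its mean is the Poisson average of the Dyson term. -/
theorem integrable_matrixElement (hmom : ∀ k : ℕ, Integrable (fun v : ℝ => v ^ k) Pv)
    (hL : 0 < L) (hz : z ∉ halfLine) (n : ℕ) (ψ₁ ψ₂ : L2Space d) :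
    Integrable (matrixElement B n L z ψ₁ ψ₂) (configLaw d L Pv) ∧
      expansionCoeff B Pv n L z ψ₁ ψ₂ =
        inner ℂ ψ₁ (chaos (boxKernel B L).op (resolventFamily hz L) (volume.prod Pv) ψ₂ n []) := by
  have := isProbabilityMeasure_cond_box (d := d) hL
  have hc : 0 ≤ SchwartzMap.seminorm ℝ 0 0 B := apply_nonneg _ _
  have hA := fieldBounds_boxKernel B hmom hL
  have hlam := toNNReal_volume_box_ne_zero (d := d) hL
  have hρ := restrict_eq_smul_cond (d := d) (Pv := Pv) hL
  have hQ := hA.integrable_pow hlam hρ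
  set Q : Measure (E d × ℝ) := (cond volume (box d L)).prod Pv with hQdef
  set D : List (E d × ℝ) → L2Space d :=
    dyson (boxKernel B L).op (resolventFamily hz L) ψ₂ n with hD
  have hDt : Tame markWeight D := Tame.dyson hc two_le_markWeight hA _ ψ₂ n
  have hh := hDt.inner_left ψ₁
  -- A configuration stores positions and marks as two tuples, whereas the abstract theory uses one
  -- tuple of marked points; the rearrangement preserves the product laws.
  have hmp : ∀ M : ℕ, MeasurePreserving
      (MeasurableEquiv.arrowProdEquivProdArrow (E d) ℝ (Fin M)).symm
      ((Measure.pi fun _ : Fin M => cond (volume : Measure (E d)) (box d L)).prod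
        (Measure.pi fun _ : Fin M => Pv)) (Measure.pi fun _ : Fin M => Q) := fun M =>
    (measurePreserving_arrowProdEquivProdArrow (E d) ℝ (Fin M)
      (fun _ => cond volume (box d L)) fun _ => Pv).symm
  have hae : ∀ M : ℕ, (fun x => inner ℂ ψ₁ (D (List.ofFn
      ((MeasurableEquiv.arrowProdEquivProdArrow (E d) ℝ (Fin M)).symm x)))) =ᵐ[
      (Measure.pi fun _ : Fin M => cond (volume : Measure (E d)) (box d L)).prod
        (Measure.pi fun _ : Fin M => Pv)] fun x => matrixElement B n L z ψ₁ ψ₂ ⟨M, x⟩ :=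
    fun M => by
      filter_upwards [ae_mem_box hL M] with x hx
      rw [matrixElement_eq B hL hz n ψ₁ ψ₂ (ω := ⟨M, x⟩) hx]
      rfl
  have hnorm : ∀ M : ℕ, ∫ x, ‖matrixElement B n L z ψ₁ ψ₂ ⟨M, x⟩‖
      ∂((Measure.pi fun _ : Fin M => cond (volume : Measure (E d)) (box d L)).prod
        (Measure.pi fun _ : Fin M => Pv)) =
      ∫ q : Fin M → E d × ℝ, ‖(inner ℂ ψ₁ (D (List.ofFn q)) : ℂ)‖ ∂(Measure.pi fun _ => Q) :=
    fun M => by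
      rw [← (hmp M).integral_comp']
      exact integral_congr_ae ((hae M).symm.mono fun x hx => congrArg norm hx)
  have hint : Integrable (matrixElement B n L z ψ₁ ψ₂) (configLaw d L Pv) := by
    refine integrable_sum_sigma (fun M => measure_ne_top _ _) (fun M => ?_) ?_
    · exact ((hmp M).integrable_comp_of_integrable (hh.integrable_pi hQ M)).congr (hae M)
    · simp_rw [hnorm]
      exact hh.summable_norm hQ _
  refine ⟨hint, ?_⟩
  have h1 := hasSum_integral_sigma hint
  have h2 := hh.hasSum_poissonMean hQ (volume (box d L)).toNNReal
  have h3 : expansionCoeff B Pv n L z ψ₁ ψ₂ =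
      poissonMean (volume (box d L)).toNNReal Q fun l => inner ℂ ψ₁ (D l) := by
    refine h1.unique ?_
    convert h2 using 2 with M
    rw [← (hmp M).integral_comp']
    congr 1
    exact integral_congr_ae (hae M).symm
  -- With no additional points the only sublist is `[]`, so the expectation is the single component
  -- there.
  have h4 := poissonMean_dyson hlam hρ hc two_le_markWeight hA (resolventFamily hz L) ψ₂ n []
  simp only [List.append_nil] at h4
  rw [h3, inner_poissonMean hQ hDt]
  exact congrArg (inner ℂ ψ₁) h4

end Law

end PoissonSchrodinger

end

/-! ### The main theorem. -/

open PoissonSchrodinger in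
theorem theorem2p3 (d : ℕ) (B : 𝓢(E d, ℝ))
    (hB : HasCompactSupport B ∨ ∀ (j : Fin d) (x : E d), B (reflect j x) = B x)
    (Pv : Measure ℝ) [IsProbabilityMeasure Pv]
    (hmom : ∀ k : ℕ, Integrable (fun v : ℝ => v ^ k) Pv) (n : ℕ) :
    (∀ L : ℝ, 0 < L → ∀ z : ℂ, z ∉ halfLine → ∀ ψ₁ ψ₂ : L2Space d,
      Integrable (matrixElement B n L z ψ₁ ψ₂) (configLaw d L Pv)) ∧
    (∀ z : ℂ, z ∉ halfLine → ∀ ψ₁ ψ₂ : L2Space d,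
      ∃ l : ℂ, Tendsto (fun L : ℝ => expansionCoeff B Pv n L z ψ₁ ψ₂) atTop (𝓝 l)) ∧
    (∃ K : ℝ, ∀ L : ℝ, 1 ≤ L → ∀ z : ℂ, z ∉ halfLine → ∀ ψ₁ ψ₂ : L2Space d,
      ‖expansionCoeff B Pv n L z ψ₁ ψ₂‖ ≤
        K * ‖ψ₁‖ * ‖ψ₂‖ / Metric.infDist z halfLine ^ (n + 1)) := by
  have hc : 0 ≤ SchwartzMap.seminorm ℝ 0 0 B := apply_nonneg _ _
  have hA := fieldFamily_boxKernel B hmom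
  refine ⟨fun L hL z hz ψ₁ ψ₂ => (integrable_matrixElement B hmom hL hz n ψ₁ ψ₂).1,
    fun z hz ψ₁ ψ₂ => ?_, ?_⟩
  · obtain ⟨f, hf⟩ := PoissonChaos.exists_tendsto_chaos_nil hc measurable_markWeight
      two_le_markWeight hA (R := resolventFamily hz) (fun L hL => norm_resolventFamily_le hz hL)
      (tendsto_resolventFamily_sub hz) ψ₂ n
    refine ⟨inner ℂ ψ₁ f, (tendsto_const_nhds.inner hf).congr' ?_⟩
    filter_upwards [eventually_gt_atTop 0] with L hL
    exact (integrable_matrixElement B hmom hL hz n ψ₁ ψ₂).2.symm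
  -- The pair `j = k = 0` is the unweighted norm of the expectation. The constant is chosen before
  -- the field and the resolvent, hence before `L`, `z` and the vectors.
  · obtain ⟨D, hD, H⟩ := PoissonChaos.exists_chaosNorm_chaos_le (𝓗 := L2Space d)
      (ρ := (volume : Measure (E d)).prod Pv) hc measurable_markWeight two_le_markWeight
      (fieldConst B Pv) (|∫ v, v ∂Pv| * ∫ y, ‖B y‖) n 0 0
    refine ⟨D.toReal, fun L hL z hz ψ₁ ψ₂ => ?_⟩
    have hL0 : 0 < L := zero_lt_one.trans_le hL
    have h1 := H _ _ (hA.bounds L hL0) (resolventFamily hz L) _ (norm_resolventFamily_le hz hL0) ψ₂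
    rw [PoissonChaos.chaosNorm_zero] at h1
    have h2 := ENNReal.toReal_mono (by finiteness) h1
    rw [toReal_enorm, ENNReal.toReal_mul, ENNReal.toReal_mul, ENNReal.toReal_pow,
      ENNReal.toReal_ofReal (inv_nonneg.2 Metric.infDist_nonneg), toReal_enorm] at h2
    rw [(integrable_matrixElement B hmom hL0 hz n ψ₁ ψ₂).2]
    refine (norm_inner_le_norm _ _).trans ((mul_le_mul_of_nonneg_left h2 (norm_nonneg _)).trans_eq ?_)
    rw [inv_pow]
    ring
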